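/- **Theorem (Tiles-SA).** Let $G$ be the square grid or the triangular grid in the plane, with unit edges. Words over the letters $\mathtt F,\mathtt +,\mathtt -,\mathtt 0$ are drawn on $G$ by turtle graphics from some grid point: $\mathtt F$ draws a unit edge in the current direction, $\mathtt +$ and $\mathtt -$ turn by $+\varphi$ and $-\varphi$, where $\varphi=90^\circ$ on the square grid and $\varphi=120^\circ$ on the triangular grid, and $\mathtt 0$ does nothing. Let $X$ be a word whose first and last letters are $\mathtt F$; if $G$ is the square grid, assume in addition that the curve of $X$ turns at each of its interior points, i.e. that any two consecutive edges drawn have different directions (on the triangular grid, non-turns are allowed). Consider the L-system map $\mathtt F\mapsto X$, with $\mathtt +,\mathtt -,\mathtt 0$ constant. For $n\ge 0$ let $C_n$ be the curve drawn by the $n$-th iterate of this map on the axiom $\mathtt F$, and let $C=\{C_n : n\ge 0\}$. Let the tile $T_{+1}$ be the closed curve drawn by the first iterate on the axiom $\mathtt{F+F+F+F}$ (square grid) or $\mathtt{F+F+F}$ (triangular grid), and the tile $T_{-1}$ the one drawn by the first iterate on the axiom $\mathtt{F-F-F-F}$ (square grid) or $\mathtt{F-F-F}$ (triangular grid). A curve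 is called self-avoiding if it traverses no edge twice (in either direction) and does not cross itself; it may touch itself at grid points. It crosses itself if two of its passages through the same grid point use four different edges at that point and the two edges of one passage separate the two edges of the other in the cyclic order around the point. For a tile, the passage from its last edge to its first edge is included (it is a passage through a grid point only if the curve returns to its initial point). $C$ is called self-avoiding if every $C_n$ is. Then $C$ is self-avoiding if and only if both tiles $T_{+1}$ and $T_{-1}$ are self-avoiding. -/

import Mathlib

/-! # L-systems -/

/-- A (deterministic, context-free) Lindenmayer system over the alphabet `Ω`: a start word (the
"axiom" of the L-system) and, for every letter, the word it is mapped to. -/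
structure LSystem (Ω : Type) where
  start : List Ω
  production : Ω → List Ω

/-- The `n`-th iterate: the start word after every letter has been replaced by its production,
simultaneously, `n` times. -/
def LSystem.iterate {Ω : Type} (L : LSystem Ω) : ℕ → List Ω
  | 0 => L.start
  | n + 1 => (L.iterate n).flatMap L.production

/-- The alphabet `F`, `+`, `-`, `0`. -/
inductive Letter
  | F
  | plus
  | minus
  | zero
  deriving DecidableEq

/-- The simple L-system with start word `A` and the map `F ↦ X`; the letters `+`, `-` and `0` are
constants. -/
def simpleLSystem (A X : List Letter) : LSystem Letter where
  start := A
  production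
    | Letter.F => X
    | Letter.plus => [Letter.plus]
    | Letter.minus => [Letter.minus]
    | Letter.zero => [Letter.zero]

/-! # Grids and turtle graphics -/

/-- The two grids: the square grid and the triangular grid. -/
inductive Grid
  | square
  | triangular

/-- The number of edges incident to a grid point, which is also the number of headings. -/
def Grid.deg : Grid → ℕ
  | .square => 4
  | .triangular => 6

/-- A heading; `h` stands for the direction at angle `h * (360 / deg)` degrees, counted
counterclockwise. -/
abbrev Grid.Heading (G : Grid) : Type := ZMod G.deg

/-- The grid point `(a, b)` is the point `a + b * ω` of the complex plane, where `ω = i` for the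
square grid and `ω = exp (i * π / 3)` for the triangular grid. -/
abbrev Grid.Point (_ : Grid) : Type := ℤ × ℤ

/-- The unit vector in the direction of a heading. -/
def Grid.step : (G : Grid) → G.Heading → G.Point
  | .square => fun h => (![(1, 0), (0, 1), (-1, 0), (0, -1)] : Fin 4 → ℤ × ℤ) h
  | .triangular => fun h =>
      (![(1, 0), (0, 1), (-1, 1), (-1, 0), (0, -1), (1, -1)] : Fin 6 → ℤ × ℤ) h

/-- The turn made by the letter `+`: 90 degrees on the square grid (one unit of heading) and
120 degrees on the triangular grid (two units of heading). -/
def Grid.turn : (G : Grid) → G.Heading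
  | .square => (1 : ZMod 4)
  | .triangular => (2 : ZMod 6)

/-- A unit stroke: the grid edge from `source` in the direction `heading`. -/
structure Stroke (G : Grid) where
  source : G.Point
  heading : G.Heading

/-- The endpoint of a stroke. -/
def Stroke.target {G : Grid} (e : Stroke G) : G.Point := e.source + G.step e.heading

/-- The undirected grid edge that a stroke traverses. -/
def Stroke.edge {G : Grid} (e : Stroke G) : Sym2 G.Point := s(e.source, e.target)

/-- The strokes drawn by a turtle that starts at `p` with heading `h` and reads a word. -/
def turtle (G : Grid) : G.Point → G.Heading → List Letter → List (Stroke G)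
  | _, _, [] => []
  | p, h, Letter.F :: w => ⟨p, h⟩ :: turtle G (p + G.step h) h w
  | p, h, Letter.plus :: w => turtle G p (h + G.turn) w
  | p, h, Letter.minus :: w => turtle G p (h - G.turn) w
  | p, h, Letter.zero :: w => turtle G p h w

/-- The curve of a word. The initial position and heading do not matter; we take `0` for both. -/
def curve (G : Grid) (w : List Letter) : List (Stroke G) := turtle G 0 0 w

/-! # Self-avoidance -/

/-- The pairs of consecutive strokes of a curve, that is, its passages through grid points. -/
def passages {G : Grid} (c : List (Stroke G)) : List (Stroke G × Stroke G) := c.zip c.tail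

/-- The passages of a curve that is regarded as closed: the passage from the last stroke to the
first one is included. -/
def closedPassages {G : Grid} (c : List (Stroke G)) : List (Stroke G × Stroke G) :=
  c.zip (c.rotate 1)

/-- The edge at which a passage enters its grid point, as seen from that point: the heading
opposite to the one of the incoming stroke. -/
def entrySide {G : Grid} (p : Stroke G × Stroke G) : G.Heading :=
  p.1.heading + ((G.deg / 2 : ℕ) : G.Heading)

/-- The edge at which a passage leaves its grid point, as seen from that point. -/
def exitSide {G : Grid} (p : Stroke G × Stroke G) : G.Heading := p.2.heading

/-- Going counterclockwise from `a`, one meets `c` strictly after `a` and strictly before `b`. -/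
def StrictlyBetween {G : Grid} (a b c : G.Heading) : Prop :=
  0 < (c - a).val ∧ (c - a).val < (b - a).val

/-- Two passages cross: they are passages through the same grid point, they use four different
incident edges, and the two edges of the first separate the two edges of the second in the cyclic
order of the edges around that point. -/
def Cross {G : Grid} (p q : Stroke G × Stroke G) : Prop :=
  (p.1.target = p.2.source ∧ q.1.target = q.2.source ∧ p.2.source = q.2.source) ∧
  (entrySide q ≠ entrySide p ∧ entrySide q ≠ exitSide p ∧
    exitSide q ≠ entrySide p ∧ exitSide q ≠ exitSide p) ∧
  (StrictlyBetween (entrySide p) (exitSide p) (entrySide q) ↔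
    ¬ StrictlyBetween (entrySide p) (exitSide p) (exitSide q))

/-- A curve is self-avoiding if it traverses no edge twice (in either direction) and does not
cross itself. It may touch itself at grid points. -/
def SelfAvoiding {G : Grid} (c : List (Stroke G)) : Prop :=
  (c.map Stroke.edge).Nodup ∧ ∀ p ∈ passages c, ∀ q ∈ passages c, ¬ Cross p q

/-- Self-avoidance of a closed curve; here the passage through the initial point counts, too. -/
def ClosedSelfAvoiding {G : Grid} (c : List (Stroke G)) : Prop :=
  (c.map Stroke.edge).Nodup ∧ ∀ p ∈ closedPassages c, ∀ q ∈ closedPassages c, ¬ Cross p q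

/-! # The curves of a simple L-system and its tiles -/

/-- The production words under consideration. The first and the last letter are `F`, that is, no
turns stand at the ends of the word. On the square grid the curve has to turn at each of its
interior points: consecutive strokes have different headings. On the triangular grid, non-turns
are allowed. -/
def IsAdmissible (G : Grid) (X : List Letter) : Prop :=
  X.head? = some Letter.F ∧ X.getLast? = some Letter.F ∧
  match G with
  | .square => ∀ p ∈ passages (curve .square X), p.1.heading ≠ p.2.heading
  | .triangular => True

/-- The set of all iterates `C_n`, `n ≥ 0`, of the curve with map `F ↦ X` (and start word `F`). -/
def iterates (G : Grid) (X : List Letter) : Set (List (Stroke G)) :=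
  Set.range fun n : ℕ => curve G ((simpleLSystem [Letter.F] X).iterate n)

/-- The number of sides of the tiles before any map is applied: 4 (square grid), 3 (triangular
grid). -/
def Grid.sides : Grid → ℕ
  | .square => 4
  | .triangular => 3

/-- The word `F t F t ... t F` with as many `F` as the tile has sides: `F+F+F+F` or `F-F-F-F` on the
square grid, and `F+F+F` or `F-F-F` on the triangular grid. -/
def tileStart (G : Grid) (t : Letter) : List Letter :=
  (List.replicate G.sides Letter.F).intersperse t

/-- The tile: the first iterate of the L-system with map `F ↦ X` and start word `tileStart G t`;
the tile with index `+1` is the one for `t = +`, the tile with index `-1` the one for `t = -`. -/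
def tile (G : Grid) (X : List Letter) (t : Letter) : List (Stroke G) :=
  curve G ((simpleLSystem (tileStart G t) X).iterate 1)

/-! Orient the grid. On the square grid a curve that turns at every point alternates between
horizontal and vertical strokes; on the triangular grid all headings are multiples of 120 degrees.
So each edge can be traversed in one direction only (`Stroke.Positive`,
`Stroke.Positive.edge_injective`). The faces then fall into two classes, left faces and right faces
of strokes: a left turn keeps the left face, a right turn keeps the right face, and a stroke is
determined by its two faces. Traversing no edge twice means injectivity of the sequence of strokes,
and only two straight passages can cross (`cross_iff`), which concerns the triangular grid alone.

The topology comes from winding numbers, defined as signed crossings with a horizontal ray. Across a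
stroke the winding number of a closed walk jumps by the number of traversals
(`winding_left_sub_right`). This yields a discrete Jordan curve theorem and the theorem of turning
tangents (`IsSimpleClosed.exists_sum_turnInt`), and also the vanishing of the total turn for curves
with a translational symmetry (`sum_turnInt_eq_zero`).

From tiles to curves: the next iterate replaces each stroke of the current one by a copy of the
curve of $X$, rotated and put on a grid that is scaled and rotated by the displacement of $X$
(`walk_substTurns`). Turning tangents for both tiles force the curve of $X$ to end with its initial
heading (`lastHeading_eq_zero`) and to have total turn 0, so that one tile runs counterclockwise and
the other one clockwise. Put a copy of a tile along the boundary of every face of the coarse grid.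
In a large parallelogram the copies along inner edges cancel, and the boundary winds once around a
given fine face (`exists_sum_cellWinding`). No tile contributes negatively, so a fine face is
enclosed by at most one tile (`faceWinding_unique`). Hence a stroke of the next iterate determines
the two coarse faces beside the coarse stroke that it stems from, and so this stroke itself. Every
repetition or crossing is thereby traced back to $X$ or to the current iterate
(`SimpleOn.substTurns`), and induction applies.

From curves to tiles: if the turn $l$ occurs in $X$, then $C_2$ contains two copies of $X$ joined by
$l$, which are two consecutive sides of a tile. Unless $X$ is straight, both turns occur, and the
end heading is such that the tiles close up (`exists_ne_of_simpleOn_square`, `lastHeading_even`,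
`totalTurn_eq_zero`). A triangle has only consecutive sides. On the square grid, opposite sides that
meet would give a closed walk with a half-turn symmetry about the center of the tile. Its image
under a quarter-turn has no stroke in common with it, yet both surround the center and have
congruent extents, which is impossible (`false_of_quarter_turn`). -/

/-! # Arithmetic of the two grids -/

/-- Multiplication of grid points, regarded as the complex numbers `a + b * ω`. -/
def Grid.mul : (G : Grid) → G.Point → G.Point → G.Point
  | .square, p, q => (p.1 * q.1 - p.2 * q.2, p.1 * q.2 + p.2 * q.1)
  | .triangular, p, q => (p.1 * q.1 - p.2 * q.2, p.1 * q.2 + p.2 * q.1 + p.2 * q.2)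

theorem Grid.mul_comm (G : Grid) (p q : G.Point) : G.mul p q = G.mul q p := by
  cases G <;> ext <;> simp only [Grid.mul] <;> ring

theorem Grid.mul_assoc (G : Grid) (p q r : G.Point) :
    G.mul (G.mul p q) r = G.mul p (G.mul q r) := by
  cases G <;> ext <;> simp only [Grid.mul] <;> ring

theorem Grid.mul_add (G : Grid) (p q r : G.Point) :
    G.mul p (q + r) = G.mul p q + G.mul p r := by
  cases G <;> ext <;> simp only [Grid.mul, Prod.fst_add, Prod.snd_add] <;> ring

theorem Grid.add_mul (G : Grid) (p q r : G.Point) :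
    G.mul (p + q) r = G.mul p r + G.mul q r := by
  rw [G.mul_comm, G.mul_add, G.mul_comm r p, G.mul_comm r q]

theorem Grid.square_heading (h : Grid.square.Heading) : h = 0 ∨ h = 1 ∨ h = 2 ∨ h = 3 := by
  have : ∀ h : ZMod 4, h = 0 ∨ h = 1 ∨ h = 2 ∨ h = 3 := by decide
  exact this h

theorem Grid.triangular_heading (h : Grid.triangular.Heading) :
    h = 0 ∨ h = 1 ∨ h = 2 ∨ h = 3 ∨ h = 4 ∨ h = 5 := by
  have : ∀ h : ZMod 6, h = 0 ∨ h = 1 ∨ h = 2 ∨ h = 3 ∨ h = 4 ∨ h = 5 := by decide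
  exact this h

theorem Grid.step_square_zero : Grid.step .square 0 = ((1, 0) : ℤ × ℤ) := rfl
theorem Grid.step_square_one : Grid.step .square 1 = ((0, 1) : ℤ × ℤ) := rfl
theorem Grid.step_square_two : Grid.step .square 2 = ((-1, 0) : ℤ × ℤ) := rfl
theorem Grid.step_square_three : Grid.step .square 3 = ((0, -1) : ℤ × ℤ) := rfl
theorem Grid.step_triangular_zero : Grid.step .triangular 0 = ((1, 0) : ℤ × ℤ) := rfl
theorem Grid.step_triangular_one : Grid.step .triangular 1 = ((0, 1) : ℤ × ℤ) := rfl
theorem Grid.step_triangular_two : Grid.step .triangular 2 = ((-1, 1) : ℤ × ℤ) := rfl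
theorem Grid.step_triangular_three : Grid.step .triangular 3 = ((-1, 0) : ℤ × ℤ) := rfl
theorem Grid.step_triangular_four : Grid.step .triangular 4 = ((0, -1) : ℤ × ℤ) := rfl
theorem Grid.step_triangular_five : Grid.step .triangular 5 = ((1, -1) : ℤ × ℤ) := rfl

attribute [simp] Grid.step_square_zero Grid.step_square_one Grid.step_square_two
  Grid.step_square_three Grid.step_triangular_zero Grid.step_triangular_one
  Grid.step_triangular_two Grid.step_triangular_three Grid.step_triangular_four
  Grid.step_triangular_five

theorem Grid.step_zero (G : Grid) : G.step 0 = ((1, 0) : ℤ × ℤ) := by cases G <;> rfl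

theorem Grid.one_mul (G : Grid) (p : G.Point) : G.mul (1, 0) p = p := by
  cases G <;> ext <;> simp [Grid.mul]

theorem Grid.zero_mul (G : Grid) (p : G.Point) : G.mul 0 p = 0 := by
  cases G <;> ext <;> simp [Grid.mul]

theorem Grid.mul_zero (G : Grid) (p : G.Point) : G.mul p 0 = 0 := by
  rw [G.mul_comm, G.zero_mul]

theorem Grid.step_add (G : Grid) (h k : G.Heading) :
    G.step (h + k) = G.mul (G.step h) (G.step k) := by
  revert h k
  cases G
  · show ∀ h k : ZMod 4, _
    decide
  · show ∀ h k : ZMod 6, _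
    decide

/-! # Strokes -/

@[ext]
theorem Stroke.ext {G : Grid} {s t : Stroke G} (h₁ : s.source = t.source)
    (h₂ : s.heading = t.heading) : s = t := by
  cases s; cases t; simp_all

noncomputable instance {G : Grid} : DecidableEq (Stroke G) := Classical.decEq _

/-- The image of a stroke under the rotation about the origin by the heading `h`, followed by the
translation by `z`. -/
def Stroke.move {G : Grid} (z : G.Point) (h : G.Heading) (s : Stroke G) : Stroke G :=
  ⟨z + G.mul (G.step h) s.source, h + s.heading⟩

theorem Stroke.move_target {G : Grid} (z : G.Point) (h : G.Heading) (s : Stroke G) :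
    (s.move z h).target = z + G.mul (G.step h) s.target := by
  simp only [Stroke.target, Stroke.move, G.mul_add, G.step_add, add_assoc]

theorem Stroke.move_move {G : Grid} (z z' : G.Point) (h h' : G.Heading) (s : Stroke G) :
    (s.move z' h').move z h = s.move (z + G.mul (G.step h) z') (h + h') := by
  simp only [Stroke.move, G.mul_add, G.step_add, G.mul_assoc, add_assoc]

theorem Stroke.move_zero {G : Grid} (s : Stroke G) : s.move 0 0 = s := by
  simp [Stroke.move, G.step_zero, G.one_mul]

theorem Stroke.move_injective {G : Grid} (z : G.Point) (h : G.Heading) :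
    Function.Injective (Stroke.move z h) := by
  intro s t hst
  have : ∀ s : Stroke G, (s.move z h).move (-(G.mul (G.step (-h)) z)) (-h) = s := by
    intro s
    rw [Stroke.move_move, neg_add_cancel, neg_add_cancel, Stroke.move_zero]
  rw [← this s, hst, this t]

/-- The strokes that a curve starting at the origin with heading `0` can contain: on the triangular
grid those with a heading that is a multiple of 120 degrees, on the square grid those for which the
parity of the heading agrees with the parity of the source. -/
def Stroke.Positive : {G : Grid} → Stroke G → Prop
  | .square, s => (s.source.1 + s.source.2) % 2 = 0 ∧ (s.heading = 0 ∨ s.heading = 2) ∨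
      (s.source.1 + s.source.2) % 2 = 1 ∧ (s.heading = 1 ∨ s.heading = 3)
  | .triangular, s => s.heading = 0 ∨ s.heading = 2 ∨ s.heading = 4

theorem Stroke.Positive.square_cases {s : Stroke .square} (hs : s.Positive) :
    ∃ a b : ℤ, (a + b) % 2 = 0 ∧ s = ⟨(a, b), 0⟩ ∨ (a + b) % 2 = 1 ∧ s = ⟨(a, b), 1⟩ ∨
      (a + b) % 2 = 0 ∧ s = ⟨(a, b), 2⟩ ∨ (a + b) % 2 = 1 ∧ s = ⟨(a, b), 3⟩ := by
  obtain ⟨⟨a, b⟩, h⟩ := s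
  refine ⟨a, b, ?_⟩
  rcases hs with ⟨h1, h2 | h2⟩ | ⟨h1, h2 | h2⟩ <;> simp only at h1 h2 <;> subst h2
  · exact Or.inl ⟨h1, rfl⟩
  · exact Or.inr (Or.inr (Or.inl ⟨h1, rfl⟩))
  · exact Or.inr (Or.inl ⟨h1, rfl⟩)
  · exact Or.inr (Or.inr (Or.inr ⟨h1, rfl⟩))

theorem Stroke.Positive.triangular_cases {s : Stroke .triangular} (hs : s.Positive) :
    ∃ a b : ℤ, s = ⟨(a, b), 0⟩ ∨ s = ⟨(a, b), 2⟩ ∨ s = ⟨(a, b), 4⟩ := by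
  obtain ⟨⟨a, b⟩, h⟩ := s
  refine ⟨a, b, ?_⟩
  rcases hs with h2 | h2 | h2 <;> simp only at h2 <;> subst h2 <;> simp

/-- The face to the left of a positive stroke. The faces of the grid in the horizontal strip
between the heights `b` and `b + 1` are the pairs `(j, b)`, from left to right. -/
def Stroke.leftFace : {G : Grid} → Stroke G → ℤ × ℤ
  | .square, s =>
    if s.heading = 0 then (s.source.1, s.source.2)
    else if s.heading = 1 then (s.source.1 - 1, s.source.2)
    else if s.heading = 2 then (s.source.1 - 1, s.source.2 - 1)
    else (s.source.1, s.source.2 - 1)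
  | .triangular, s =>
    if s.heading = 0 then (2 * s.source.1, s.source.2)
    else if s.heading = 2 then (2 * s.source.1 - 2, s.source.2)
    else (2 * s.source.1, s.source.2 - 1)

/-- The face to the right of a positive stroke. -/
def Stroke.rightFace : {G : Grid} → Stroke G → ℤ × ℤ
  | .square, s =>
    if s.heading = 0 then (s.source.1, s.source.2 - 1)
    else if s.heading = 1 then (s.source.1, s.source.2)
    else if s.heading = 2 then (s.source.1 - 1, s.source.2)
    else (s.source.1 - 1, s.source.2 - 1)
  | .triangular, s =>
    if s.heading = 0 then (2 * s.source.1 + 1, s.source.2 - 1)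
    else if s.heading = 2 then (2 * s.source.1 - 1, s.source.2)
    else (2 * s.source.1 - 1, s.source.2 - 1)

/-- The contribution of a positive stroke to the winding number around a face: the signed number of
crossings with the horizontal ray from the face to the right. -/
def Stroke.crossing : {G : Grid} → Stroke G → ℤ × ℤ → ℤ
  | .square, s, f =>
    if s.heading = 1 then (if f.2 = s.source.2 ∧ f.1 < s.source.1 then 1 else 0)
    else if s.heading = 3 then (if f.2 = s.source.2 - 1 ∧ f.1 < s.source.1 then -1 else 0)
    else 0
  | .triangular, s, f =>
    if s.heading = 2 then (if f.2 = s.source.2 ∧ f.1 < 2 * s.source.1 - 1 then 1 else 0)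
    else if s.heading = 4 then (if f.2 = s.source.2 - 1 ∧ f.1 < 2 * s.source.1 then -1 else 0)
    else 0

/-- The sign with which a point lies ahead of a horizontal edge, that is, on the same horizontal
line and to the right. -/
def Stroke.ahead : {G : Grid} → Stroke G → G.Point → ℤ
  | .square, s, p =>
    if s.heading = 0 then (if p.2 = s.source.2 ∧ s.source.1 + 1 ≤ p.1 then 1 else 0)
    else if s.heading = 2 then (if p.2 = s.source.2 ∧ s.source.1 ≤ p.1 then -1 else 0)
    else 0
  | .triangular, s, p =>
    if s.heading = 0 then (if p.2 = s.source.2 ∧ s.source.1 + 1 ≤ p.1 then 1 else 0)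
    else 0

/-- If the faces beside `e` lie in one row, their rays differ only in crossing `e`. If `e` is
horizontal, the rays run above and below its line, and a stroke that reaches or leaves this line
ahead of `e` meets just one of them. The `ahead` terms record this; they telescope along a walk. -/
theorem Stroke.crossing_left_sub_right {G : Grid} {s e : Stroke G} (hs : s.Positive)
    (he : e.Positive) :
    s.crossing e.leftFace - s.crossing e.rightFace =
      (if s = e then 1 else 0) + e.ahead s.source - e.ahead s.target := by
  cases G
  · obtain ⟨a, b, hs⟩ := hs.square_cases
    obtain ⟨c, d, he⟩ := he.square_cases
    rcases hs with ⟨h1, rfl⟩ | ⟨h1, rfl⟩ | ⟨h1, rfl⟩ | ⟨h1, rfl⟩ <;>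
    rcases he with ⟨h2, rfl⟩ | ⟨h2, rfl⟩ | ⟨h2, rfl⟩ | ⟨h2, rfl⟩ <;>
    simp (decide := true) only [Stroke.crossing, Stroke.leftFace, Stroke.rightFace, Stroke.ahead, Stroke.target,
      Stroke.mk.injEq, Prod.mk.injEq, if_true, if_false, and_true, and_false, Prod.fst_add, Prod.snd_add,
      Grid.step_square_zero, Grid.step_square_one, Grid.step_square_two,
      Grid.step_square_three] <;>
    (split_ifs <;> omega)
  · obtain ⟨a, b, hs⟩ := hs.triangular_cases
    obtain ⟨c, d, he⟩ := he.triangular_cases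
    rcases hs with rfl | rfl | rfl <;>
    rcases he with rfl | rfl | rfl <;>
    simp (decide := true) only [Stroke.crossing, Stroke.leftFace, Stroke.rightFace, Stroke.ahead, Stroke.target,
      Stroke.mk.injEq, Prod.mk.injEq, if_true, if_false, and_true, and_false, Prod.fst_add, Prod.snd_add,
      Grid.step_triangular_zero, Grid.step_triangular_two, Grid.step_triangular_four] <;>
    (split_ifs <;> omega)


/-! # Local geometry of positive strokes -/

/-- A unit step flips the parity of a point of the square grid, so positivity there forces a change
between horizontal and vertical. -/
theorem Stroke.Positive.turn_cases {G : Grid} {s t : Stroke G} (hs : s.Positive) (ht : t.Positive)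
    (h : t.source = s.target) :
    t.heading = s.heading + G.turn ∨ t.heading = s.heading - G.turn ∨
      (G = .triangular ∧ t.heading = s.heading) := by
  cases G
  · obtain ⟨a, b, hs⟩ := hs.square_cases
    obtain ⟨c, d, ht⟩ := ht.square_cases
    rcases hs with ⟨h1, rfl⟩ | ⟨h1, rfl⟩ | ⟨h1, rfl⟩ | ⟨h1, rfl⟩ <;>
    rcases ht with ⟨h2, rfl⟩ | ⟨h2, rfl⟩ | ⟨h2, rfl⟩ | ⟨h2, rfl⟩ <;>
    simp only [Stroke.target, Prod.ext_iff, Prod.fst_add, Prod.snd_add, Grid.step_square_zero,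
      Grid.step_square_one, Grid.step_square_two, Grid.step_square_three] at h <;>
    first
    | exact Or.inl (by dsimp only; decide)
    | exact Or.inr (Or.inl (by dsimp only; decide))
    | (exfalso; omega)
  · obtain ⟨a, b, hs⟩ := hs.triangular_cases
    obtain ⟨c, d, ht⟩ := ht.triangular_cases
    rcases hs with rfl | rfl | rfl <;>
    rcases ht with rfl | rfl | rfl <;>
    first
    | exact Or.inl (by dsimp only; decide)
    | exact Or.inr (Or.inl (by dsimp only; decide))
    | exact Or.inr (Or.inr ⟨rfl, by dsimp only⟩)

theorem Stroke.Positive.leftFace_eq {G : Grid} {s t : Stroke G} (hs : s.Positive)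
    (ht : t.Positive) (h : t.source = s.target) (hl : t.heading = s.heading + G.turn) :
    t.leftFace = s.leftFace := by
  cases G
  · obtain ⟨a, b, hs⟩ := hs.square_cases
    obtain ⟨c, d, ht⟩ := ht.square_cases
    rcases hs with ⟨h1, rfl⟩ | ⟨h1, rfl⟩ | ⟨h1, rfl⟩ | ⟨h1, rfl⟩ <;>
    rcases ht with ⟨h2, rfl⟩ | ⟨h2, rfl⟩ | ⟨h2, rfl⟩ | ⟨h2, rfl⟩ <;>
    simp only [Stroke.target, Prod.ext_iff, Prod.fst_add, Prod.snd_add, Grid.step_square_zero,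
      Grid.step_square_one, Grid.step_square_two, Grid.step_square_three] at h <;>
    first
    | (exfalso; dsimp only at hl; revert hl; decide)
    | (simp (decide := true) only [Stroke.leftFace, if_true, if_false, Prod.ext_iff]; omega)
  · obtain ⟨a, b, hs⟩ := hs.triangular_cases
    obtain ⟨c, d, ht⟩ := ht.triangular_cases
    rcases hs with rfl | rfl | rfl <;>
    rcases ht with rfl | rfl | rfl <;>
    simp only [Stroke.target, Prod.ext_iff, Prod.fst_add, Prod.snd_add, Grid.step_triangular_zero,
      Grid.step_triangular_two, Grid.step_triangular_four] at h <;>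
    first
    | (exfalso; dsimp only at hl; revert hl; decide)
    | (simp (decide := true) only [Stroke.leftFace, if_true, if_false, Prod.ext_iff]; omega)

theorem Stroke.Positive.rightFace_eq {G : Grid} {s t : Stroke G} (hs : s.Positive)
    (ht : t.Positive) (h : t.source = s.target) (hl : t.heading = s.heading - G.turn) :
    t.rightFace = s.rightFace := by
  cases G
  · obtain ⟨a, b, hs⟩ := hs.square_cases
    obtain ⟨c, d, ht⟩ := ht.square_cases
    rcases hs with ⟨h1, rfl⟩ | ⟨h1, rfl⟩ | ⟨h1, rfl⟩ | ⟨h1, rfl⟩ <;>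
    rcases ht with ⟨h2, rfl⟩ | ⟨h2, rfl⟩ | ⟨h2, rfl⟩ | ⟨h2, rfl⟩ <;>
    simp only [Stroke.target, Prod.ext_iff, Prod.fst_add, Prod.snd_add, Grid.step_square_zero,
      Grid.step_square_one, Grid.step_square_two, Grid.step_square_three] at h <;>
    first
    | (exfalso; dsimp only at hl; revert hl; decide)
    | (simp (decide := true) only [Stroke.rightFace, if_true, if_false, Prod.ext_iff]; omega)
  · obtain ⟨a, b, hs⟩ := hs.triangular_cases
    obtain ⟨c, d, ht⟩ := ht.triangular_cases
    rcases hs with rfl | rfl | rfl <;>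
    rcases ht with rfl | rfl | rfl <;>
    simp only [Stroke.target, Prod.ext_iff, Prod.fst_add, Prod.snd_add, Grid.step_triangular_zero,
      Grid.step_triangular_two, Grid.step_triangular_four] at h <;>
    first
    | (exfalso; dsimp only at hl; revert hl; decide)
    | (simp (decide := true) only [Stroke.rightFace, if_true, if_false, Prod.ext_iff]; omega)

/-- On the triangular grid: the edge that leaves the source of a stroke to the left of the
straight line through the stroke. -/
def Stroke.sideOut (s : Stroke .triangular) : Stroke .triangular := ⟨s.source, s.heading + 2⟩

/-- On the triangular grid: the edge that enters the source of a stroke on the left of the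
straight line through the stroke. -/
def Stroke.sideIn (s : Stroke .triangular) : Stroke .triangular :=
  ⟨s.source - Grid.step .triangular (s.heading + 4), s.heading + 4⟩

theorem Stroke.Positive.sideOut {s : Stroke .triangular} (hs : s.Positive) :
    s.sideOut.Positive := by
  obtain ⟨a, b, hs⟩ := hs.triangular_cases
  rcases hs with rfl | rfl | rfl <;> simp only [Stroke.sideOut, Stroke.Positive] <;> decide

theorem Stroke.Positive.sideIn {s : Stroke .triangular} (hs : s.Positive) :
    s.sideIn.Positive := by
  obtain ⟨a, b, hs⟩ := hs.triangular_cases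
  rcases hs with rfl | rfl | rfl <;> simp only [Stroke.sideIn, Stroke.Positive] <;> decide

theorem Stroke.sideIn_target (s : Stroke .triangular) : s.sideIn.target = s.source := by
  simp [Stroke.sideIn, Stroke.target]

theorem Grid.two_add_four : (2 : Grid.triangular.Heading) + 4 = 0 := by decide
theorem Grid.four_add_four : (4 : Grid.triangular.Heading) + 4 = 2 := by decide
theorem Grid.two_add_two : (2 : Grid.triangular.Heading) + 2 = 4 := by decide
theorem Grid.four_add_two : (4 : Grid.triangular.Heading) + 2 = 0 := by decide

/-- Clockwise around the source of a stroke `t` that continues a stroke `s` straight on, the left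
side shows in turn: the left face of `s`, the edge `sideOut`, a face in between, the edge `sideIn`,
the left face of `t`. -/
theorem Stroke.Positive.side_faces {s : Stroke .triangular} (hs : s.Positive) :
    s.sideIn.leftFace = s.leftFace ∧ s.sideIn.rightFace = s.sideOut.rightFace := by
  obtain ⟨a, b, hs⟩ := hs.triangular_cases
  rcases hs with rfl | rfl | rfl <;>
    simp only [Stroke.sideIn, Stroke.sideOut, Grid.two_add_four, Grid.four_add_four,
      Grid.two_add_two, Grid.four_add_two, zero_add, Grid.step_triangular_zero,
      Grid.step_triangular_two, Grid.step_triangular_four] <;>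
    simp (decide := true) only [Stroke.leftFace, Stroke.rightFace, if_true, if_false,
      Prod.ext_iff, Prod.fst_sub, Prod.snd_sub, and_true] <;> omega

theorem Stroke.Positive.sideOut_leftFace {s t : Stroke .triangular} (hs : s.Positive)
    (h : t.source = s.target) (hh : t.heading = s.heading) : t.sideOut.leftFace = s.leftFace := by
  obtain ⟨a, b, hs⟩ := hs.triangular_cases
  obtain ⟨⟨c, d⟩, k⟩ := t
  rcases hs with rfl | rfl | rfl <;> simp only at hh <;> subst hh <;>
    simp only [Stroke.target, Prod.ext_iff, Prod.fst_add, Prod.snd_add, Grid.step_triangular_zero,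
      Grid.step_triangular_two, Grid.step_triangular_four] at h <;>
    simp only [Stroke.sideOut, Grid.two_add_two, Grid.four_add_two, zero_add] <;>
    simp (decide := true) only [Stroke.leftFace, if_true, if_false, Prod.ext_iff] <;> omega

theorem Stroke.Positive.sideIn_rightFace {s t : Stroke .triangular} (hs : s.Positive)
    (h : t.source = s.target) (hh : t.heading = s.heading) {q : Stroke .triangular}
    (hq : q.target = t.source) (hqh : q.heading = s.heading + 2) :
    t.rightFace = q.rightFace := by
  obtain ⟨a, b, hs⟩ := hs.triangular_cases
  obtain ⟨⟨c, d⟩, k⟩ := t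
  obtain ⟨⟨c', d'⟩, k'⟩ := q
  rcases hs with rfl | rfl | rfl <;> simp only at hh hqh <;> subst hh <;>
    simp only [Grid.two_add_two, Grid.four_add_two, zero_add] at hqh <;> subst hqh <;>
    simp only [Stroke.target, Prod.ext_iff, Prod.fst_add, Prod.snd_add, Grid.step_triangular_zero,
      Grid.step_triangular_two, Grid.step_triangular_four] at h hq <;>
    simp (decide := true) only [Stroke.rightFace, if_true, if_false, Prod.ext_iff] <;> omega

theorem Stroke.crossing_ne {G : Grid} {s : Stroke G} (hs : s.Positive) {j b : ℤ}
    (h : s.crossing (j, b) ≠ s.crossing (j + 1, b)) :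
    (s.leftFace = (j, b) ∧ s.rightFace = (j + 1, b)) ∨
      (s.leftFace = (j + 1, b) ∧ s.rightFace = (j, b)) := by
  cases G
  · obtain ⟨c, d, hs⟩ := hs.square_cases
    rcases hs with ⟨h1, rfl⟩ | ⟨h1, rfl⟩ | ⟨h1, rfl⟩ | ⟨h1, rfl⟩ <;>
    simp (decide := true) only [Stroke.crossing, if_true, if_false, ne_eq] at h <;>
    simp (decide := true) only [Stroke.leftFace, Stroke.rightFace, if_true, if_false,
      Prod.ext_iff] <;> split_ifs at h <;> omega
  · obtain ⟨c, d, hs⟩ := hs.triangular_cases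
    rcases hs with rfl | rfl | rfl <;>
    simp (decide := true) only [Stroke.crossing, if_true, if_false, ne_eq] at h <;>
    simp (decide := true) only [Stroke.leftFace, Stroke.rightFace, if_true, if_false,
      Prod.ext_iff] <;> split_ifs at h <;> omega

theorem Stroke.Positive.eq_of_faces {G : Grid} {s t : Stroke G} (hs : s.Positive)
    (ht : t.Positive) (hl : s.leftFace = t.leftFace) (hr : s.rightFace = t.rightFace) : s = t := by
  cases G
  · obtain ⟨a, b, hs⟩ := hs.square_cases
    obtain ⟨c, d, ht⟩ := ht.square_cases
    rcases hs with ⟨h1, rfl⟩ | ⟨h1, rfl⟩ | ⟨h1, rfl⟩ | ⟨h1, rfl⟩ <;>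
    rcases ht with ⟨h2, rfl⟩ | ⟨h2, rfl⟩ | ⟨h2, rfl⟩ | ⟨h2, rfl⟩ <;>
    simp (decide := true) only [Stroke.leftFace, Stroke.rightFace, if_true, if_false,
      Prod.ext_iff] at hl hr <;>
    first
    | (exfalso; omega)
    | (congr 2 <;> omega)
  · obtain ⟨a, b, hs⟩ := hs.triangular_cases
    obtain ⟨c, d, ht⟩ := ht.triangular_cases
    rcases hs with rfl | rfl | rfl <;>
    rcases ht with rfl | rfl | rfl <;>
    simp (decide := true) only [Stroke.leftFace, Stroke.rightFace, if_true, if_false,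
      Prod.ext_iff] at hl hr <;>
    first
    | (exfalso; omega)
    | (congr 2 <;> omega)

/-- The reverse of a positive stroke is never positive. -/
theorem Stroke.Positive.edge_injective {G : Grid} {s t : Stroke G} (hs : s.Positive)
    (ht : t.Positive) (h : s.edge = t.edge) : s = t := by
  simp only [Stroke.edge, Sym2.eq_iff] at h
  cases G
  · obtain ⟨a, b, hs⟩ := hs.square_cases
    obtain ⟨c, d, ht⟩ := ht.square_cases
    rcases hs with ⟨h1, rfl⟩ | ⟨h1, rfl⟩ | ⟨h1, rfl⟩ | ⟨h1, rfl⟩ <;>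
    rcases ht with ⟨h2, rfl⟩ | ⟨h2, rfl⟩ | ⟨h2, rfl⟩ | ⟨h2, rfl⟩ <;>
    simp only [Stroke.target, Prod.ext_iff, Prod.fst_add, Prod.snd_add, Grid.step_square_zero,
      Grid.step_square_one, Grid.step_square_two, Grid.step_square_three] at h <;>
    first
    | (exfalso; omega)
    | (congr 2 <;> omega)
  · obtain ⟨a, b, hs⟩ := hs.triangular_cases
    obtain ⟨c, d, ht⟩ := ht.triangular_cases
    rcases hs with rfl | rfl | rfl <;>
    rcases ht with rfl | rfl | rfl <;>
    simp only [Stroke.target, Prod.ext_iff, Prod.fst_add, Prod.snd_add, Grid.step_triangular_zero,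
      Grid.step_triangular_two, Grid.step_triangular_four] at h <;>
    first
    | (exfalso; omega)
    | (congr 2 <;> omega)

/-- A turning passage uses two cyclically adjacent edges, and these separate nothing. Straight
passages with different headings always separate each other, since opposite headings are not both
positive at a point. -/
theorem cross_iff {G : Grid} {p q : Stroke G × Stroke G} (hp1 : p.1.Positive) (hp2 : p.2.Positive)
    (hq1 : q.1.Positive) (hq2 : q.2.Positive) (hp : p.2.source = p.1.target)
    (hq : q.2.source = q.1.target) :
    Cross p q ↔ p.2.source = q.2.source ∧ p.2.heading = p.1.heading ∧
      q.2.heading = q.1.heading ∧ p.1.heading ≠ q.1.heading := by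
  have hp' := hp1.turn_cases hp2 hp
  have hq' := hq1.turn_cases hq2 hq
  simp only [Cross, hp, hq, true_and, and_assoc]
  rw [and_congr_right_iff]
  intro _
  simp only [entrySide, exitSide, StrictlyBetween]
  obtain ⟨p1, p2⟩ := p
  obtain ⟨q1, q2⟩ := q
  simp only at *
  cases G
  · have key : ∀ a : ZMod 4, ∀ b ∈ [a + 1, a - 1], ∀ c : ZMod 4, ∀ d ∈ [c + 1, c - 1],
        ((c + 2 ≠ a + 2 ∧ c + 2 ≠ b ∧ d ≠ a + 2 ∧ d ≠ b ∧
          ((0 < (c + 2 - (a + 2)).val ∧ (c + 2 - (a + 2)).val < (b - (a + 2)).val) ↔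
          ¬ (0 < (d - (a + 2)).val ∧ (d - (a + 2)).val < (b - (a + 2)).val))) ↔
          b = a ∧ d = c ∧ a ≠ c) := by decide
    refine key _ _ ?_ _ _ ?_
    · rcases hp' with h | h | ⟨h, _⟩
      · exact List.mem_cons.2 (Or.inl h)
      · exact List.mem_cons.2 (Or.inr (List.mem_singleton.2 h))
      · cases h
    · rcases hq' with h | h | ⟨h, _⟩
      · exact List.mem_cons.2 (Or.inl h)
      · exact List.mem_cons.2 (Or.inr (List.mem_singleton.2 h))
      · cases h
  · have key : ∀ a ∈ ([0, 2, 4] : List (ZMod 6)), ∀ b ∈ ([0, 2, 4] : List (ZMod 6)),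
        ∀ c ∈ ([0, 2, 4] : List (ZMod 6)), ∀ d ∈ ([0, 2, 4] : List (ZMod 6)),
        ((c + 3 ≠ a + 3 ∧ c + 3 ≠ b ∧ d ≠ a + 3 ∧ d ≠ b ∧
          ((0 < (c + 3 - (a + 3)).val ∧ (c + 3 - (a + 3)).val < (b - (a + 3)).val) ↔
          ¬ (0 < (d - (a + 3)).val ∧ (d - (a + 3)).val < (b - (a + 3)).val))) ↔
          b = a ∧ d = c ∧ a ≠ c) := by decide
    have mem : ∀ h : ZMod 6, h = 0 ∨ h = 2 ∨ h = 4 → h ∈ ([0, 2, 4] : List (ZMod 6)) := by decide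
    exact key _ (mem _ hp1) _ (mem _ hp2) _ (mem _ hq1) _ (mem _ hq2)


/-! # Walks and winding numbers -/

/-- An infinite sequence of positive strokes, each of which starts where the previous one ends. -/
structure IsWalk {G : Grid} (s : ℕ → Stroke G) : Prop where
  source_succ : ∀ i, (s (i + 1)).source = (s i).target
  positive : ∀ i, (s i).Positive

/-- The signed number of crossings of the strokes with indices in `[a, b)` with the horizontal ray
from a face to the right. -/
def winding {G : Grid} (s : ℕ → Stroke G) (a b : ℕ) (f : ℤ × ℤ) : ℤ :=
  ∑ k ∈ Finset.Ico a b, (s k).crossing f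

/-- The number of indices in `[a, b)` at which a stroke occurs. -/
noncomputable def traversals {G : Grid} (s : ℕ → Stroke G) (a b : ℕ) (e : Stroke G) : ℤ :=
  ∑ k ∈ Finset.Ico a b, if s k = e then 1 else 0

theorem winding_left_sub_right {G : Grid} {s : ℕ → Stroke G} (hs : IsWalk s) {a b : ℕ}
    (hab : a ≤ b) {e : Stroke G} (he : e.Positive) :
    winding s a b e.leftFace - winding s a b e.rightFace =
      traversals s a b e + e.ahead (s a).source - e.ahead (s b).source := by
  induction b, hab using Nat.le_induction with
  | base => simp [winding, traversals]
  | succ b hab ih =>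
    simp only [winding, traversals, Finset.sum_Ico_succ_top hab] at ih ⊢
    have := Stroke.crossing_left_sub_right (hs.positive b) he
    rw [hs.source_succ]
    linarith

theorem traversals_eq_zero {G : Grid} {s : ℕ → Stroke G} {a b : ℕ} {e : Stroke G}
    (h : ∀ k, a ≤ k → k < b → s k ≠ e) : traversals s a b e = 0 :=
  Finset.sum_eq_zero fun k hk => by
    rw [Finset.mem_Ico] at hk
    rw [if_neg (h k hk.1 hk.2)]

theorem traversals_eq_one {G : Grid} {s : ℕ → Stroke G} {a b i : ℕ} (hi : a ≤ i) (hib : i < b)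
    (h : ∀ k, a ≤ k → k < b → s k = s i → k = i) : traversals s a b (s i) = 1 := by
  rw [traversals, Finset.sum_eq_single i]
  · simp
  · intro k hk hki
    rw [Finset.mem_Ico] at hk
    rw [if_neg fun h' => hki (h k hk.1 hk.2 h')]
  · intro h'
    exact absurd (Finset.mem_Ico.2 ⟨hi, hib⟩) h'

theorem Grid.turn_ne_zero (G : Grid) : G.turn ≠ 0 := by
  cases G
  · exact (by decide : (1 : ZMod 4) ≠ 0)
  · exact (by decide : (2 : ZMod 6) ≠ 0)

theorem Grid.turn_ne_neg (G : Grid) : G.turn ≠ -G.turn := by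
  cases G
  · exact (by decide : (1 : ZMod 4) ≠ -1)
  · exact (by decide : (2 : ZMod 6) ≠ -2)

theorem Stroke.eq_of_target {G : Grid} {s t : Stroke G} (h : s.target = t.target)
    (hh : s.heading = t.heading) : s = t := by
  refine Stroke.ext ?_ hh
  simp only [Stroke.target, hh] at h
  exact add_right_cancel h

/-- After `sideIn`, a left turn would retrace `s (i + 1)` and going straight on would cross the
straight passage, so only the right turn into `sideOut` remains. Backwards from `sideOut` the
argument is the same. -/
theorem straight_side_iff {s : ℕ → Stroke .triangular} (hs : IsWalk s) {i k : ℕ}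
    (hst : (s (i + 1)).heading = (s i).heading) (h1 : s (k + 1) = s (i + 1) → s k = s i)
    (h2 : s k = s i → s (k + 1) = s (i + 1))
    (h3 : (s (k + 1)).heading = (s k).heading → (s (i + 1)).source = (s (k + 1)).source →
      (s i).heading = (s k).heading) :
    s k = (s (i + 1)).sideIn ↔ s (k + 1) = (s (i + 1)).sideOut := by
  have n2 : ∀ h : Grid.triangular.Heading, h + 2 ≠ h := by
    have : ∀ h : ZMod 6, h + 2 ≠ h := by decide
    exact this
  have n4 : ∀ h : Grid.triangular.Heading, h + 4 ≠ h := by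
    have : ∀ h : ZMod 6, h + 4 ≠ h := by decide
    exact this
  have e1 : ∀ h : Grid.triangular.Heading, h + 4 + Grid.turn .triangular = h := by
    have : ∀ h : ZMod 6, h + 4 + 2 = h := by decide
    exact this
  have e2 : ∀ h : Grid.triangular.Heading, h + 4 - Grid.turn .triangular = h + 2 := by
    have : ∀ h : ZMod 6, h + 4 - 2 = h + 2 := by decide
    exact this
  have e3 : ∀ h k : Grid.triangular.Heading, h + 2 = k + Grid.turn .triangular → k = h := by
    have : ∀ h k : ZMod 6, h + 2 = k + 2 → k = h := by decide
    exact this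
  have e4 : ∀ h k : Grid.triangular.Heading, h + 2 = k - Grid.turn .triangular → k = h + 4 := by
    have : ∀ h k : ZMod 6, h + 2 = k - 2 → k = h + 4 := by decide
    exact this
  have ht := (hs.positive k).turn_cases (hs.positive (k + 1)) (hs.source_succ k)
  constructor
  · intro h
    have hsrc : (s (k + 1)).source = (s (i + 1)).source := by
      rw [hs.source_succ k, h, Stroke.sideIn_target]
    have hk : (s k).heading = (s (i + 1)).heading + 4 := by rw [h]; rfl
    rcases ht with ht | ht | ⟨-, ht⟩
    · rw [hk, e1] at ht
      have := h1 (Stroke.ext hsrc ht)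
      rw [this, hst] at hk
      exact absurd hk.symm (n4 _)
    · rw [hk, e2] at ht
      exact Stroke.ext hsrc ht
    · have := h3 ht hsrc.symm
      rw [← hst, hk] at this
      exact absurd this.symm (n4 _)
  · intro h
    have hsrc : (s (k + 1)).source = (s (i + 1)).source := by rw [h]; rfl
    have hk : (s (k + 1)).heading = (s (i + 1)).heading + 2 := by rw [h]; rfl
    have htgt : (s k).target = (s (i + 1)).source := by rw [← hs.source_succ, hsrc]
    rw [hk] at ht
    rcases ht with ht | ht | ⟨-, ht⟩
    · have := h2 (Stroke.eq_of_target (htgt.trans (hs.source_succ i)) ((e3 _ _ ht).trans hst))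
      rw [this] at hk
      exact absurd hk.symm (n2 _)
    · exact Stroke.eq_of_target (htgt.trans (Stroke.sideIn_target _).symm) (e4 _ _ ht)
    · have := h3 (hk.trans ht) hsrc.symm
      rw [← hst, ← ht] at this
      exact absurd this.symm (n2 _)

theorem traversals_succ {G : Grid} {s : ℕ → Stroke G} {a b : ℕ} (hab : a ≤ b) {e e' : Stroke G}
    (h : ∀ k, a ≤ k → k < b → (s k = e ↔ s (k + 1) = e')) :
    traversals s a b e = traversals s a b e' + (if s b = e' then 1 else 0) -
      (if s a = e' then 1 else 0) := by
  induction b, hab using Nat.le_induction with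
  | base => simp [traversals]
  | succ b hab ih =>
    have := ih fun k h1 h2 => h k h1 (h2.trans (Nat.lt_succ_self _))
    simp only [traversals, Finset.sum_Ico_succ_top hab] at this ⊢
    rw [this]
    simp only [h b hab (Nat.lt_succ_self _)]
    ring

/-! ## Closed walks -/

/-- A walk that is closed with period `n`, traverses no edge twice in a period and does not cross
itself. -/
structure IsSimpleClosed {G : Grid} (s : ℕ → Stroke G) (n : ℕ) : Prop extends IsWalk s where
  pos : 0 < n
  periodic : ∀ i, s (i + n) = s i
  inj : ∀ i j, s i = s j → i ≡ j [MOD n]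
  -- This is the form that the absence of crossings takes by `cross_iff`.
  noCross : ∀ i j, (s (i + 1)).heading = (s i).heading → (s (j + 1)).heading = (s j).heading →
    (s (i + 1)).source = (s (j + 1)).source → (s i).heading = (s j).heading

theorem sum_Ico_periodic {f : ℕ → ℤ} {n : ℕ} (hf : ∀ i, f (i + n) = f i) (a : ℕ) :
    ∑ k ∈ Finset.Ico a (a + n), f k = ∑ k ∈ Finset.range n, f k := by
  induction a with
  | zero => simp
  | succ a ih =>
    rcases Nat.eq_zero_or_pos n with rfl | hn
    · simp
    · rw [← ih, Nat.succ_add, Finset.sum_Ico_succ_top (by omega),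
        Finset.sum_eq_sum_Ico_succ_bot (a := a) (by omega), hf, add_comm]

theorem winding_periodic {G : Grid} {s : ℕ → Stroke G} {n : ℕ} (hs : ∀ i, s (i + n) = s i) (a : ℕ)
    (f : ℤ × ℤ) : winding s a (a + n) f = winding s 0 n f := by
  simp only [winding]
  rw [sum_Ico_periodic (fun i => by rw [hs]), Finset.range_eq_Ico]

theorem exists_crossing_ne {G : Grid} {s : ℕ → Stroke G} (hs : ∀ i, (s i).Positive) {a b : ℕ} {j r : ℤ}
    (h : winding s a b (j, r) ≠ winding s a b (j + 1, r)) :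
    ∃ i, a ≤ i ∧ i < b ∧ (((s i).leftFace = (j, r) ∧ (s i).rightFace = (j + 1, r)) ∨
      ((s i).leftFace = (j + 1, r) ∧ (s i).rightFace = (j, r))) := by
  by_contra! hc
  refine h (Finset.sum_congr rfl fun k hk => ?_)
  rw [Finset.mem_Ico] at hk
  by_contra hne
  have := hc k hk.1 hk.2
  rcases Stroke.crossing_ne (hs k) hne with ⟨h1, h2⟩ | ⟨h1, h2⟩
  · exact this.1 h1 h2
  · exact this.2 h1 h2

theorem Stroke.exists_crossing_eq_zero {G : Grid} (s : Stroke G) :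
    ∃ J : ℤ, ∀ j b, J ≤ j → s.crossing (j, b) = 0 := by
  cases G
  · refine ⟨s.source.1, fun j b h => ?_⟩
    simp only [Stroke.crossing]
    split_ifs <;> first | rfl | omega
  · refine ⟨2 * s.source.1, fun j b h => ?_⟩
    simp only [Stroke.crossing]
    split_ifs <;> first | rfl | omega

theorem exists_winding_eq_zero {G : Grid} (s : ℕ → Stroke G) (a b : ℕ) :
    ∃ J : ℤ, ∀ j r, J ≤ j → winding s a b (j, r) = 0 := by
  induction b with
  | zero => exact ⟨0, fun j r _ => by simp [winding]⟩
  | succ b ih =>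
    obtain ⟨J, hJ⟩ := ih
    obtain ⟨K, hK⟩ := (s b).exists_crossing_eq_zero
    refine ⟨max J K, fun j r h => ?_⟩
    rcases Nat.lt_or_ge b a with hb | hb
    · have := hJ j r (le_trans (le_max_left _ _) h)
      simp only [winding] at this ⊢
      rw [Finset.Ico_eq_empty (by omega)]; rfl
    · simp only [winding, Finset.sum_Ico_succ_top hb] at hJ ⊢
      rw [hJ j r (le_trans (le_max_left _ _) h), hK j r (le_trans (le_max_right _ _) h), zero_add]

namespace IsSimpleClosed

variable {G : Grid} {s : ℕ → Stroke G} {n : ℕ}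

theorem eq_of_modEq (hs : IsSimpleClosed s n) {i j : ℕ} (h : i ≡ j [MOD n]) : s i = s j := by
  have key : ∀ i k, s (i + n * k) = s i := by
    intro i k
    induction k with
    | zero => rfl
    | succ k ih => rw [Nat.mul_succ, ← add_assoc, hs.periodic, ih]
  rw [← Nat.mod_add_div i n, ← Nat.mod_add_div j n, key, key, h]

theorem traversals_self (hs : IsSimpleClosed s n) (a i : ℕ) :
    traversals s a (a + n) (s i) = 1 := by
  have key : ∃ i', a ≤ i' ∧ i' < a + n ∧ i' ≡ i [MOD n] := by
    have hn := hs.pos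
    refine ⟨a + (i + n * a - a) % n, by omega, ?_, ?_⟩
    · have := Nat.mod_lt (i + n * a - a) hn
      omega
    · have h1 : a ≤ n * a := Nat.le_mul_of_pos_left a hn
      calc a + (i + n * a - a) % n ≡ a + (i + n * a - a) [MOD n] :=
            Nat.ModEq.add_left _ (Nat.mod_modEq _ _)
        _ = i + n * a := by omega
        _ ≡ i [MOD n] := by simp [Nat.ModEq]
  obtain ⟨i', h1, h2, h3⟩ := key
  rw [← hs.eq_of_modEq h3]
  refine traversals_eq_one h1 h2 fun k hk1 hk2 hk => ?_
  have := hs.inj _ _ hk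
  rcases le_total k i' with h | h
  · have := (Nat.modEq_iff_dvd' h).1 this
    have := Nat.eq_zero_of_dvd_of_lt this (by omega)
    omega
  · have := (Nat.modEq_iff_dvd' h).1 this.symm
    have := Nat.eq_zero_of_dvd_of_lt this (by omega)
    omega

theorem left_sub_right (hs : IsSimpleClosed s n) {e : Stroke G} (he : e.Positive) :
    winding s 0 n e.leftFace - winding s 0 n e.rightFace = traversals s 0 n e := by
  rw [winding_left_sub_right hs.toIsWalk (Nat.zero_le _) he]
  have := hs.periodic 0
  rw [zero_add] at this
  rw [this]
  ring

theorem left_sub_right_self (hs : IsSimpleClosed s n) (i : ℕ) :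
    winding s 0 n (s i).leftFace - winding s 0 n (s i).rightFace = 1 := by
  rw [hs.left_sub_right (hs.positive i)]
  have := hs.traversals_self 0 i
  rwa [zero_add] at this

theorem succ_congr (hs : IsSimpleClosed s n) {i k : ℕ} : s (k + 1) = s (i + 1) ↔ s k = s i :=
  ⟨fun h => hs.eq_of_modEq (Nat.ModEq.add_right_cancel' 1 (hs.inj _ _ h)),
    fun h => hs.eq_of_modEq (Nat.ModEq.add_right 1 (hs.inj _ _ h))⟩

theorem side_iff {s : ℕ → Stroke .triangular} (hs : IsSimpleClosed s n) {i : ℕ}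
    (hst : (s (i + 1)).heading = (s i).heading) (k : ℕ) :
    s k = (s (i + 1)).sideIn ↔ s (k + 1) = (s (i + 1)).sideOut :=
  straight_side_iff hs.toIsWalk hst hs.succ_congr.1 hs.succ_congr.2
    fun hk h => hs.noCross i k hst hk h

/-- A left turn does not change the left face. At a right turn both left faces are one jump away
from the common right face. On a straight passage one goes from left face to left face across
`sideOut` and `sideIn`, which are traversed equally often because nothing crosses the passage. -/
theorem winding_leftFace_succ (hs : IsSimpleClosed s n) (i : ℕ) :
    winding s 0 n (s (i + 1)).leftFace = winding s 0 n (s i).leftFace := by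
  rcases (hs.positive i).turn_cases (hs.positive (i + 1)) (hs.source_succ i) with h | h | ⟨rfl, h⟩
  · rw [(hs.positive i).leftFace_eq (hs.positive (i + 1)) (hs.source_succ i) h]
  · have h1 := hs.left_sub_right_self i
    have h2 := hs.left_sub_right_self (i + 1)
    rw [(hs.positive i).rightFace_eq (hs.positive (i + 1)) (hs.source_succ i) h] at h2
    linarith
  · have h1 := hs.left_sub_right (hs.positive (i + 1)).sideIn
    have h2 := hs.left_sub_right (hs.positive (i + 1)).sideOut
    rw [(hs.positive (i + 1)).side_faces.1, (hs.positive (i + 1)).side_faces.2] at h1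
    rw [(hs.positive i).sideOut_leftFace (hs.source_succ i) h] at h2
    have h3 := traversals_succ (Nat.zero_le n) fun k _ _ => hs.side_iff h k
    have h4 := hs.periodic 0
    rw [zero_add] at h4
    rw [h4] at h3
    linarith

theorem winding_leftFace (hs : IsSimpleClosed s n) (i : ℕ) :
    winding s 0 n (s i).leftFace = winding s 0 n (s 0).leftFace := by
  induction i with
  | zero => rfl
  | succ i ih => rw [hs.winding_leftFace_succ, ih]

/-- A discrete Jordan curve theorem: the winding numbers of a simple closed curve are `0` and `1`,
or `-1` and `0`; the greater value is taken on the left side of the curve. -/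
theorem exists_winding (hs : IsSimpleClosed s n) :
    ∃ c : ℤ, (c = 0 ∨ c = -1) ∧ (∀ i, winding s 0 n (s i).leftFace = c + 1) ∧
      (∀ i, winding s 0 n (s i).rightFace = c) ∧
      ∀ f, winding s 0 n f = c ∨ winding s 0 n f = c + 1 := by
  obtain ⟨c, hc⟩ : ∃ c, winding s 0 n (s 0).leftFace = c + 1 :=
    ⟨winding s 0 n (s 0).leftFace - 1, by ring⟩
  have hl : ∀ i, winding s 0 n (s i).leftFace = c + 1 := fun i => by rw [hs.winding_leftFace, hc]
  have hr : ∀ i, winding s 0 n (s i).rightFace = c := fun i => by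
    have := hs.left_sub_right_self i
    rw [hl] at this
    linarith
  have hstep : ∀ j r, winding s 0 n (j, r) = winding s 0 n (j + 1, r) ∨
      ((winding s 0 n (j, r) = c ∨ winding s 0 n (j, r) = c + 1) ∧
        (winding s 0 n (j + 1, r) = c ∨ winding s 0 n (j + 1, r) = c + 1)) := by
    intro j r
    by_contra! h
    obtain ⟨i, -, -, ⟨h1, h2⟩ | ⟨h1, h2⟩⟩ := exists_crossing_ne hs.positive h.1
    · have := hl i; have := hr i; simp_all
    · have := hl i; have := hr i; simp_all
  -- Induction along a row from right to left; it starts far to the right, where the winding numbers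
  -- vanish.
  have hdown : ∀ P : ℤ → Prop, (∃ J, ∀ j, J ≤ j → P j) → (∀ j, P (j + 1) → P j) → ∀ j, P j := by
    rintro P ⟨J, hJ⟩ hP j
    obtain ⟨k, hk⟩ : ∃ k : ℕ, J ≤ j + k := ⟨(J - j).toNat, by omega⟩
    have : ∀ k : ℕ, P (j + k) → P j := by
      intro k
      induction k with
      | zero => simp
      | succ k ih =>
        intro h
        refine ih (hP _ ?_)
        push_cast at h
        rwa [← add_assoc] at h
    exact this k (hJ _ hk)
  obtain ⟨J, hJ⟩ := exists_winding_eq_zero s 0 n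
  -- Otherwise 0 would be neither `c` nor `c + 1`, the value 0 from the far right would persist
  -- along every row, and the jump at `s 0` could not occur.
  have hzero : c = 0 ∨ c = -1 := by
    by_contra! h
    have key : ∀ f, winding s 0 n f = 0 := by
      rintro ⟨j, r⟩
      refine hdown (fun j => winding s 0 n (j, r) = 0) ⟨J, fun j hj => hJ j r hj⟩ (fun j hj => ?_) j
      rcases hstep j r with h1 | ⟨-, h1⟩
      · rw [h1, hj]
      · omega
    have h1 := hl 0
    have h2 := hr 0
    rw [key] at h1 h2
    omega
  refine ⟨c, hzero, hl, hr, ?_⟩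
  rintro ⟨j, r⟩
  refine hdown (fun j => winding s 0 n (j, r) = c ∨ winding s 0 n (j, r) = c + 1)
    ⟨J, fun j hj => ?_⟩ (fun j hj => ?_) j
  · rw [hJ j r hj]; omega
  · rcases hstep j r with h1 | ⟨h1, -⟩
    · rw [h1]; exact hj
    · exact h1

end IsSimpleClosed


/-! # The total turning of a curve -/

/-- The turn of a curve by the angle `δ`, as an integral multiple of the basic turn. -/
def Grid.turnInt (G : Grid) (δ : G.Heading) : ℤ :=
  if δ = G.turn then 1 else if δ = -G.turn then -1 else 0

/-- An auxiliary function of the heading that compares turns with crossings of a horizontal ray. -/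
def Grid.phase : (G : Grid) → G.Heading → ℤ
  | .square, h => if h = 0 then 3 else if h = 1 then 0 else if h = 2 then 1 else 2
  | .triangular, h => if h = 0 then 2 else if h = 2 then 0 else 1

/-- `Grid.phase` lifts headings to integers, with a cut after heading 0. The left turn over the cut
leads into the only heading whose stroke meets the ray from its own left face, and the crossing
term, weighted by `G.sides`, makes up for the cut. -/
theorem phase_left {G : Grid} {s t : Stroke G} (hs : s.Positive) (ht : t.Positive)
    (hh : t.heading = s.heading + G.turn) :
    -(G.sides * t.crossing t.leftFace) =
      -G.turnInt (t.heading - s.heading) + G.phase t.heading - G.phase s.heading := by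
  have e : t.heading - s.heading = G.turn := by rw [hh]; ring
  rw [e, Grid.turnInt, if_pos rfl]
  cases G
  · obtain ⟨a, b, hs⟩ := hs.square_cases
    obtain ⟨c, d, ht⟩ := ht.square_cases
    rcases hs with ⟨h1, rfl⟩ | ⟨h1, rfl⟩ | ⟨h1, rfl⟩ | ⟨h1, rfl⟩ <;>
    rcases ht with ⟨h2, rfl⟩ | ⟨h2, rfl⟩ | ⟨h2, rfl⟩ | ⟨h2, rfl⟩ <;>
    first
    | (exfalso; dsimp only at hh; revert hh; decide)
    | simp (decide := true) [Stroke.crossing, Stroke.leftFace, Grid.phase, Grid.sides]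
  · obtain ⟨a, b, hs⟩ := hs.triangular_cases
    obtain ⟨c, d, ht⟩ := ht.triangular_cases
    rcases hs with rfl | rfl | rfl <;>
    rcases ht with rfl | rfl | rfl <;>
    first
    | (exfalso; dsimp only at hh; revert hh; decide)
    | simp (decide := true) [Stroke.crossing, Stroke.leftFace, Grid.phase, Grid.sides]

/-- Here the left faces of the two strokes differ. The summand 1 and the `ahead` terms are the
change of the winding number from one to the other via the common right face, as in
`winding_right_turn`. -/
theorem phase_right {G : Grid} {s t : Stroke G} (hs : s.Positive) (ht : t.Positive)
    (h : t.source = s.target) (hh : t.heading = s.heading - G.turn) :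
    G.sides * (1 + t.ahead t.source - s.ahead t.source - t.crossing t.leftFace) =
      -G.turnInt (t.heading - s.heading) + G.phase t.heading - G.phase s.heading := by
  have e : t.heading - s.heading = -G.turn := by rw [hh]; ring
  rw [e, Grid.turnInt, if_neg G.turn_ne_neg.symm, if_pos rfl, h]
  cases G
  · obtain ⟨a, b, hs⟩ := hs.square_cases
    obtain ⟨c, d, ht⟩ := ht.square_cases
    rcases hs with ⟨h1, rfl⟩ | ⟨h1, rfl⟩ | ⟨h1, rfl⟩ | ⟨h1, rfl⟩ <;>
    rcases ht with ⟨h2, rfl⟩ | ⟨h2, rfl⟩ | ⟨h2, rfl⟩ | ⟨h2, rfl⟩ <;>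
    first
    | (exfalso; dsimp only at hh; revert hh; decide)
    | (simp only [Stroke.target, Prod.ext_iff, Prod.fst_add, Prod.snd_add, Grid.step_square_zero,
        Grid.step_square_one, Grid.step_square_two, Grid.step_square_three] at h
       simp (decide := true) only [Stroke.crossing, Stroke.leftFace, Stroke.ahead, Stroke.target,
        Prod.fst_add, Prod.snd_add, Grid.step_square_zero, Grid.step_square_one,
        Grid.step_square_two, Grid.step_square_three, Grid.phase, Grid.sides, if_true, if_false, true_and]
       split_ifs <;> omega)
  · obtain ⟨a, b, hs⟩ := hs.triangular_cases
    obtain ⟨c, d, ht⟩ := ht.triangular_cases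
    rcases hs with rfl | rfl | rfl <;>
    rcases ht with rfl | rfl | rfl <;>
    first
    | (exfalso; dsimp only at hh; revert hh; decide)
    | (simp only [Stroke.target, Prod.ext_iff, Prod.fst_add, Prod.snd_add, Grid.step_triangular_zero,
        Grid.step_triangular_two, Grid.step_triangular_four] at h
       simp (decide := true) only [Stroke.crossing, Stroke.leftFace, Stroke.ahead, Stroke.target,
        Prod.fst_add, Prod.snd_add, Grid.step_triangular_zero, Grid.step_triangular_two,
        Grid.step_triangular_four, Grid.phase, Grid.sides, if_true, if_false, true_and]
       split_ifs <;> omega)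

theorem turnInt_zero (G : Grid) : G.turnInt 0 = 0 := by
  have h1 := G.turn_ne_zero.symm
  have h2 : (0 : G.Heading) ≠ -G.turn := fun h => G.turn_ne_zero (neg_eq_zero.1 h.symm)
  simp [Grid.turnInt, h1, h2]

theorem crossing_straight {t : Stroke .triangular} (ht : t.Positive) :
    t.sideIn.ahead t.source - t.sideOut.ahead t.source - t.crossing t.leftFace = 0 := by
  obtain ⟨a, b, ht⟩ := ht.triangular_cases
  rcases ht with rfl | rfl | rfl <;>
    simp (decide := true) [Stroke.sideIn, Stroke.sideOut, Grid.two_add_four, Grid.four_add_four,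
      Grid.two_add_two, Grid.four_add_two, Stroke.ahead, Stroke.crossing, Stroke.leftFace]

section

variable {G : Grid} {s : ℕ → Stroke G} {i b : ℕ}

theorem winding_succ_bot (s : ℕ → Stroke G) {a b : ℕ} (h : a < b) (f : ℤ × ℤ) :
    winding s a b f = (s a).crossing f + winding s (a + 1) b f := by
  simp only [winding]
  rw [Finset.sum_eq_sum_Ico_succ_bot h]

theorem winding_left_turn (hs : IsWalk s)
    (hh : (s (i + 1)).heading = (s i).heading + G.turn) :
    winding s (i + 1) b (s (i + 1)).leftFace - winding s (i + 1) b (s i).leftFace = 0 := by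
  rw [(hs.positive i).leftFace_eq (hs.positive (i + 1)) (hs.source_succ i) hh, sub_self]

/-- Both strokes border the same right face; among the remaining strokes the first one does not
occur any more and the second one occurs once. -/
theorem winding_right_turn (hs : IsWalk s) (hi : i + 1 ≤ b)
    (hh : (s (i + 1)).heading = (s i).heading - G.turn) (h0 : traversals s (i + 1) b (s i) = 0)
    (h1 : traversals s (i + 1) b (s (i + 1)) = 1) :
    winding s (i + 1) b (s (i + 1)).leftFace - winding s (i + 1) b (s i).leftFace =
      1 + (s (i + 1)).ahead (s (i + 1)).source - (s i).ahead (s (i + 1)).source +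
      ((s i).ahead (s b).source - (s (i + 1)).ahead (s b).source) := by
  have e0 := winding_left_sub_right hs hi (hs.positive i)
  have e1 := winding_left_sub_right hs hi (hs.positive (i + 1))
  rw [(hs.positive i).rightFace_eq (hs.positive (i + 1)) (hs.source_succ i) hh] at e1
  linarith

end

theorem winding_straight {s : ℕ → Stroke .triangular} {i b : ℕ} (hs : IsWalk s) (hi : i + 1 ≤ b)
    (hh : (s (i + 1)).heading = (s i).heading)
    (h : traversals s (i + 1) b (s (i + 1)).sideIn = traversals s (i + 1) b (s (i + 1)).sideOut) :
    winding s (i + 1) b (s (i + 1)).leftFace - winding s (i + 1) b (s i).leftFace =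
      (s (i + 1)).sideIn.ahead (s (i + 1)).source - (s (i + 1)).sideOut.ahead (s (i + 1)).source +
      ((s (i + 1)).sideOut.ahead (s b).source - (s (i + 1)).sideIn.ahead (s b).source) := by
  have e0 := winding_left_sub_right hs hi (hs.positive (i + 1)).sideIn
  have e1 := winding_left_sub_right hs hi (hs.positive (i + 1)).sideOut
  rw [(hs.positive (i + 1)).side_faces.1, (hs.positive (i + 1)).side_faces.2] at e0
  rw [(hs.positive i).sideOut_leftFace (hs.source_succ i) hh] at e1
  linarith

/-! ## Closed curves -/

/-- The order of the grid points by height, points of the same height being ordered from left to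
right. -/
def LexLE {G : Grid} (p q : G.Point) : Prop := p.2 < q.2 ∨ p.2 = q.2 ∧ p.1 ≤ q.1

/-- Eliminates the boundary terms at the end of a walk that is cut open at its lowest, leftmost
point. -/
theorem ahead_eq_zero {G : Grid} {s : Stroke G} (hs : s.Positive) {p : G.Point}
    (h1 : LexLE p s.source) (h2 : LexLE p s.target) : s.ahead p = 0 := by
  cases G
  · obtain ⟨a, b, hs⟩ := hs.square_cases
    rcases hs with ⟨-, rfl⟩ | ⟨-, rfl⟩ | ⟨-, rfl⟩ | ⟨-, rfl⟩ <;>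
    simp only [LexLE, Stroke.target, Prod.fst_add, Prod.snd_add, Grid.step_square_zero,
        Grid.step_square_one, Grid.step_square_two, Grid.step_square_three] at h1 h2 <;>
    simp (decide := true) only [Stroke.ahead, if_true, if_false] <;>
    (split_ifs <;> omega)
  · obtain ⟨a, b, hs⟩ := hs.triangular_cases
    rcases hs with rfl | rfl | rfl <;>
    simp only [LexLE, Stroke.target, Prod.fst_add, Prod.snd_add, Grid.step_triangular_zero,
        Grid.step_triangular_two, Grid.step_triangular_four] at h1 h2 <;>
    simp (decide := true) only [Stroke.ahead, if_true, if_false]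
    split_ifs <;> omega

theorem side_ahead_eq_zero {s t : Stroke .triangular} (hs : s.Positive)
    (h : t.source = s.target) (hh : t.heading = s.heading) {p : Grid.triangular.Point}
    (h1 : LexLE p s.source) (h2 : LexLE p t.source) (h3 : LexLE p t.target) :
    t.sideOut.ahead p = 0 ∧ t.sideIn.ahead p = 0 := by
  obtain ⟨a, b, hs⟩ := hs.triangular_cases
  obtain ⟨⟨c, d⟩, k⟩ := t
  obtain ⟨x, y⟩ := p
  rcases hs with rfl | rfl | rfl <;> simp only at hh <;> subst hh <;>
    simp only [LexLE, Stroke.target, Prod.ext_iff, Prod.fst_add, Prod.snd_add,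
      Grid.step_triangular_zero, Grid.step_triangular_two, Grid.step_triangular_four]
      at h h1 h2 h3 <;>
    simp (decide := true) only [Stroke.sideIn, Stroke.sideOut, Grid.two_add_four,
      Grid.four_add_four, Grid.two_add_two, Grid.four_add_two, Stroke.ahead, zero_add, if_true,
      if_false, Grid.step_triangular_zero, Prod.fst_sub, Prod.snd_sub] <;>
    (constructor <;> first | trivial | (split_ifs <;> omega))

theorem exists_lexLE {G : Grid} (p : ℕ → G.Point) {n : ℕ} (hn : 0 < n) :
    ∃ a < n, ∀ i < n, LexLE (p a) (p i) := by
  induction n, hn using Nat.le_induction with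
  | base =>
    refine ⟨0, by omega, fun i hi => ?_⟩
    rw [show i = 0 by omega]
    exact Or.inr ⟨rfl, le_rfl⟩
  | succ n hn ih =>
    obtain ⟨a, ha, h⟩ := ih
    by_cases hc : LexLE (p a) (p n)
    · refine ⟨a, by omega, fun i hi => ?_⟩
      rcases Nat.lt_succ_iff_lt_or_eq.1 hi with h' | rfl
      · exact h i h'
      · exact hc
    · refine ⟨n, by omega, fun i hi => ?_⟩
      rcases Nat.lt_succ_iff_lt_or_eq.1 hi with h' | rfl
      · have := h i h'
        simp only [LexLE] at hc this ⊢
        omega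
      · exact Or.inr ⟨rfl, le_rfl⟩


theorem crossing_eq_zero_of_low {G : Grid} {s : Stroke G} (hs : s.Positive) {p : G.Point}
    (h1 : LexLE p s.source) (h2 : LexLE p s.target) {j r : ℤ} (hr : r < p.2) :
    s.crossing (j, r) = 0 := by
  cases G
  · obtain ⟨a, b, hs⟩ := hs.square_cases
    rcases hs with ⟨-, rfl⟩ | ⟨-, rfl⟩ | ⟨-, rfl⟩ | ⟨-, rfl⟩ <;>
    simp only [LexLE, Stroke.target, Prod.fst_add, Prod.snd_add, Grid.step_square_zero,
        Grid.step_square_one, Grid.step_square_two, Grid.step_square_three] at h1 h2 <;>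
    simp (decide := true) only [Stroke.crossing, if_true, if_false] <;>
    (split_ifs <;> omega)
  · obtain ⟨a, b, hs⟩ := hs.triangular_cases
    rcases hs with rfl | rfl | rfl <;>
    simp only [LexLE, Stroke.target, Prod.fst_add, Prod.snd_add, Grid.step_triangular_zero,
        Grid.step_triangular_two, Grid.step_triangular_four] at h1 h2 <;>
    simp (decide := true) only [Stroke.crossing, if_true, if_false] <;>
    (split_ifs <;> omega)

/-- Of two opposite neighbours of a point, one precedes it in the order `LexLE`. -/
theorem straight_ne_lexLE {s t : Stroke .triangular} (hs : s.Positive)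
    (h : t.source = s.target) (hh : t.heading = s.heading) {p : Grid.triangular.Point}
    (h1 : LexLE p s.source) (h3 : LexLE p t.target) : t.source ≠ p := by
  rintro rfl
  obtain ⟨a, b, hs⟩ := hs.triangular_cases
  obtain ⟨⟨c, d⟩, k⟩ := t
  rcases hs with rfl | rfl | rfl <;> simp only at hh <;> subst hh <;>
    simp only [LexLE, Stroke.target, Prod.ext_iff, Prod.fst_add, Prod.snd_add,
      Grid.step_triangular_zero, Grid.step_triangular_two, Grid.step_triangular_four]
      at h h1 h3 <;> omega

namespace IsSimpleClosed

variable {G : Grid} {s : ℕ → Stroke G} {n : ℕ}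

theorem traversals_tail_self (hs : IsSimpleClosed s n) {a i : ℕ} (ha : a ≤ i) :
    traversals s (i + 1) (a + n) (s i) = 0 :=
  traversals_eq_zero fun k hk1 hk2 h => by
    have := (Nat.modEq_iff_dvd' (by omega)).1 (hs.inj _ _ h).symm
    have := Nat.eq_zero_of_dvd_of_lt this (by omega)
    omega

theorem traversals_tail_succ (hs : IsSimpleClosed s n) {a i : ℕ} (ha : a ≤ i)
    (hi : i + 1 < a + n) : traversals s (i + 1) (a + n) (s (i + 1)) = 1 :=
  traversals_eq_one le_rfl hi fun k hk1 hk2 h => by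
    have := (Nat.modEq_iff_dvd' (by omega)).1 (hs.inj _ _ h).symm
    have := Nat.eq_zero_of_dvd_of_lt this (by omega)
    omega

theorem traversals_tail_side {s : ℕ → Stroke .triangular} (hs : IsSimpleClosed s n) {a i : ℕ}
    (hi : i + 1 < a + n) (hh : (s (i + 1)).heading = (s i).heading)
    (hne : (s (i + 1)).source ≠ (s a).source) :
    traversals s (i + 1) (a + n) (s (i + 1)).sideIn =
      traversals s (i + 1) (a + n) (s (i + 1)).sideOut := by
  -- Only the ends of the index range could separate a `sideIn` from its `sideOut`; the stroke after
  -- the range is `s a`, which starts at another point.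
  rw [traversals_succ hi.le fun k _ _ => hs.side_iff hh k, hs.periodic, if_neg, if_neg]
  · ring
  · intro h
    have := congrArg Stroke.heading h
    exact (by decide : ∀ h : ZMod 6, h ≠ h + 2) _ this
  · intro h
    exact hne (congrArg Stroke.source h).symm

theorem lexLE_all (hs : IsSimpleClosed s n) {a : ℕ}
    (ha : ∀ i < n, LexLE (s a).source (s i).source) (i : ℕ) :
    LexLE (s a).source (s i).source := by
  have := ha (i % n) (Nat.mod_lt _ hs.pos)
  rwa [hs.eq_of_modEq (Nat.mod_modEq i n)] at this

theorem lexLE_target (hs : IsSimpleClosed s n) {a : ℕ}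
    (ha : ∀ i < n, LexLE (s a).source (s i).source) (i : ℕ) :
    LexLE (s a).source (s i).target := by
  rw [← hs.source_succ]
  exact hs.lexLE_all ha _

/-- The proof of turning tangents tracks the winding number of the part of the curve still to come
around the current left face. Up to `Grid.phase`, each turn changes it by a fixed fraction, so the
total turn can be read off from its values at the beginning and at the end. -/
theorem phase_step (hs : IsSimpleClosed s n) {a : ℕ}
    (ha : ∀ i < n, LexLE (s a).source (s i).source) {i : ℕ} (hai : a ≤ i) (hi : i + 1 < a + n) :
    G.sides * (winding s (i + 2) (a + n) (s (i + 1)).leftFace -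
      winding s (i + 1) (a + n) (s i).leftFace) =
      -G.turnInt ((s (i + 1)).heading - (s i).heading) + G.phase (s (i + 1)).heading -
        G.phase (s i).heading := by
  have hb := winding_succ_bot s hi (s (i + 1)).leftFace
  have hz : ∀ k, (s k).ahead (s (a + n)).source = 0 := fun k => by
    rw [hs.periodic]
    exact ahead_eq_zero (hs.positive k) (hs.lexLE_all ha k) (hs.lexLE_target ha k)
  rcases (hs.positive i).turn_cases (hs.positive (i + 1)) (hs.source_succ i) with h | h | ⟨rfl, h⟩
  · rw [← phase_left (hs.positive i) (hs.positive (i + 1)) h, ← mul_neg]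
    have := winding_left_turn (b := a + n) hs.toIsWalk h
    congr 1
    linarith
  · rw [← phase_right (hs.positive i) (hs.positive (i + 1)) (hs.source_succ i) h]
    have := winding_right_turn hs.toIsWalk hi.le h (hs.traversals_tail_self hai)
      (hs.traversals_tail_succ hai hi)
    rw [hz, hz] at this
    congr 1
    linarith
  · have hne := straight_ne_lexLE (hs.positive i) (hs.source_succ i) h (hs.lexLE_all ha i)
      (hs.lexLE_target ha (i + 1))
    have := winding_straight hs.toIsWalk hi.le h (hs.traversals_tail_side hi h hne)
    have hz := side_ahead_eq_zero (hs.positive i) (hs.source_succ i) h (hs.lexLE_all ha i)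
      (hs.lexLE_all ha (i + 1)) (hs.lexLE_target ha (i + 1))
    rw [hs.periodic, hz.1, hz.2] at this
    have h0 := crossing_straight (hs.positive (i + 1))
    rw [h, sub_self, turnInt_zero, show winding s (i + 2) (a + n) (s (i + 1)).leftFace -
      winding s (i + 1) (a + n) (s i).leftFace = 0 by linarith]
    ring

theorem sum_phase_step (hs : IsSimpleClosed s n) {a : ℕ}
    (ha : ∀ i < n, LexLE (s a).source (s i).source) {m : ℕ} (hm : m < n) :
    G.sides * (winding s (a + m + 1) (a + n) (s (a + m)).leftFace -
      winding s (a + 1) (a + n) (s a).leftFace) =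
      -∑ i ∈ Finset.Ico a (a + m), G.turnInt ((s (i + 1)).heading - (s i).heading) +
        G.phase (s (a + m)).heading - G.phase (s a).heading := by
  induction m with
  | zero => simp
  | succ m ih =>
    have h1 := ih (by omega)
    have h2 := hs.phase_step ha (i := a + m) (by omega) (by omega)
    rw [← add_assoc, Finset.sum_Ico_succ_top (by omega)]
    linarith

theorem winding_low (hs : IsSimpleClosed s n) {a : ℕ}
    (ha : ∀ i < n, LexLE (s a).source (s i).source) {j r : ℤ} (hr : r < (s a).source.2) :
    winding s 0 n (j, r) = 0 :=
  Finset.sum_eq_zero fun k _ =>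
    crossing_eq_zero_of_low (hs.positive k) (hs.lexLE_all ha k) (hs.lexLE_target ha k) hr

/-- The theorem of turning tangents: the total turning of a simple closed curve is plus or minus
one full turn, according to the side of the curve that is its interior. -/
theorem exists_sum_turnInt (hs : IsSimpleClosed s n) :
    ∃ c : ℤ, (c = 0 ∨ c = -1) ∧ (∀ i, winding s 0 n (s i).leftFace = c + 1) ∧
      (∀ i, winding s 0 n (s i).rightFace = c) ∧
      (∀ f, winding s 0 n f = c ∨ winding s 0 n f = c + 1) ∧
      ∑ i ∈ Finset.range n, G.turnInt ((s (i + 1)).heading - (s i).heading) =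
        G.sides * (2 * c + 1) := by
  obtain ⟨c, hc, hl, hr, hall⟩ := hs.exists_winding
  refine ⟨c, hc, hl, hr, hall, ?_⟩
  obtain ⟨a, -, ha⟩ := exists_lexLE (fun i => (s i).source) hs.pos
  have hn := hs.pos
  have h1 := hs.sum_phase_step ha (m := n - 1) (by omega)
  have h2 : ∑ i ∈ Finset.range n, G.turnInt ((s (i + 1)).heading - (s i).heading) =
      ∑ i ∈ Finset.Ico a (a + (n - 1)), G.turnInt ((s (i + 1)).heading - (s i).heading) +
        G.turnInt ((s a).heading - (s (a + (n - 1))).heading) := by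
    have e1 : ∀ i, s (i + n + 1) = s (i + 1) := fun i => by
      rw [add_right_comm, hs.periodic]
    rw [← sum_Ico_periodic (fun i => by rw [e1, hs.periodic]) a,
      show a + n = a + (n - 1) + 1 by omega, Finset.sum_Ico_succ_top (by omega),
      show a + (n - 1) + 1 = a + n by omega, hs.periodic]
  -- At the beginning all strokes but the first are still to come, so that the winding number is
  -- that of the closed curve up to one crossing; at the end (`h4`) nothing is left.
  have h3 := winding_succ_bot s (show a < a + n by omega) (s a).leftFace
  rw [winding_periodic hs.periodic, hl] at h3
  have h4 : winding s (a + (n - 1) + 1) (a + n) (s (a + (n - 1))).leftFace = 0 := by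
    simp only [winding]
    rw [Finset.Ico_eq_empty (by omega)]; rfl
  rw [h4] at h1
  rw [h2]
  have hsrc : (s a).source = (s (a + (n - 1))).target := by
    rw [← hs.source_succ, show a + (n - 1) + 1 = a + n by omega, hs.periodic]
  have hlow : ∀ j r, r < (s a).source.2 → winding s 0 n (j, r) = 0 := fun j r => hs.winding_low ha
  have l1 := hs.lexLE_target ha a
  have l2 := hs.lexLE_all ha (a + (n - 1))
  have hla := hl a
  have hra := hr a
  have hlb := hl (a + (n - 1))
  have hpred : ∀ k, s k ≠ s a → (s k).source = (s a).source → ∃ k', s k' ≠ s (a + (n - 1)) ∧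
      (s k').target = (s a).source := by
    intro k hk hsrc
    have e : k + n - 1 + 1 = k + n := by omega
    refine ⟨k + n - 1, fun h => hk ?_, ?_⟩
    · have := hs.succ_congr.2 h
      rwa [e, show a + (n - 1) + 1 = a + n by omega, hs.periodic, hs.periodic] at this
    · rw [← hs.source_succ, e, hs.periodic, hsrc]
  have hpa := hs.positive a
  have hpb := hs.positive (a + (n - 1))
  generalize ∑ i ∈ Finset.Ico a (a + (n - 1)), G.turnInt ((s (i + 1)).heading - (s i).heading) = S
    at h1 ⊢
  generalize ht : s a = t at *
  generalize he : s (a + (n - 1)) = e at *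
  -- Few edges at the lowest, leftmost point lead to points that are not smaller. For each possible
  -- pair of last and first stroke, a face below this point has winding number 0, which determines
  -- `c`.
  cases G
  · obtain ⟨x, y, hpa⟩ := hpa.square_cases
    obtain ⟨x', y', hpb⟩ := hpb.square_cases
    rcases hpa with ⟨p1, rfl⟩ | ⟨p1, rfl⟩ | ⟨p1, rfl⟩ | ⟨p1, rfl⟩ <;>
    rcases hpb with ⟨p2, rfl⟩ | ⟨p2, rfl⟩ | ⟨p2, rfl⟩ | ⟨p2, rfl⟩ <;>
    simp only [LexLE, Stroke.target, Prod.ext_iff, Prod.fst_add, Prod.snd_add,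
      Grid.step_square_zero, Grid.step_square_one, Grid.step_square_two, Grid.step_square_three]
      at hsrc l1 l2 <;>
    first
    | (exfalso; omega)
    | skip
    · simp (decide := true) only [Stroke.rightFace, if_true, if_false] at hra
      rw [hlow _ _ (by dsimp only; omega)] at hra
      simp (decide := true) only [Stroke.crossing, Grid.phase, Grid.sides, Grid.turnInt, if_true,
        if_false] at h1 h3 ⊢
      push_cast at h1 ⊢
      omega
    · simp (decide := true) only [Stroke.leftFace, if_true, if_false] at hlb
      rw [hlow _ _ (by dsimp only; omega)] at hlb
      simp (decide := true) only [Stroke.crossing, Stroke.leftFace, Grid.phase, Grid.sides,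
        Grid.turnInt, if_true, if_false, true_and, sub_one_lt] at h1 h3 ⊢
      push_cast at h1 ⊢
      omega
  · obtain ⟨x, y, hpa⟩ := hpa.triangular_cases
    obtain ⟨x', y', hpb⟩ := hpb.triangular_cases
    rcases hpa with rfl | rfl | rfl <;>
    rcases hpb with rfl | rfl | rfl <;>
    simp only [LexLE, Stroke.target, Prod.ext_iff, Prod.fst_add, Prod.snd_add,
      Grid.step_triangular_zero, Grid.step_triangular_two, Grid.step_triangular_four]
      at hsrc l1 l2 <;>
    first
    | (exfalso; omega)
    | skip
    · simp (decide := true) only [Stroke.rightFace, if_true, if_false] at hra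
      rw [hlow _ _ (by dsimp only; omega)] at hra
      simp (decide := true) only [Stroke.crossing, Grid.phase, Grid.sides, Grid.turnInt, if_true,
        if_false] at h1 h3 ⊢
      push_cast at h1 ⊢
      omega
    -- The curve arrives with heading 4 and leaves with heading 2. The edge with heading 0 from this
    -- point is unused, since only the last stroke could lead to it and that one is followed by `s
    -- a`. So the left face of the last stroke has the same winding number as the face below this
    -- edge, namely 0.
    · have hpo : (⟨(x, y), 0⟩ : Stroke .triangular).Positive := Or.inl rfl
      have ho := hs.left_sub_right hpo
      rw [traversals_eq_zero fun k _ _ hk => ?_] at ho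
      · simp (decide := true) only [Stroke.leftFace, Stroke.rightFace, if_true, if_false] at hlb ho
        rw [hlow (2 * x + 1) (y - 1) (by dsimp only; omega), show (2 * x, y) = (2 * x', y' - 1) by
          ext <;> simp only <;> omega, hlb] at ho
        simp (decide := true) only [Stroke.crossing, Stroke.leftFace, Grid.phase, Grid.sides,
          Grid.turnInt, if_true, if_false, true_and] at h1 h3 ⊢
        rw [if_pos (by omega)] at h3
        push_cast at h1 ⊢
        omega
      · obtain ⟨k', hk1, hk2⟩ := hpred k (by rw [hk]; intro h; cases h) (by rw [hk])
        have l3 := hs.lexLE_all (a := a) (by rw [ht]; exact ha) k'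
        have hpk := hs.positive k'
        rw [ht] at l3
        generalize s k' = q at *
        obtain ⟨z, w, hpk⟩ := hpk.triangular_cases
        rcases hpk with rfl | rfl | rfl <;>
        simp only [LexLE, Stroke.target, Prod.ext_iff, Prod.fst_add, Prod.snd_add,
          Grid.step_triangular_zero, Grid.step_triangular_two, Grid.step_triangular_four]
          at hk2 l3 <;>
        first
        | (exfalso; omega)
        | skip
        refine hk1 ?_
        congr 2 <;> omega

end IsSimpleClosed


/-! ## Curves with a translational symmetry on the triangular grid -/

/-- A correction of `Grid.phase` for curves that are invariant under the translation by `d`. -/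
def shiftPhase (d : ℤ × ℤ) (h : Grid.triangular.Heading) : ℤ :=
  if h = 2 ∧ d.2 = 0 ∧ 1 ≤ d.1 then 1 else 0

/-- When the window of one period moves on, it loses a stroke and gains the translate by `d`. The
crossing of the new stroke is a difference of values of `shiftPhase`; for left turns it can be
nonzero only if `d` points horizontally to the right. -/
theorem shiftPhase_left {s t : Stroke .triangular} {d : Grid.triangular.Point} (hs : s.Positive)
    (ht : t.Positive) (hd : d ≠ 0) (hh : t.heading = s.heading + Grid.turn .triangular) :
    (t.move d 0).crossing t.leftFace = shiftPhase d t.heading - shiftPhase d s.heading := by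
  obtain ⟨x, y⟩ := d
  rw [Ne, Prod.ext_iff, not_and_or] at hd
  simp only [Prod.fst_zero, Prod.snd_zero] at hd
  obtain ⟨a, b, hs⟩ := hs.triangular_cases
  obtain ⟨c, e, ht⟩ := ht.triangular_cases
  rcases hs with rfl | rfl | rfl <;>
  rcases ht with rfl | rfl | rfl <;>
  first
  | (exfalso; dsimp only at hh; revert hh; decide)
  | (simp (decide := true) only [Stroke.move, Grid.step_triangular_zero, Grid.one_mul,
      Prod.fst_add, Prod.snd_add, zero_add, shiftPhase, Stroke.crossing, Stroke.leftFace, if_true,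
      if_false, true_and, false_and] <;> ((try split_ifs) <;> omega))

theorem shiftPhase_right {s t : Stroke .triangular} {d : Grid.triangular.Point} (hs : s.Positive)
    (ht : t.Positive) (hd : d ≠ 0) (h : t.source = s.target)
    (hh : t.heading = s.heading - Grid.turn .triangular) :
    (t.move d 0).crossing t.leftFace + s.ahead (t.move d 0).source - t.ahead (t.move d 0).source =
      shiftPhase d t.heading - shiftPhase d s.heading := by
  obtain ⟨x, y⟩ := d
  rw [Ne, Prod.ext_iff, not_and_or] at hd
  simp only [Prod.fst_zero, Prod.snd_zero] at hd
  obtain ⟨a, b, hs⟩ := hs.triangular_cases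
  obtain ⟨c, e, ht⟩ := ht.triangular_cases
  rcases hs with rfl | rfl | rfl <;>
  rcases ht with rfl | rfl | rfl <;>
  first
  | (exfalso; dsimp only at hh; revert hh; decide)
  | (simp only [Stroke.target, Prod.ext_iff, Prod.fst_add, Prod.snd_add, Grid.step_triangular_zero,
        Grid.step_triangular_two, Grid.step_triangular_four] at h
     simp (decide := true) only [Stroke.move, Grid.step_triangular_zero, Grid.one_mul,
      Prod.fst_add, Prod.snd_add, zero_add, shiftPhase, Stroke.crossing, Stroke.leftFace,
      Stroke.ahead, if_true, if_false, true_and, false_and]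
     (try split_ifs) <;> omega)

theorem shiftPhase_straight {t : Stroke .triangular} {d : Grid.triangular.Point}
    (ht : t.Positive) (hd : d ≠ 0) :
    (t.move d 0).crossing t.leftFace + t.sideOut.ahead (t.move d 0).source -
      t.sideIn.ahead (t.move d 0).source = 0 := by
  obtain ⟨x, y⟩ := d
  rw [Ne, Prod.ext_iff, not_and_or] at hd
  simp only [Prod.fst_zero, Prod.snd_zero] at hd
  obtain ⟨c, e, ht⟩ := ht.triangular_cases
  rcases ht with rfl | rfl | rfl <;>
    simp (decide := true) only [Stroke.move, Grid.step_triangular_zero, Grid.one_mul,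
      Prod.fst_add, Prod.snd_add, zero_add, Stroke.crossing, Stroke.leftFace, Stroke.sideIn,
      Stroke.sideOut, Grid.two_add_four, Grid.four_add_four, Grid.two_add_two, Grid.four_add_two,
      Stroke.ahead, Prod.fst_sub, Prod.snd_sub, if_true, if_false] <;>
    (try split_ifs) <;> omega

theorem Stroke.crossing_move {s t : Stroke .triangular} (hs : s.Positive) (ht : t.Positive)
    (d : Grid.triangular.Point) :
    (s.move d 0).crossing (t.move d 0).leftFace = s.crossing t.leftFace := by
  obtain ⟨x, y⟩ := d
  obtain ⟨a, b, hs⟩ := hs.triangular_cases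
  obtain ⟨c, e, ht⟩ := ht.triangular_cases
  rcases hs with rfl | rfl | rfl <;>
  rcases ht with rfl | rfl | rfl <;>
    simp (decide := true) only [Stroke.move, Grid.step_triangular_zero, Grid.one_mul,
      Prod.fst_add, Prod.snd_add, zero_add, Stroke.crossing, Stroke.leftFace, if_true, if_false] <;>
    (try split_ifs) <;> omega

/-- A curve that is invariant under a translation does not turn in total, if two successive periods
of it are self-avoiding. -/
theorem sum_turnInt_eq_zero {s : ℕ → Stroke .triangular} (hs : IsWalk s) {m : ℕ} (hm : 0 < m)
    {d : Grid.triangular.Point} (hd : ∀ i, s (i + m) = (s i).move d 0)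
    (hinj : ∀ i j, i < 2 * m → j < 2 * m → s i = s j → i = j)
    (hcross : ∀ i j, i + 1 < 2 * m → j + 1 < 2 * m → (s (i + 1)).heading = (s i).heading →
      (s (j + 1)).heading = (s j).heading → (s (i + 1)).source = (s (j + 1)).source →
      (s i).heading = (s j).heading) :
    ∑ i ∈ Finset.range m, Grid.turnInt .triangular ((s (i + 1)).heading - (s i).heading) = 0 := by
  have hd0 : d ≠ 0 := by
    rintro rfl
    have := hinj (0 + m) 0 (by omega) (by omega) (by rw [hd, Stroke.move_zero])
    omega
  -- The winding number of a sliding window of `m` strokes around the left face of the stroke before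
  -- it. After `m` steps the whole picture is translated, so `U` and the phase `ψ` return to their
  -- values and the turns must sum to 0.
  set U : ℕ → ℤ := fun i => winding s (i + 1) (i + m + 1) (s i).leftFace with hU
  set ψ : ℕ → ℤ := fun i =>
    Grid.phase .triangular (s i).heading + 3 * shiftPhase d (s i).heading with hψ
  have hstep : ∀ i < m, 3 * (U (i + 1) - U i) =
      -Grid.turnInt .triangular ((s (i + 1)).heading - (s i).heading) + ψ (i + 1) - ψ i := by
    intro i hi
    have hb : U (i + 1) = winding s (i + 1) (i + m + 1) (s (i + 1)).leftFace -
        (s (i + 1)).crossing (s (i + 1)).leftFace +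
        ((s (i + 1)).move d 0).crossing (s (i + 1)).leftFace := by
      rw [winding_succ_bot s (show i + 1 < i + m + 1 by omega), ← hd (i + 1)]
      simp only [hU, winding]
      rw [show i + 1 + m + 1 = (i + m + 1) + 1 by omega, Finset.sum_Ico_succ_top (by omega),
        show i + 1 + m = i + m + 1 by omega]
      ring
    have hsm : s (i + m + 1) = (s (i + 1)).move d 0 := by
      rw [← hd, add_right_comm]
    rcases (hs.positive i).turn_cases (hs.positive (i + 1)) (hs.source_succ i) with
      h | h | ⟨-, h⟩
    · have h1 := phase_left (hs.positive i) (hs.positive (i + 1)) h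
      have h2 := shiftPhase_left (hs.positive i) (hs.positive (i + 1)) hd0 h
      have h3 := winding_left_turn (b := i + m + 1) hs h
      simp only [Grid.sides, Nat.cast_ofNat] at h1
      simp only [hψ]
      rw [hb]
      simp only [hU]
      linarith
    · have h1 := phase_right (hs.positive i) (hs.positive (i + 1)) (hs.source_succ i) h
      have h2 := shiftPhase_right (hs.positive i) (hs.positive (i + 1)) hd0 (hs.source_succ i) h
      have h3 := winding_right_turn (b := i + m + 1) hs (by omega) h
        (traversals_eq_zero fun k hk1 hk2 hk => by
          have := hinj _ _ (by omega) (by omega) hk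
          omega)
        (traversals_eq_one le_rfl (by omega) fun k hk1 hk2 hk =>
          hinj _ _ (by omega) (by omega) hk)
      rw [hsm] at h3
      simp only [Grid.sides, Nat.cast_ofNat] at h1
      simp only [hψ]
      rw [hb]
      simp only [hU]
      linarith
    · have h1 := crossing_straight (hs.positive (i + 1))
      have h2 := shiftPhase_straight (hs.positive (i + 1)) hd0
      have hside : traversals s (i + 1) (i + m + 1) (s (i + 1)).sideIn =
          traversals s (i + 1) (i + m + 1) (s (i + 1)).sideOut := by
        have := traversals_succ (s := s) (show i + 1 ≤ i + m by omega) (e := (s (i + 1)).sideIn)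
          (e' := (s (i + 1)).sideOut) fun k hk1 hk2 =>
            straight_side_iff hs h
              (fun hk => by rw [Nat.succ_injective (hinj _ _ (by omega) (by omega) hk)])
              (fun hk => by rw [hinj _ _ (by omega) (by omega) hk])
              (fun hk1 hk2 => hcross _ _ (by omega) (by omega) h hk1 hk2)
        -- The pairing of `sideIn` with the next `sideOut` leaves over the ends of the window, but
        -- `s (i + 1)` and `s (i + m)`, a translate of `s i`, have the heading of the straight
        -- passage and are no side edges.
        simp only [traversals, Finset.sum_Ico_succ_top (show i + 1 ≤ i + m by omega)] at this ⊢
        rw [this, if_neg (show s (i + 1) ≠ (s (i + 1)).sideOut from fun h' =>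
          (by decide : ∀ h : ZMod 6, h ≠ h + 2) _ (congrArg Stroke.heading h')),
          if_neg (show s (i + m) ≠ (s (i + 1)).sideIn from fun h' => ?_)]
        · ring
        · have h' := congrArg Stroke.heading h'
          rw [hd] at h'
          simp only [Stroke.move, Stroke.sideIn, zero_add, h] at h'
          exact (by decide : ∀ h : ZMod 6, h ≠ h + 4) _ h'
      have h3 := winding_straight hs (show i + 1 ≤ i + m + 1 by omega) h hside
      rw [hsm] at h3
      rw [h, sub_self, turnInt_zero]
      simp only [hψ]
      rw [hb, h]
      simp only [hU]
      linarith
  have hsum : ∀ k ≤ m, 3 * (U k - U 0) = -∑ i ∈ Finset.range k,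
      Grid.turnInt .triangular ((s (i + 1)).heading - (s i).heading) + ψ k - ψ 0 := by
    intro k
    induction k with
    | zero => simp
    | succ k ih =>
      intro hk
      have h1 := ih (by omega)
      have h2 := hstep k (by omega)
      rw [Finset.sum_range_succ]
      linarith
  have hUm : U m = U 0 := by
    simp only [hU, winding]
    rw [show (m + 1) = 0 + 1 + m by omega, show m + m + 1 = 0 + m + 1 + m by omega,
      ← Finset.sum_Ico_add']
    refine Finset.sum_congr rfl fun k _ => ?_
    have := hd 0
    rw [zero_add] at this
    rw [hd, this, Stroke.crossing_move (hs.positive _) (hs.positive _)]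
  have hψm : ψ m = ψ 0 := by
    have := hd 0
    rw [zero_add] at this
    simp only [hψ, this, Stroke.move, zero_add]
  have := hsum m le_rfl
  rw [hUm, hψm] at this
  linarith


/-! # From words to sequences of turns -/

/-- The turns made before each `F` of a word, if the angle `a` has been turned through already. -/
def turnList (G : Grid) : G.Heading → List Letter → List G.Heading
  | _, [] => []
  | a, Letter.F :: w => a :: turnList G 0 w
  | a, Letter.plus :: w => turnList G (a + G.turn) w
  | a, Letter.minus :: w => turnList G (a - G.turn) w
  | a, Letter.zero :: w => turnList G a w

/-- The turn made after the last `F` of a word. -/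
def finalTurn (G : Grid) : G.Heading → List Letter → G.Heading
  | a, [] => a
  | _, Letter.F :: w => finalTurn G 0 w
  | a, Letter.plus :: w => finalTurn G (a + G.turn) w
  | a, Letter.minus :: w => finalTurn G (a - G.turn) w
  | a, Letter.zero :: w => finalTurn G a w

theorem turnList_append (G : Grid) (a : G.Heading) (u v : List Letter) :
    turnList G a (u ++ v) = turnList G a u ++ turnList G (finalTurn G a u) v := by
  induction u generalizing a with
  | nil => rfl
  | cons l u ih => cases l <;> simp [turnList, finalTurn, ih]

theorem finalTurn_append_F (G : Grid) (a : G.Heading) (u : List Letter) :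
    finalTurn G a (u ++ [Letter.F]) = 0 := by
  induction u generalizing a with
  | nil => rfl
  | cons l u ih => cases l <;> simp [finalTurn, ih]

/-- The production begins and ends with `F`: the turn pending before an `F` is made before the first
stroke of its copy, and no turn is pending after the copy. -/
theorem turnList_flatMap (G : Grid) (A X : List Letter) (hX : (Letter.F :: X).getLast? = some Letter.F)
    (a : G.Heading) (w : List Letter) :
    turnList G a (w.flatMap (simpleLSystem A (Letter.F :: X)).production) =
      (turnList G a w).flatMap fun t => t :: turnList G 0 X := by
  induction w generalizing a with
  | nil => rfl
  | cons l w ih =>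
    cases l
    · have hf : finalTurn G a (Letter.F :: X) = 0 := by
        obtain ⟨u, hu⟩ := List.getLast?_eq_some_iff.1 hX
        rw [hu, finalTurn_append_F]
      rw [List.flatMap_cons, turnList_append]
      change turnList G a (Letter.F :: X) ++ turnList G (finalTurn G a (Letter.F :: X)) _ = _
      rw [hf, ih]
      simp [turnList]
    all_goals
      rw [List.flatMap_cons, turnList_append]
      simp [simpleLSystem, turnList, finalTurn, ← ih]

/-- The walk that starts with a given stroke and makes the turn `t i` before the stroke with index
`i`, for `i > 0`. -/
def walk {G : Grid} (e : Stroke G) (t : ℕ → G.Heading) : ℕ → Stroke G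
  | 0 => e
  | i + 1 => ⟨(walk e t i).target, (walk e t i).heading + t (i + 1)⟩

theorem walk_succ' {G : Grid} (e : Stroke G) (t : ℕ → G.Heading) (i : ℕ) :
    walk e t (i + 1) = walk ⟨e.target, e.heading + t 1⟩ (fun j => t (j + 1)) i := by
  induction i with
  | zero => rfl
  | succ i ih => rw [walk, ih, walk]

theorem walk_congr {G : Grid} (e : Stroke G) {t t' : ℕ → G.Heading} {N : ℕ}
    (h : ∀ i, 0 < i → i < N → t i = t' i) : ∀ i < N, walk e t i = walk e t' i := by
  intro i
  induction i with
  | zero => intro _; rfl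
  | succ i ih =>
    intro hi
    simp only [walk]
    rw [ih (by omega), h (i + 1) (by omega) hi]

/-- `walk` ignores the turn with index 0, so the turn pending at the beginning has to enter through
the heading of the initial stroke. -/
theorem turtle_eq_map (G : Grid) (w : List Letter) (p : G.Point) (h a : G.Heading) :
    turtle G p (h + a) w = (List.range (turnList G a w).length).map
      (walk ⟨p, h + (turnList G a w).getD 0 0⟩ fun i => (turnList G a w).getD i 0) := by
  induction w generalizing p h a with
  | nil => rfl
  | cons l w ih =>
    cases l
    · rw [turtle, turnList]
      have := ih (p + G.step (h + a)) (h + a) 0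
      rw [add_zero] at this
      rw [this, List.length_cons, List.range_succ_eq_map, List.map_cons, List.map_map]
      refine congrArg₂ _ rfl (List.map_congr_left fun i _ => ?_)
      rw [Function.comp_apply, Nat.succ_eq_add_one, walk_succ']
      rfl
    · rw [turtle, turnList, add_assoc, ih]
    · rw [turtle, turnList, ← ih, add_sub_assoc]
    · rw [turtle, turnList, ih]

/-- The sequence of turns of the curve that results from a curve with the sequence of turns `A`,
when each stroke is replaced by a curve of `m` strokes with the sequence of turns `x`. -/
def substTurns {H : Type*} (x : ℕ → H) (m : ℕ) (A : ℕ → H) (i : ℕ) : H :=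
  if i % m = 0 then A (i / m) else x (i % m)

theorem getD_flatMap {H : Type*} (z : H) (xs L : List H) {i : ℕ}
    (hi : i < (xs.length + 1) * L.length) :
    (L.flatMap fun t => t :: xs).getD i z =
      substTurns (fun j => (z :: xs).getD j z) (xs.length + 1) (fun j => L.getD j z) i := by
  induction L generalizing i with
  | nil => simp at hi
  | cons t L ih =>
    rw [List.flatMap_cons]
    rcases Nat.lt_or_ge i (xs.length + 1) with h | h
    · rw [List.getD_append _ _ _ _ (by simpa using h), substTurns, Nat.mod_eq_of_lt h,
        Nat.div_eq_of_lt h]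
      cases i with
      | zero => simp
      | succ i => simp
    · obtain ⟨k, rfl⟩ := Nat.exists_eq_add_of_le h
      rw [List.getD_append_right _ _ _ _ (by simp)]
      rw [show (xs.length + 1 + k) - (t :: xs).length = k by simp, ih, substTurns, substTurns,
        Nat.add_mod_left, Nat.add_div_left _ (by omega)]
      · rfl
      · rw [List.length_cons, Nat.mul_succ] at hi
        omega

theorem length_flatMap_cons {H : Type*} (xs L : List H) :
    (L.flatMap fun t => t :: xs).length = (xs.length + 1) * L.length := by
  induction L with
  | nil => simp
  | cons t L ih => rw [List.flatMap_cons, List.length_append, ih, List.length_cons]; simp; ring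

/-- The stroke from the origin with heading `0`. -/
def Stroke.origin (G : Grid) : Stroke G := ⟨0, 0⟩

/-- The sequence of turns of the `n`-th iterate of a curve with `m` strokes and with turns `x`. -/
def iterTurns (G : Grid) (x : ℕ → G.Heading) (m : ℕ) : ℕ → ℕ → G.Heading
  -- A junk value: a single stroke has no inner turns. An admissible turn keeps the infinite walk
  -- positive.
  | 0 => fun _ => G.turn
  | n + 1 => substTurns x m (iterTurns G x m n)

/-- The sequence of turns of a production word without its first letter `F`. -/
def wordTurns (G : Grid) (X : List Letter) (j : ℕ) : G.Heading := (0 :: turnList G 0 X).getD j 0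

/-- The number of strokes of a production word whose first letter `F` is removed. -/
def wordLength (G : Grid) (X : List Letter) : ℕ := (turnList G 0 X).length + 1

section

variable (G : Grid) {X : List Letter}

theorem substTurns_congr {H : Type*} {x A A' : ℕ → H} {m N : ℕ} (hm : 0 < m)
    (h : ∀ i, 0 < i → i < N → A i = A' i) {i : ℕ} (hi : 0 < i) (hiN : i < m * N) :
    substTurns x m A i = substTurns x m A' i := by
  rw [substTurns, substTurns]
  split_ifs with h0
  · refine h _ (Nat.div_pos (Nat.le_of_dvd hi (Nat.dvd_of_mod_eq_zero h0)) hm) ?_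
    exact Nat.div_lt_of_lt_mul hiN
  · rfl

theorem turnList_iterate (hX : (Letter.F :: X).getLast? = some Letter.F) (n : ℕ) :
    (turnList G 0 ((simpleLSystem [Letter.F] (Letter.F :: X)).iterate n)).length =
        wordLength G X ^ n ∧
      (turnList G 0 ((simpleLSystem [Letter.F] (Letter.F :: X)).iterate n)).getD 0 0 = 0 ∧
      ∀ i, 0 < i → i < wordLength G X ^ n →
        (turnList G 0 ((simpleLSystem [Letter.F] (Letter.F :: X)).iterate n)).getD i 0 =
          iterTurns G (wordTurns G X) (wordLength G X) n i := by
  induction n with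
  | zero =>
    refine ⟨rfl, rfl, fun i h1 h2 => ?_⟩
    simp at h2; omega
  | succ n ih =>
    obtain ⟨h1, h2, h3⟩ := ih
    rw [LSystem.iterate, turnList_flatMap G _ _ hX]
    have hlen := length_flatMap_cons (turnList G 0 X)
      (turnList G 0 ((simpleLSystem [Letter.F] (Letter.F :: X)).iterate n))
    rw [h1] at hlen
    have hm : 0 < wordLength G X := Nat.succ_pos _
    have hget := fun i h => getD_flatMap 0 (turnList G 0 X)
      (turnList G 0 ((simpleLSystem [Letter.F] (Letter.F :: X)).iterate n)) (i := i) h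
    rw [h1] at hget
    refine ⟨hlen.trans (pow_succ' _ _).symm, ?_, fun i hi hin => ?_⟩
    · rw [hget 0 (Nat.mul_pos hm (pow_pos hm n))]
      simpa [substTurns] using h2
    · rw [pow_succ'] at hin
      rw [hget i hin]
      exact substTurns_congr hm h3 hi hin

theorem curve_iterate (hX : (Letter.F :: X).getLast? = some Letter.F) (n : ℕ) :
    curve G ((simpleLSystem [Letter.F] (Letter.F :: X)).iterate n) =
      (List.range (wordLength G X ^ n)).map
        (walk (Stroke.origin G) (iterTurns G (wordTurns G X) (wordLength G X) n)) := by
  obtain ⟨h1, h2, h3⟩ := turnList_iterate G hX n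
  have := turtle_eq_map G ((simpleLSystem [Letter.F] (Letter.F :: X)).iterate n) 0 0 0
  rw [h1, h2, add_zero] at this
  rw [curve, this]
  refine List.map_congr_left fun i hi => ?_
  exact walk_congr _ h3 i (List.mem_range.1 hi)

theorem tile_eq (hX : (Letter.F :: X).getLast? = some Letter.F) {t : Letter} {l : G.Heading}
    (ht : ∀ w, turnList G 0 (t :: w) = turnList G l w) :
    tile G (Letter.F :: X) t =
      (List.range (G.sides * wordLength G X)).map (walk (Stroke.origin G)
        (substTurns (wordTurns G X) (wordLength G X) fun _ => l)) := by
  have hF : ∀ a w, turnList G a (Letter.F :: w) = a :: turnList G 0 w := fun _ _ => rfl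
  have hs : turnList G 0 (tileStart G t) = 0 :: List.replicate (G.sides - 1) l := by
    cases G <;> simp [tileStart, Grid.sides, List.replicate, List.intersperse, hF, ht, turnList]
  have hside : 0 < G.sides := by cases G <;> simp [Grid.sides]
  have hm : 0 < wordLength G X := Nat.succ_pos _
  have hlen := length_flatMap_cons (turnList G 0 X) (turnList G 0 (tileStart G t))
  have hget := fun i h => getD_flatMap 0 (turnList G 0 X) (turnList G 0 (tileStart G t)) (i := i) h
  have hl : (turnList G 0 (tileStart G t)).length = G.sides := by
    rw [hs]; simp; omega
  rw [hl] at hlen hget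
  have := turtle_eq_map G ((simpleLSystem (tileStart G t) (Letter.F :: X)).iterate 1) 0 0 0
  rw [LSystem.iterate, turnList_flatMap G _ _ hX] at this
  change turtle G 0 (0 + 0) _ = (List.range (((turnList G 0 (tileStart G t)).flatMap
    fun t => t :: turnList G 0 X).length)).map (walk ⟨0, 0 + ((turnList G 0 (tileStart G t)).flatMap
    fun t => t :: turnList G 0 X).getD 0 0⟩ fun i => ((turnList G 0 (tileStart G t)).flatMap
    fun t => t :: turnList G 0 X).getD i 0) at this
  rw [hlen, add_zero] at this
  rw [tile, curve, LSystem.iterate]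
  refine this.trans ?_
  rw [mul_comm G.sides]
  refine List.map_congr_left fun i hi => ?_
  have e0 : ((turnList G 0 (tileStart G t)).flatMap fun t => t :: turnList G 0 X).getD 0 0 = 0 := by
    rw [hs]; rfl
  rw [e0, add_zero]
  refine walk_congr _ (fun i hi hin => ?_) i (List.mem_range.1 hi)
  rw [hget i hin]
  refine substTurns_congr hm (fun i hi hin => ?_) hi hin
  rw [hs]
  obtain ⟨k, rfl⟩ : ∃ k, i = k + 1 := ⟨i - 1, by omega⟩
  rw [List.getD_cons_succ, List.getD_eq_getElem _ _ (by simp; omega), List.getElem_replicate]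

end


/-! # Self-avoidance of walks -/

/-- The turns that a self-avoiding curve can make. -/
def Grid.IsTurn (G : Grid) (δ : G.Heading) : Prop :=
  δ = G.turn ∨ δ = -G.turn ∨ (G = .triangular ∧ δ = 0)

theorem Stroke.Positive.next {G : Grid} {s : Stroke G} (hs : s.Positive) {δ : G.Heading}
    (hδ : G.IsTurn δ) : Stroke.Positive (⟨s.target, s.heading + δ⟩ : Stroke G) := by
  cases G
  · obtain ⟨a, b, hs⟩ := hs.square_cases
    have e : ∀ h : Grid.square.Heading, h + δ = h + 1 ∨ h + δ = h + 3 := by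
      rcases hδ with rfl | rfl | ⟨h, -⟩
      · exact fun h => Or.inl rfl
      · exact fun h => Or.inr rfl
      · cases h
    have e1 : (1 : Grid.square.Heading) + 1 = 2 := by decide
    have e2 : (1 : Grid.square.Heading) + 3 = 0 := by decide
    have e3 : (2 : Grid.square.Heading) + 1 = 3 := by decide
    have e4 : (2 : Grid.square.Heading) + 3 = 1 := by decide
    have e5 : (3 : Grid.square.Heading) + 1 = 0 := by decide
    have e6 : (3 : Grid.square.Heading) + 3 = 2 := by decide
    rcases hs with ⟨h1, rfl⟩ | ⟨h1, rfl⟩ | ⟨h1, rfl⟩ | ⟨h1, rfl⟩ <;>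
    rcases e _ with h | h <;> rw [h] <;>
    simp only [Stroke.target, zero_add, e1, e2, e3, e4, e5, e6] <;>
    simp (decide := true) only [Stroke.Positive, Grid.step_square_zero, Grid.step_square_one,
      Grid.step_square_two, Grid.step_square_three, Prod.fst_add, Prod.snd_add, and_true,
      and_false, or_false, false_or] <;> omega
  · have key : ∀ h δ : ZMod 6, h = 0 ∨ h = 2 ∨ h = 4 → δ = 2 ∨ δ = -2 ∨ δ = 0 →
        h + δ = 0 ∨ h + δ = 2 ∨ h + δ = 4 := by decide
    refine key _ _ hs ?_
    rcases hδ with h | h | ⟨-, h⟩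
    · exact Or.inl h
    · exact Or.inr (Or.inl h)
    · exact Or.inr (Or.inr h)

theorem Stroke.positive_origin (G : Grid) : (Stroke.origin G).Positive := by
  cases G
  · exact Or.inl ⟨rfl, Or.inl rfl⟩
  · exact Or.inl rfl

theorem isWalk_walk {G : Grid} {e : Stroke G} (he : e.Positive) {t : ℕ → G.Heading}
    (ht : ∀ i, 0 < i → G.IsTurn (t i)) : IsWalk (walk e t) := by
  refine ⟨fun i => rfl, fun i => ?_⟩
  induction i with
  | zero => exact he
  | succ i ih => exact ih.next (ht _ (Nat.succ_pos _))

/-- The first `N` strokes of a walk traverse no edge twice, and the walk does not cross itself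
there. -/
structure SimpleOn {G : Grid} (s : ℕ → Stroke G) (N : ℕ) : Prop where
  inj : ∀ i j, i < N → j < N → s i = s j → i = j
  noCross : ∀ i j, i + 1 < N → j + 1 < N → (s (i + 1)).heading = (s i).heading →
    (s (j + 1)).heading = (s j).heading → (s (i + 1)).source = (s (j + 1)).source →
    (s i).heading = (s j).heading

theorem SimpleOn.mono {G : Grid} {s : ℕ → Stroke G} {M N : ℕ} (h : SimpleOn s N) (hM : M ≤ N) :
    SimpleOn s M :=
  ⟨fun i j hi hj => h.inj i j (by omega) (by omega),
    fun i j hi hj => h.noCross i j (by omega) (by omega)⟩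

theorem mem_passages {G : Grid} {s : ℕ → Stroke G} {N : ℕ} {p : Stroke G × Stroke G} :
    p ∈ passages ((List.range N).map s) ↔ ∃ i, i + 1 < N ∧ p = (s i, s (i + 1)) := by
  simp only [passages, List.mem_iff_getElem, List.length_zip, List.length_map, List.length_range,
    List.length_tail, List.getElem_zip, List.getElem_map, List.getElem_range, List.getElem_tail]
  constructor
  · rintro ⟨i, hi, rfl⟩
    exact ⟨i, by omega, rfl⟩
  · rintro ⟨i, hi, rfl⟩
    exact ⟨i, by omega, rfl⟩

theorem mem_closedPassages {G : Grid} {s : ℕ → Stroke G} {N : ℕ} {p : Stroke G × Stroke G} :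
    p ∈ closedPassages ((List.range N).map s) ↔ ∃ i < N, p = (s i, s ((i + 1) % N)) := by
  simp only [closedPassages, List.mem_iff_getElem, List.length_zip, List.length_map,
    List.length_range, List.length_rotate, List.getElem_zip, List.getElem_map,
    List.getElem_range, List.getElem_rotate, min_self]
  constructor
  · rintro ⟨i, hi, rfl⟩
    exact ⟨i, hi, rfl⟩
  · rintro ⟨i, hi, rfl⟩
    exact ⟨i, hi, rfl⟩

theorem nodup_edges_iff {G : Grid} {s : ℕ → Stroke G} {N : ℕ} :
    (((List.range N).map s).map Stroke.edge).Nodup ↔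
      ∀ i j, i < N → j < N → (s i).edge = (s j).edge → i = j := by
  rw [List.map_map, List.nodup_map_iff_inj_on List.nodup_range]
  simp only [List.mem_range, Function.comp_apply]
  exact ⟨fun h i j hi hj => h i hi j hj, fun h i hi j hj => h i j hi hj⟩

theorem IsWalk.nodup_edges_iff {G : Grid} {s : ℕ → Stroke G} (hs : IsWalk s) {N : ℕ} :
    (((List.range N).map s).map Stroke.edge).Nodup ↔
      ∀ i j, i < N → j < N → s i = s j → i = j := by
  rw [_root_.nodup_edges_iff]
  exact ⟨fun h i j hi hj e => h i j hi hj (by rw [e]),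
    fun h i j hi hj e => h i j hi hj ((hs.positive i).edge_injective (hs.positive j) e)⟩

theorem IsWalk.cross_iff {G : Grid} {s : ℕ → Stroke G} (hs : IsWalk s) (i j : ℕ) :
    Cross (s i, s (i + 1)) (s j, s (j + 1)) ↔ (s (i + 1)).source = (s (j + 1)).source ∧
      (s (i + 1)).heading = (s i).heading ∧ (s (j + 1)).heading = (s j).heading ∧
      (s i).heading ≠ (s j).heading :=
  _root_.cross_iff (hs.positive _) (hs.positive _) (hs.positive _) (hs.positive _)
    (hs.source_succ i) (hs.source_succ j)

theorem IsWalk.selfAvoiding_iff {G : Grid} {s : ℕ → Stroke G} (hs : IsWalk s) {N : ℕ} :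
    SelfAvoiding ((List.range N).map s) ↔ SimpleOn s N := by
  rw [SelfAvoiding, hs.nodup_edges_iff]
  constructor
  · rintro ⟨h1, h2⟩
    refine ⟨h1, fun i j hi hj a b c => ?_⟩
    by_contra hne
    exact h2 _ (mem_passages.2 ⟨i, hi, rfl⟩) _ (mem_passages.2 ⟨j, hj, rfl⟩)
      ((hs.cross_iff i j).2 ⟨c, a, b, hne⟩)
  · rintro ⟨h1, h2⟩
    refine ⟨h1, fun p hp q hq h => ?_⟩
    obtain ⟨i, hi, rfl⟩ := mem_passages.1 hp
    obtain ⟨j, hj, rfl⟩ := mem_passages.1 hq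
    obtain ⟨a, b, c, d⟩ := (hs.cross_iff i j).1 h
    exact d (h2 i j hi hj b c a)

theorem IsWalk.simpleOn_of_closedSelfAvoiding {G : Grid} {s : ℕ → Stroke G} (hs : IsWalk s) {N : ℕ}
    (h : ClosedSelfAvoiding ((List.range N).map s)) : SimpleOn s N := by
  refine hs.selfAvoiding_iff.1 ⟨h.1, fun p hp q hq => h.2 p ?_ q ?_⟩
  · obtain ⟨i, hi, rfl⟩ := mem_passages.1 hp
    exact mem_closedPassages.2 ⟨i, by omega, by rw [Nat.mod_eq_of_lt hi]⟩
  · obtain ⟨i, hi, rfl⟩ := mem_passages.1 hq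
    exact mem_closedPassages.2 ⟨i, by omega, by rw [Nat.mod_eq_of_lt hi]⟩

theorem IsSimpleClosed.closedSelfAvoiding {G : Grid} {s : ℕ → Stroke G} {N : ℕ}
    (hs : IsSimpleClosed s N) : ClosedSelfAvoiding ((List.range N).map s) := by
  refine ⟨hs.nodup_edges_iff.2 fun i j hi hj h => ?_, fun p hp q hq h => ?_⟩
  · have := hs.inj i j h
    rwa [Nat.ModEq, Nat.mod_eq_of_lt hi, Nat.mod_eq_of_lt hj] at this
  · obtain ⟨i, hi, rfl⟩ := mem_closedPassages.1 hp
    obtain ⟨j, hj, rfl⟩ := mem_closedPassages.1 hq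
    rw [hs.eq_of_modEq (Nat.mod_modEq (i + 1) N), hs.eq_of_modEq (Nat.mod_modEq (j + 1) N),
      hs.cross_iff] at h
    exact h.2.2.2 (hs.noCross i j h.2.1 h.2.2.1 h.1)

/-! # Substitution -/

theorem walk_move {G : Grid} (e : Stroke G) (t : ℕ → G.Heading) (z : G.Point) (h : G.Heading)
    (i : ℕ) : walk (e.move z h) t i = (walk e t i).move z h := by
  induction i with
  | zero => rfl
  | succ i ih =>
    simp only [walk]
    rw [ih, Stroke.move_target]
    simp only [Stroke.move, add_assoc]

theorem walk_add {G : Grid} (e : Stroke G) (t : ℕ → G.Heading) (k i : ℕ) :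
    walk e t (k + i) = walk (walk e t k) (fun j => t (k + j)) i := by
  induction i with
  | zero => rfl
  | succ i ih => rw [← add_assoc, walk, ih, walk]; rfl

theorem Stroke.move_origin {G : Grid} (z : G.Point) (h : G.Heading) :
    (Stroke.origin G).move z h = ⟨z, h⟩ := by
  simp [Stroke.move, Stroke.origin, G.mul_zero]

/-- The copy of a stroke that belongs to a stroke `b` of a base curve, if the strokes of the base
curve are replaced by curves that end at `d` times the endpoint of the stroke. -/
def Stroke.place {G : Grid} (d : G.Point) (b s : Stroke G) : Stroke G :=
  s.move (G.mul b.source d) b.heading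

/-- Induction along the base curve. Relative to its start, a copy ends at `d` with heading `r`, so
before the next copy the heading has changed by `r` in addition to the turn `A k`: the copies follow
a base curve whose turns are increased by `r`. -/
theorem walk_substTurns {G : Grid} (x A : ℕ → G.Heading) {m : ℕ} (hm : 0 < m) (k : ℕ) :
    ∀ j < m, walk (Stroke.origin G) (substTurns x m A) (m * k + j) =
      Stroke.place (walk (Stroke.origin G) x (m - 1)).target
        (walk (Stroke.origin G) (fun i => A i + (walk (Stroke.origin G) x (m - 1)).heading) k)
        (walk (Stroke.origin G) x j) := by
  set d := (walk (Stroke.origin G) x (m - 1)).target with hd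
  set r := (walk (Stroke.origin G) x (m - 1)).heading with hr
  have key : ∀ k, walk (Stroke.origin G) (substTurns x m A) (m * k) = Stroke.place d
      (walk (Stroke.origin G) (fun i => A i + r) k) (Stroke.origin G) →
      ∀ j < m, walk (Stroke.origin G) (substTurns x m A) (m * k + j) = Stroke.place d
        (walk (Stroke.origin G) (fun i => A i + r) k) (walk (Stroke.origin G) x j) := by
    intro k hk j hj
    rw [walk_add, hk, Stroke.place, Stroke.place, walk_move]
    congr 1
    refine walk_congr _ (fun i hi him => ?_) j hj
    rw [substTurns, Nat.mul_add_mod, Nat.mod_eq_of_lt him, if_neg (by omega)]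
  induction k with
  | zero =>
    refine key 0 ?_
    rw [Nat.mul_zero, Stroke.place]
    change Stroke.origin G = Stroke.move (G.mul 0 d) 0 _
    rw [G.zero_mul, Stroke.move_zero]
  | succ k ih =>
    refine key (k + 1) ?_
    have h1 := ih (m - 1) (by omega)
    have h2 : m * (k + 1) = m * k + (m - 1) + 1 := by
      rw [Nat.mul_succ]; omega
    rw [h2, walk, h1, ← h2, substTurns, Nat.mul_mod_right, if_pos rfl,
      Nat.mul_div_cancel_left _ hm, Stroke.place, Stroke.move_target, Stroke.place,
      Stroke.move_origin]
    refine Stroke.ext ?_ ?_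
    · simp only [walk]
      rw [← hd, Stroke.target, G.add_mul]
    · simp only [walk, Stroke.move]
      rw [← hr]
      ring


/-! # The walks around the tiles -/

section

variable {G : Grid} {x : ℕ → G.Heading} {m : ℕ} {l : G.Heading}

/-- The walk around a tile: the turns `x` are repeated, with the turn `l` in between. -/
def tileWalk (x : ℕ → G.Heading) (m : ℕ) (l : G.Heading) : ℕ → Stroke G :=
  walk (Stroke.origin G) (substTurns x m fun _ => l)

/-- The displacement by a curve with `m` strokes and turns `x`. -/
def displacement (x : ℕ → G.Heading) (m : ℕ) : G.Point := (walk (Stroke.origin G) x (m - 1)).target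

/-- The heading of the last stroke of a curve with `m` strokes and turns `x`. -/
def lastHeading (x : ℕ → G.Heading) (m : ℕ) : G.Heading := (walk (Stroke.origin G) x (m - 1)).heading

/-- The total turn of a curve with `m` strokes and turns `x`. -/
def totalTurn (x : ℕ → G.Heading) (m : ℕ) : ℤ := ∑ j ∈ Finset.Ico 1 m, G.turnInt (x j)

theorem Grid.isTurn_turn (G : Grid) : G.IsTurn G.turn := Or.inl rfl

theorem Grid.isTurn_neg_turn (G : Grid) : G.IsTurn (-G.turn) := Or.inr (Or.inl rfl)

theorem Grid.isTurn_of_or {β : G.Heading} (h : β = G.turn ∨ β = -G.turn) : G.IsTurn β :=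
  h.elim Or.inl fun h => Or.inr (Or.inl h)

theorem isTurn_substTurns {A : ℕ → G.Heading} (hx : ∀ j, 0 < j → j < m → G.IsTurn (x j))
    (hm : 0 < m) (hA : ∀ k, 0 < k → G.IsTurn (A k)) (i : ℕ) (hi : 0 < i) :
    G.IsTurn (substTurns x m A i) := by
  rw [substTurns]
  split_ifs with h
  · exact hA _ (Nat.div_pos (Nat.le_of_dvd hi (Nat.dvd_of_mod_eq_zero h)) hm)
  · exact hx _ (Nat.pos_of_ne_zero h) (Nat.mod_lt _ hm)

theorem isWalk_tileWalk (hx : ∀ j, 0 < j → j < m → G.IsTurn (x j)) (hm : 0 < m)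
    (hl : G.IsTurn l) : IsWalk (tileWalk x m l) :=
  isWalk_walk (Stroke.positive_origin G) (isTurn_substTurns hx hm fun _ _ => hl)

theorem tileWalk_add (hm : 0 < m) (i : ℕ) :
    tileWalk x m l (m + i) =
      (tileWalk x m l i).move (displacement x m) (lastHeading x m + l) := by
  have h := walk_substTurns x (fun _ => l) hm 1 0 hm
  rw [mul_one, add_zero] at h
  rw [tileWalk, walk_add, h]
  have h2 : (fun j => substTurns x m (fun _ => l) (m + j)) = substTurns x m fun _ => l := by
    funext j
    simp only [substTurns, Nat.add_mod_left]
  rw [h2, ← walk_move]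
  congr 1
  refine Stroke.ext ?_ ?_
  · change G.mul (0 + G.step 0) _ + G.mul _ 0 = displacement x m + G.mul _ 0
    rw [zero_add, G.step_zero, G.one_mul, G.mul_zero, G.mul_zero]
    rfl
  · change 0 + (l + lastHeading x m) + 0 = lastHeading x m + l + 0
    ring

theorem tileWalk_heading_sub (i : ℕ) :
    (tileWalk x m l (i + 1)).heading - (tileWalk x m l i).heading =
      substTurns x m (fun _ => l) (i + 1) := by
  simp only [tileWalk, walk, add_sub_cancel_left]

theorem Stroke.move_sides {d : G.Point} {β : G.Heading} (hβ : β = G.turn ∨ β = -G.turn)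
    (s : Stroke G) : (Stroke.move d β)^[G.sides] s = s := by
  cases G
  · have e1 : (1 : Grid.square.Heading) + 1 = 2 := by decide
    have e2 : (2 : Grid.square.Heading) + 1 = 3 := by decide
    have e3 : (3 : Grid.square.Heading) + 1 = 0 := by decide
    have e4 : (3 : Grid.square.Heading) + 3 = 2 := by decide
    have e5 : (2 : Grid.square.Heading) + 3 = 1 := by decide
    have e6 : (1 : Grid.square.Heading) + 3 = 0 := by decide
    change (((s.move d β).move d β).move d β).move d β = s
    rw [Stroke.move_move, Stroke.move_move, Stroke.move_move]
    refine Eq.trans ?_ s.move_zero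
    have hβ' : β = 1 ∨ β = 3 := hβ
    rcases hβ' with rfl | rfl <;> simp only [e1, e2, e3, e4, e5, e6] <;> congr 1 <;> ext <;>
      simp [Grid.mul]
  · have e1 : (2 : Grid.triangular.Heading) + 2 = 4 := by decide
    have e2 : (4 : Grid.triangular.Heading) + 2 = 0 := by decide
    have e3 : (4 : Grid.triangular.Heading) + 4 = 2 := by decide
    have e4 : (2 : Grid.triangular.Heading) + 4 = 0 := by decide
    change ((s.move d β).move d β).move d β = s
    rw [Stroke.move_move, Stroke.move_move]
    refine Eq.trans ?_ s.move_zero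
    have hβ' : β = 2 ∨ β = 4 := hβ
    rcases hβ' with rfl | rfl <;> simp only [e1, e2, e3, e4] <;> congr 1 <;> ext <;>
      simp [Grid.mul] <;> ring

theorem tileWalk_mul_add (hm : 0 < m) (k i : ℕ) :
    tileWalk x m l (k * m + i) =
      (Stroke.move (displacement x m) (lastHeading x m + l))^[k] (tileWalk x m l i) := by
  induction k with
  | zero => simp
  | succ k ih =>
    rw [Function.iterate_succ_apply', ← ih, ← tileWalk_add hm]
    congr 1; ring

theorem tileWalk_periodic (hm : 0 < m)
    (hβ : lastHeading x m + l = G.turn ∨ lastHeading x m + l = -G.turn) (i : ℕ) :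
    tileWalk x m l (i + G.sides * m) = tileWalk x m l i := by
  rw [add_comm, tileWalk_mul_add hm, Stroke.move_sides hβ]

theorem tileWalk_heading_ne (hl : l ≠ 0) {i : ℕ}
    (h : (tileWalk x m l (i + 1)).heading = (tileWalk x m l i).heading) : (i + 1) % m ≠ 0 := by
  intro h0
  have := tileWalk_heading_sub (x := x) (m := m) (l := l) i
  rw [h, sub_self, substTurns, if_pos h0] at this
  exact hl this.symm

theorem Grid.ne_zero_of_or {β : G.Heading} (h : β = G.turn ∨ β = -G.turn) : β ≠ 0 := by
  rcases h with rfl | rfl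
  · exact G.turn_ne_zero
  · exact neg_ne_zero.2 G.turn_ne_zero

theorem Grid.sides_pos (G : Grid) : 0 < G.sides := by cases G <;> simp [Grid.sides]

theorem tileWalk_mod (hm : 0 < m)
    (hβ : lastHeading x m + l = G.turn ∨ lastHeading x m + l = -G.turn) (i : ℕ) :
    tileWalk x m l (i % (G.sides * m)) = tileWalk x m l i := by
  conv_rhs => rw [← Nat.mod_add_div i (G.sides * m)]
  generalize i % (G.sides * m) = a
  induction i / (G.sides * m) with
  | zero => rfl
  | succ k ih => rw [Nat.mul_succ, ← add_assoc, tileWalk_periodic hm hβ, ih]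

/-- The turn `l` between sides is not 0, so a straight passage lies inside one side. Hence the
passage from the last stroke of a period to the first one plays no role for crossings. -/
theorem tileWalk_mod_succ (hm : 0 < m)
    (hβ : lastHeading x m + l = G.turn ∨ lastHeading x m + l = -G.turn) (hl : l ≠ 0) {i : ℕ}
    (h : (tileWalk x m l (i + 1)).heading = (tileWalk x m l i).heading) :
    i % (G.sides * m) + 1 < G.sides * m ∧
      tileWalk x m l (i % (G.sides * m) + 1) = tileWalk x m l (i + 1) := by
  have h0 := tileWalk_heading_ne hl h
  have hn : 0 < G.sides * m := Nat.mul_pos G.sides_pos hm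
  have h1 := Nat.mod_lt i hn
  have h2 : (i + 1) % (G.sides * m) = (i % (G.sides * m) + 1) % (G.sides * m) := by
    rw [Nat.mod_add_mod]
  have h3 : i % (G.sides * m) + 1 < G.sides * m := by
    by_contra hc
    have e : i % (G.sides * m) + 1 = G.sides * m := by omega
    rw [e, Nat.mod_self] at h2
    exact h0 (Nat.mod_eq_zero_of_dvd ((Dvd.intro_left _ rfl).trans (Nat.dvd_of_mod_eq_zero h2)))
  refine ⟨h3, ?_⟩
  rw [Nat.mod_eq_of_lt h3] at h2
  rw [← h2, tileWalk_mod hm hβ]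

theorem isSimpleClosed_tileWalk (hx : ∀ j, 0 < j → j < m → G.IsTurn (x j)) (hm : 0 < m)
    (hβ : lastHeading x m + l = G.turn ∨ lastHeading x m + l = -G.turn)
    (hl : l = G.turn ∨ l = -G.turn) (h : SimpleOn (tileWalk x m l) (G.sides * m)) :
    IsSimpleClosed (tileWalk x m l) (G.sides * m) where
  toIsWalk := isWalk_tileWalk hx hm (G.isTurn_of_or hl)
  pos := Nat.mul_pos G.sides_pos hm
  periodic := tileWalk_periodic hm hβ
  inj i j hij := by
    have hn : 0 < G.sides * m := Nat.mul_pos G.sides_pos hm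
    exact h.inj _ _ (Nat.mod_lt i hn) (Nat.mod_lt j hn)
      (by rw [tileWalk_mod hm hβ, tileWalk_mod hm hβ, hij])
  noCross i j hi hj hij := by
    obtain ⟨h1, h2⟩ := tileWalk_mod_succ hm hβ (G.ne_zero_of_or hl) hi
    obtain ⟨h3, h4⟩ := tileWalk_mod_succ hm hβ (G.ne_zero_of_or hl) hj
    have := h.noCross _ _ h1 h3
    rw [h2, h4, tileWalk_mod hm hβ, tileWalk_mod hm hβ] at this
    exact this hi hj hij

theorem sum_turnInt_tileWalk (hm : 0 < m) :
    ∑ i ∈ Finset.range m,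
      G.turnInt ((tileWalk x m l (i + 1)).heading - (tileWalk x m l i).heading) =
      totalTurn x m + G.turnInt l := by
  obtain ⟨k, rfl⟩ : ∃ k, m = k + 1 := ⟨m - 1, by omega⟩
  rw [Finset.sum_range_succ, totalTurn, Finset.sum_Ico_eq_sum_range]
  congr 1
  · refine Finset.sum_congr rfl fun i hi => ?_
    rw [Finset.mem_range] at hi
    rw [tileWalk_heading_sub, substTurns, Nat.mod_eq_of_lt (by omega), if_neg (by omega), add_comm]
  · rw [tileWalk_heading_sub, substTurns, Nat.mod_self, if_pos rfl]

theorem sum_range_mul_periodic {f : ℕ → ℤ} {m : ℕ} (hf : ∀ i, f (i + m) = f i) (k : ℕ) :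
    ∑ i ∈ Finset.range (k * m), f i = k * ∑ i ∈ Finset.range m, f i := by
  induction k with
  | zero => simp
  | succ k ih =>
    rw [Nat.succ_mul, ← Finset.sum_range_add_sum_Ico _ (Nat.le_add_right (k * m) m), ih,
      sum_Ico_periodic hf]
    push_cast
    ring

theorem sum_turnInt_sides (hm : 0 < m) :
    ∑ i ∈ Finset.range (G.sides * m),
      G.turnInt ((tileWalk x m l (i + 1)).heading - (tileWalk x m l i).heading) =
      G.sides * (totalTurn x m + G.turnInt l) := by
  rw [sum_range_mul_periodic, sum_turnInt_tileWalk hm]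
  intro i
  rw [tileWalk_heading_sub, tileWalk_heading_sub, substTurns, substTurns,
    show i + m + 1 = i + 1 + m by ring, Nat.add_mod_right]

/-- The tile consists of `G.sides` congruent parts, so the theorem of turning tangents can be
divided by `G.sides`. -/
theorem exists_totalTurn (hm : 0 < m) (h : IsSimpleClosed (tileWalk x m l) (G.sides * m)) :
    ∃ c : ℤ, (c = 0 ∨ c = -1) ∧
      (∀ i, winding (tileWalk x m l) 0 (G.sides * m) (tileWalk x m l i).leftFace = c + 1) ∧
      (∀ i, winding (tileWalk x m l) 0 (G.sides * m) (tileWalk x m l i).rightFace = c) ∧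
      (∀ f, winding (tileWalk x m l) 0 (G.sides * m) f = c ∨
        winding (tileWalk x m l) 0 (G.sides * m) f = c + 1) ∧
      totalTurn x m + G.turnInt l = 2 * c + 1 := by
  obtain ⟨c, h1, h2, h3, h4, h5⟩ := h.exists_sum_turnInt
  refine ⟨c, h1, h2, h3, h4, ?_⟩
  rw [sum_turnInt_sides hm] at h5
  exact mul_left_cancel₀ (by have := G.sides_pos; positivity) h5

theorem Grid.turnInt_mul {δ : G.Heading} (h : G.IsTurn δ) : ((G.turnInt δ : ℤ) : G.Heading) * G.turn = δ := by
  rcases h with rfl | rfl | ⟨rfl, rfl⟩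
  · simp [Grid.turnInt]
  · simp [Grid.turnInt, G.turn_ne_neg.symm]
  · rw [turnInt_zero]; simp

theorem lastHeading_eq (hx : ∀ j, 0 < j → j < m → G.IsTurn (x j)) :
    lastHeading x m = ((totalTurn x m : ℤ) : G.Heading) * G.turn := by
  have key : ∀ i, i < m → (walk (Stroke.origin G) x i).heading =
      ((∑ j ∈ Finset.Ico 1 (i + 1), G.turnInt (x j) : ℤ) : G.Heading) * G.turn := by
    intro i
    induction i with
    | zero => intro _; simp [walk, Stroke.origin]
    | succ i ih =>
      intro hi
      rw [Finset.sum_Ico_succ_top (by omega), Int.cast_add, _root_.add_mul, ← ih (by omega),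
        Grid.turnInt_mul (hx _ (by omega) hi)]
      rfl
  rcases Nat.eq_zero_or_pos m with rfl | hm
  · simp [lastHeading, totalTurn, walk, Stroke.origin]
  · rw [lastHeading, key _ (by omega), Nat.sub_add_cancel hm, totalTurn]

/-- If the joining turn cancels the end heading, the sides are translates of each other and do not
close up. -/
theorem totalTurn_of_translation {x : ℕ → Grid.triangular.Heading} {l : Grid.triangular.Heading}
    (hx : ∀ j, 0 < j → j < m → Grid.triangular.IsTurn (x j)) (hm : 0 < m)
    (hl : Grid.triangular.IsTurn l) (hβ : lastHeading x m + l = 0)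
    (h : SimpleOn (tileWalk x m l) (2 * m)) : totalTurn x m + Grid.triangular.turnInt l = 0 := by
  rw [← sum_turnInt_tileWalk hm]
  refine sum_turnInt_eq_zero (isWalk_tileWalk hx hm hl) hm (d := displacement x m) (fun i => ?_)
    h.inj h.noCross
  rw [add_comm, tileWalk_add hm, hβ]

end


/-! ### The end heading of a curve both of whose tiles are self-avoiding -/

section

variable {G : Grid} {x : ℕ → G.Heading} {m : ℕ} {l : G.Heading}

theorem Grid.turnInt_turn (G : Grid) : G.turnInt G.turn = 1 := if_pos rfl

theorem Grid.turnInt_neg_turn (G : Grid) : G.turnInt (-G.turn) = -1 := by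
  rw [Grid.turnInt, if_neg G.turn_ne_neg.symm, if_pos rfl]

theorem Stroke.move_move_opposite {d : Grid.square.Point} (s : Stroke .square) :
    (s.move d 2).move d 2 = s := by
  rw [Stroke.move_move]
  refine Eq.trans ?_ s.move_zero
  have e : (2 : Grid.square.Heading) + 2 = 0 := by decide
  rw [e]
  congr 1
  ext <;> simp [Grid.mul]

theorem tileWalk_opposite {x : ℕ → Grid.square.Heading} {l : Grid.square.Heading} (hm : 0 < m)
    (hβ : lastHeading x m + l = 2) (i : ℕ) : tileWalk x m l (2 * m + i) = tileWalk x m l i := by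
  rw [two_mul, add_assoc, tileWalk_add hm, tileWalk_add hm, hβ, Stroke.move_move_opposite]

/-- If both tiles are simple, then a curve ends with the heading with which it starts. -/
theorem lastHeading_eq_zero (hx : ∀ j, 0 < j → j < m → G.IsTurn (x j)) (hm : 0 < m)
    (h : ∀ l, l = G.turn ∨ l = -G.turn → SimpleOn (tileWalk x m l) (G.sides * m)) :
    lastHeading x m = 0 := by
  have hr := lastHeading_eq hx
  have t1 := G.turnInt_turn
  have t2 := G.turnInt_neg_turn
  cases G
  -- For an odd end heading one of the two turns makes the walk close up already after two sides.
  · have odd : ∀ l : Grid.square.Heading, l = 1 ∨ l = -1 → lastHeading x m + l ≠ 2 := by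
      intro l hl hβ
      have h1 := tileWalk_opposite hm hβ 0
      have h2 := (h l hl).inj _ _ (by simp only [Grid.sides]; omega)
        (by simp only [Grid.sides]; omega) h1
      omega
    have h2 : ∀ r : ZMod 4, r + 1 ≠ 2 → r + -1 ≠ 2 → r = 0 ∨ r = 2 := by decide
    rcases h2 _ (odd 1 (Or.inl rfl)) (odd (-1) (Or.inr rfl)) with h0 | h0
    · exact h0
    have c1 := isSimpleClosed_tileWalk hx hm
      (by rw [h0]; exact Or.inr (by decide)) (Or.inl rfl) (h _ (Or.inl rfl))
    have c2 := isSimpleClosed_tileWalk hx hm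
      (by rw [h0]; exact Or.inl (by decide)) (Or.inr rfl) (h _ (Or.inr rfl))
    obtain ⟨c, hc, -, -, -, e1⟩ := exists_totalTurn hm c1
    obtain ⟨c', hc', -, -, -, e2⟩ := exists_totalTurn hm c2
    rw [t1] at e1
    rw [t2] at e2
    -- Both `totalTurn x m + 1` and `totalTurn x m - 1` are 1 or -1.
    have : totalTurn x m = 0 := by omega
    rw [hr, this, Int.cast_zero, MulZeroClass.zero_mul]
  · have h3 : ∀ k : ZMod 6, k * 2 = 0 ∨ k * 2 = 2 ∨ k * 2 = -2 := by decide
    rcases h3 (totalTurn x m : ℤ) with h0 | h0 | h0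
    -- In the other two cases one tile is closed, with turn 1 or -1 per side, while for the other
    -- letter the sides are translates with turn 0. These values differ by 2 in the wrong direction.
    · exact hr.trans h0
    · have h0' := hr.trans h0
      have c1 := isSimpleClosed_tileWalk hx hm
        (by rw [h0']; exact Or.inr (by decide)) (Or.inl rfl) (h _ (Or.inl rfl))
      obtain ⟨c, hc, -, -, -, e1⟩ := exists_totalTurn hm c1
      have e2 := totalTurn_of_translation hx hm (Grid.isTurn_neg_turn _)
        (by rw [h0']; decide) ((h _ (Or.inr rfl)).mono (by simp only [Grid.sides]; omega))
      omega
    · have h0' := hr.trans h0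
      have c1 := isSimpleClosed_tileWalk hx hm
        (by rw [h0']; exact Or.inl (by decide)) (Or.inr rfl) (h _ (Or.inr rfl))
      obtain ⟨c, hc, -, -, -, e1⟩ := exists_totalTurn hm c1
      have e2 := totalTurn_of_translation hx hm (Grid.isTurn_turn _)
        (by rw [h0']; decide) ((h _ (Or.inl rfl)).mono (by simp only [Grid.sides]; omega))
      omega

theorem isSimpleClosed_tiles (hx : ∀ j, 0 < j → j < m → G.IsTurn (x j)) (hm : 0 < m)
    (h : ∀ l, l = G.turn ∨ l = -G.turn → SimpleOn (tileWalk x m l) (G.sides * m))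
    (hl : l = G.turn ∨ l = -G.turn) : IsSimpleClosed (tileWalk x m l) (G.sides * m) :=
  isSimpleClosed_tileWalk hx hm (by rwa [lastHeading_eq_zero hx hm h, zero_add]) hl (h _ hl)

end


/-! # Copies of a curve along the strokes of a base curve -/

section

variable {G : Grid} {x : ℕ → G.Heading} {m : ℕ} {l : G.Heading}

/-- On the square grid the hypothesis on `d` says that its coordinate sum is odd, so that
multiplication by `d` preserves the parity of points. On the triangular grid it is always true and
only headings matter. -/
theorem Stroke.Positive.place {d : G.Point} (hd : Stroke.Positive (⟨d, G.turn⟩ : Stroke G))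
    {b s : Stroke G} (hb : b.Positive) (hs : s.Positive) : (Stroke.place d b s).Positive := by
  cases G
  · have hd' : (d.1 + d.2) % 2 = 1 := by
      rcases hd with ⟨h, h'⟩ | ⟨h, -⟩
      · have h0 : ¬ ((1 : Grid.square.Heading) = 0 ∨ (1 : Grid.square.Heading) = 2) := by decide
        exact absurd h' h0
      · exact h
    obtain ⟨p, q, hb⟩ := hb.square_cases
    obtain ⟨u, v, hs⟩ := hs.square_cases
    have par : ∃ k, (p * d.1 - q * d.2) + (p * d.2 + q * d.1) = p + q + 2 * k :=
      ⟨(p + q) * ((d.1 + d.2 - 1) / 2) - q * d.2, by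
        obtain ⟨k, hk⟩ : ∃ k, d.1 + d.2 = 2 * k + 1 := ⟨(d.1 + d.2) / 2, by omega⟩
        have e : (d.1 + d.2 - 1) / 2 = k := by omega
        rw [e]
        linear_combination (p + q) * hk⟩
    obtain ⟨k, hk⟩ := par
    have e1 : (1 : Grid.square.Heading) + 1 = 2 := by decide
    have e2 : (1 : Grid.square.Heading) + 2 = 3 := by decide
    have e3 : (1 : Grid.square.Heading) + 3 = 0 := by decide
    have e4 : (2 : Grid.square.Heading) + 1 = 3 := by decide
    have e5 : (2 : Grid.square.Heading) + 2 = 0 := by decide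
    have e6 : (2 : Grid.square.Heading) + 3 = 1 := by decide
    have e7 : (3 : Grid.square.Heading) + 1 = 0 := by decide
    have e8 : (3 : Grid.square.Heading) + 2 = 1 := by decide
    have e9 : (3 : Grid.square.Heading) + 3 = 2 := by decide
    rcases hb with ⟨h1, rfl⟩ | ⟨h1, rfl⟩ | ⟨h1, rfl⟩ | ⟨h1, rfl⟩ <;>
    rcases hs with ⟨h2, rfl⟩ | ⟨h2, rfl⟩ | ⟨h2, rfl⟩ | ⟨h2, rfl⟩ <;>
    simp (decide := true) only [Stroke.place, Stroke.move, Stroke.Positive, Grid.mul, zero_add,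
      add_zero, e1, e2, e3, e4, e5, e6, e7, e8, e9, Grid.step_square_zero, Grid.step_square_one,
      Grid.step_square_two, Grid.step_square_three, Prod.fst_add, Prod.snd_add, and_true,
      and_false, or_false, false_or, or_true] <;>
    omega
  · have key : ∀ h δ : ZMod 6, h = 0 ∨ h = 2 ∨ h = 4 → δ = 0 ∨ δ = 2 ∨ δ = 4 →
        h + δ = 0 ∨ h + δ = 2 ∨ h + δ = 4 := by decide
    exact key _ _ hb hs

theorem Stroke.place_injective (d : G.Point) (b : Stroke G) :
    Function.Injective (Stroke.place d b) :=
  Stroke.move_injective _ _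

theorem Stroke.place_move (d : G.Point) (b s : Stroke G) (l : G.Heading) :
    Stroke.place d b (s.move d l) = Stroke.place d ⟨b.target, b.heading + l⟩ s := by
  rw [Stroke.place, Stroke.move_move, Stroke.place, Stroke.target, G.add_mul]

/-- The stroke that follows a stroke after the turn `l`. -/
def Stroke.next (l : G.Heading) (b : Stroke G) : Stroke G := ⟨b.target, b.heading + l⟩

/-- The number of signed crossings of the ray from a face to the right with the copy of a curve that
belongs to the stroke `b` of a base curve. -/
def copyCrossing (x : ℕ → G.Heading) (m : ℕ) (b : Stroke G) (f : ℤ × ℤ) : ℤ :=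
  ∑ j ∈ Finset.range m,
    (Stroke.place (displacement x m) b (walk (Stroke.origin G) x j)).crossing f

theorem tileWalk_eq_walk {j : ℕ} (hj : j < m) : tileWalk x m l j = walk (Stroke.origin G) x j :=
  walk_congr _ (fun i hi him => by
    rw [substTurns, Nat.mod_eq_of_lt him, if_neg (by omega)]) j hj

theorem place_tileWalk (hm : 0 < m) (hr : lastHeading x m = 0) (b : Stroke G) (k i : ℕ) :
    Stroke.place (displacement x m) b (tileWalk x m l (k * m + i)) =
      Stroke.place (displacement x m) ((Stroke.next l)^[k] b) (tileWalk x m l i) := by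
  induction k generalizing b with
  | zero => simp
  | succ k ih =>
    rw [show (k + 1) * m + i = m + (k * m + i) by ring, tileWalk_add hm, hr, zero_add,
      Stroke.place_move, Function.iterate_succ_apply]
    exact ih _

theorem winding_place_tileWalk (hm : 0 < m) (hr : lastHeading x m = 0) (b : Stroke G) (N : ℕ)
    (f : ℤ × ℤ) :
    winding (fun i => Stroke.place (displacement x m) b (tileWalk x m l i)) 0 (N * m) f =
      ∑ k ∈ Finset.range N, copyCrossing x m ((Stroke.next l)^[k] b) f := by
  simp only [winding, Nat.Ico_zero_eq_range]
  induction N with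
  | zero => simp
  | succ N ih =>
    rw [Finset.sum_range_succ, ← ih, Nat.succ_mul, Finset.sum_range_add, copyCrossing]
    congr 1
    refine Finset.sum_congr rfl fun j hj => ?_
    rw [place_tileWalk hm hr, tileWalk_eq_walk (Finset.mem_range.1 hj)]

theorem IsSimpleClosed.place {s : ℕ → Stroke G} {n : ℕ} (hs : IsSimpleClosed s n) {d : G.Point}
    (hd : Stroke.Positive (⟨d, G.turn⟩ : Stroke G)) {b : Stroke G} (hb : b.Positive) :
    IsSimpleClosed (fun i => Stroke.place d b (s i)) n where
  source_succ i := by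
    rw [Stroke.place, Stroke.place, Stroke.move_target, ← hs.source_succ]
    rfl
  positive i := Stroke.Positive.place hd hb (hs.positive i)
  pos := hs.pos
  periodic i := by simp only [hs.periodic]
  inj i j h := hs.inj i j (Stroke.place_injective d b h)
  noCross i j hi hj hij := by
    simp only [Stroke.place, Stroke.move, add_right_inj] at hi hj hij ⊢
    refine hs.noCross i j hi hj ?_
    have := @Stroke.move_injective G 0 b.heading ⟨(s (i + 1)).source, 0⟩ ⟨(s (j + 1)).source, 0⟩
      (Stroke.ext (by simpa [Stroke.move] using hij) rfl)
    exact (Stroke.mk.inj this).1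

theorem positive_displacement (hx : ∀ j, 0 < j → j < m → G.IsTurn (x j)) (hm : 0 < m)
    (hr : lastHeading x m = 0) :
    Stroke.Positive (⟨displacement x m, G.turn⟩ : Stroke G) := by
  have h1 := (isWalk_tileWalk hx hm G.isTurn_turn).positive (m + 0)
  have h2 : tileWalk x m G.turn 0 = Stroke.origin G := rfl
  rwa [tileWalk_add hm, hr, zero_add, h2, Stroke.move_origin] at h1

/-- The winding numbers of the copies of the tiles in the case that a curve ends with the heading
with which it starts. -/
theorem winding_place (hx : ∀ j, 0 < j → j < m → G.IsTurn (x j)) (hm : 0 < m)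
    (h : ∀ l, l = G.turn ∨ l = -G.turn → SimpleOn (tileWalk x m l) (G.sides * m)) {b : Stroke G}
    (hb : b.Positive) :
    (∀ j < m, ∑ k ∈ Finset.range G.sides, copyCrossing x m ((Stroke.next G.turn)^[k] b)
      (Stroke.place (displacement x m) b (walk (Stroke.origin G) x j)).leftFace = 1) ∧
    (∀ f, 0 ≤ ∑ k ∈ Finset.range G.sides, copyCrossing x m ((Stroke.next G.turn)^[k] b) f) ∧
    (∀ j < m, ∑ k ∈ Finset.range G.sides, copyCrossing x m ((Stroke.next (-G.turn))^[k] b)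
      (Stroke.place (displacement x m) b (walk (Stroke.origin G) x j)).rightFace = -1) ∧
    ∀ f, ∑ k ∈ Finset.range G.sides, copyCrossing x m ((Stroke.next (-G.turn))^[k] b) f ≤ 0 := by
  have h0 := lastHeading_eq_zero hx hm h
  have hd := positive_displacement hx hm h0
  have c1 := isSimpleClosed_tiles hx hm h (Or.inl rfl)
  have c2 := isSimpleClosed_tiles hx hm h (Or.inr rfl)
  have key : ∀ l, IsSimpleClosed (tileWalk x m l) (G.sides * m) → ∃ c : ℤ, (c = 0 ∨ c = -1) ∧
      totalTurn x m + G.turnInt l = 2 * c + 1 ∧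
      (∀ j < m, ∑ k ∈ Finset.range G.sides, copyCrossing x m ((Stroke.next l)^[k] b)
        (Stroke.place (displacement x m) b (walk (Stroke.origin G) x j)).leftFace = c + 1) ∧
      (∀ j < m, ∑ k ∈ Finset.range G.sides, copyCrossing x m ((Stroke.next l)^[k] b)
        (Stroke.place (displacement x m) b (walk (Stroke.origin G) x j)).rightFace = c) ∧
      (∀ f, ∑ k ∈ Finset.range G.sides, copyCrossing x m ((Stroke.next l)^[k] b) f = c ∨
        ∑ k ∈ Finset.range G.sides, copyCrossing x m ((Stroke.next l)^[k] b) f = c + 1) := by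
    intro l hl
    obtain ⟨c, hc, a1, a2, a3, e⟩ := (hl.place hd hb).exists_sum_turnInt
    simp only [winding_place_tileWalk hm h0] at a1 a2 a3
    refine ⟨c, hc, ?_, fun j hj => ?_, fun j hj => ?_, a3⟩
    · have e' : ∀ i, (Stroke.place (displacement x m) b (tileWalk x m l (i + 1))).heading -
        (Stroke.place (displacement x m) b (tileWalk x m l i)).heading =
          (tileWalk x m l (i + 1)).heading - (tileWalk x m l i).heading := fun i => by
        simp only [Stroke.place, Stroke.move, add_sub_add_left_eq_sub]
      simp only [e'] at e
      rw [sum_turnInt_sides hm] at e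
      exact mul_left_cancel₀ (by have := G.sides_pos; positivity) e
    · have := a1 j
      rwa [tileWalk_eq_walk hj] at this
    · have := a2 j
      rwa [tileWalk_eq_walk hj] at this
  obtain ⟨c, hc, e1, a1, -, a3⟩ := key _ c1
  obtain ⟨c', hc', e2, -, b2, b3⟩ := key _ c2
  rw [G.turnInt_turn] at e1
  rw [G.turnInt_neg_turn] at e2
  -- The two equations give `c = c' + 1`, with both numbers in {0, -1}. So the first tile winds
  -- counterclockwise and the second one clockwise.
  obtain rfl : c = 0 := by omega
  obtain rfl : c' = -1 := by omega
  refine ⟨fun j hj => by simpa using a1 j hj, fun f => ?_, b2, fun f => ?_⟩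
  · rcases a3 f with h | h <;> omega
  · rcases b3 f with h | h <;> omega

end


/-! # The copies of a tile cover each face once -/

section

variable {G : Grid} {x : ℕ → G.Heading} {m : ℕ}

/-- The indicator function of the points above a horizontal strip of faces. -/
def above (f : ℤ × ℤ) (p : ℤ × ℤ) : ℤ := if f.2 < p.2 then 1 else 0

/-- A stroke far to the right of the face meets the ray exactly when it passes through the row of
the face, so its crossing is a difference of heights and telescopes. -/
theorem crossing_right {s : Stroke G} (hs : s.Positive) {f : ℤ × ℤ}
    (h : s.source.2 = f.2 ∨ s.source.2 = f.2 + 1 → |f.1| + 1 < s.source.1) :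
    s.crossing f = above f s.target - above f s.source := by
  obtain ⟨j, r⟩ := f
  have hj := neg_abs_le j
  have hj' := le_abs_self j
  generalize |j| = k at h hj hj'
  cases G
  · obtain ⟨a, b, hs⟩ := hs.square_cases
    rcases hs with ⟨-, rfl⟩ | ⟨-, rfl⟩ | ⟨-, rfl⟩ | ⟨-, rfl⟩ <;>
    simp (decide := true) only [Stroke.crossing, above, Stroke.target, if_true, if_false,
      Prod.snd_add, Grid.step_square_zero, Grid.step_square_one,
      Grid.step_square_two, Grid.step_square_three] at h ⊢ <;>
    (split_ifs <;> omega)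
  · obtain ⟨a, b, hs⟩ := hs.triangular_cases
    rcases hs with rfl | rfl | rfl <;>
    simp (decide := true) only [Stroke.crossing, above, Stroke.target, if_true, if_false,
      Prod.snd_add, Grid.step_triangular_zero, Grid.step_triangular_two,
      Grid.step_triangular_four] at h ⊢ <;>
    (split_ifs <;> omega)

theorem crossing_left {s : Stroke G} (hs : s.Positive) {f : ℤ × ℤ}
    (h : s.source.2 = f.2 ∨ s.source.2 = f.2 + 1 → s.source.1 < -(|f.1| + 1)) :
    s.crossing f = 0 := by
  obtain ⟨j, r⟩ := f
  have hj := neg_abs_le j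
  have hj' := le_abs_self j
  generalize |j| = k at h hj hj'
  cases G
  · obtain ⟨a, b, hs⟩ := hs.square_cases
    rcases hs with ⟨-, rfl⟩ | ⟨-, rfl⟩ | ⟨-, rfl⟩ | ⟨-, rfl⟩ <;>
    simp (decide := true) only [Stroke.crossing, if_true, if_false] at h ⊢ <;>
    (split_ifs <;> omega)
  · obtain ⟨a, b, hs⟩ := hs.triangular_cases
    rcases hs with rfl | rfl | rfl <;>
    simp (decide := true) only [Stroke.crossing, if_true, if_false] at h ⊢ <;>
    (split_ifs <;> omega)

theorem abs_mul_step_le (h : G.Heading) (p : G.Point) :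
    |(G.mul (G.step h) p).1| ≤ |p.1| + |p.2| ∧ |(G.mul (G.step h) p).2| ≤ |p.1| + |p.2| := by
  obtain ⟨a, b⟩ := p
  cases G
  · rcases Grid.square_heading h with rfl | rfl | rfl | rfl <;>
    simp only [Grid.mul, Grid.step_square_zero, Grid.step_square_one,
      Grid.step_square_two, Grid.step_square_three] <;>
    (constructor <;> (rw [abs_le]; constructor <;>
      linarith [neg_abs_le a, neg_abs_le b, le_abs_self a, le_abs_self b]))
  · rcases Grid.triangular_heading h with rfl | rfl | rfl | rfl | rfl | rfl <;>
    simp only [Grid.mul, Grid.step_triangular_zero, Grid.step_triangular_one,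
      Grid.step_triangular_two, Grid.step_triangular_three, Grid.step_triangular_four,
      Grid.step_triangular_five] <;>
    (constructor <;> (rw [abs_le]; constructor <;>
      linarith [neg_abs_le a, neg_abs_le b, le_abs_self a, le_abs_self b]))

/-- A bound for the coordinates of a curve with `m` strokes and turns `x`. -/
def extent (x : ℕ → G.Heading) (m : ℕ) : ℤ :=
  ∑ j ∈ Finset.range m, (|(walk (Stroke.origin G) x j).source.1| + |(walk (Stroke.origin G) x j).source.2|)

theorem abs_place_sub_le (b : Stroke G) {j : ℕ} (hj : j < m) :
    |(Stroke.place (displacement x m) b (walk (Stroke.origin G) x j)).source.1 -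
      (G.mul b.source (displacement x m)).1| ≤ extent x m ∧
    |(Stroke.place (displacement x m) b (walk (Stroke.origin G) x j)).source.2 -
      (G.mul b.source (displacement x m)).2| ≤ extent x m := by
  have h := abs_mul_step_le b.heading (walk (Stroke.origin G) x j).source
  have h2 : |(walk (Stroke.origin G) x j).source.1| + |(walk (Stroke.origin G) x j).source.2| ≤
      extent x m :=
    Finset.single_le_sum (f := fun j => |(walk (Stroke.origin G) x j).source.1| +
      |(walk (Stroke.origin G) x j).source.2|) (fun i _ => by positivity) (Finset.mem_range.2 hj)
  simp only [Stroke.place, Stroke.move, Prod.fst_add, Prod.snd_add, add_sub_cancel_left]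
  exact ⟨h.1.trans h2, h.2.trans h2⟩

theorem extent_nonneg (x : ℕ → G.Heading) (m : ℕ) : 0 ≤ extent x m :=
  Finset.sum_nonneg fun _ _ => by positivity

theorem sum_above_place (hm : 0 < m) (b : Stroke G) (f : ℤ × ℤ) :
    ∑ j ∈ Finset.range m,
      (above f (Stroke.place (displacement x m) b (walk (Stroke.origin G) x j)).target -
        above f (Stroke.place (displacement x m) b (walk (Stroke.origin G) x j)).source) =
      above f (G.mul b.target (displacement x m)) - above f (G.mul b.source (displacement x m)) := by
  have h0 : ∀ j, (Stroke.place (displacement x m) b (walk (Stroke.origin G) x j)).target =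
      (Stroke.place (displacement x m) b (walk (Stroke.origin G) x (j + 1))).source := by
    intro j
    rw [Stroke.place, Stroke.move_target]
    rfl
  simp only [h0]
  rw [Finset.sum_range_sub fun j =>
    above f (Stroke.place (displacement x m) b (walk (Stroke.origin G) x j)).source]
  congr 2
  · obtain ⟨k, rfl⟩ : ∃ k, m = k + 1 := ⟨m - 1, by omega⟩
    rw [← h0, Stroke.place, Stroke.move_target]
    exact (G.add_mul _ _ _).symm
  · change G.mul b.source (displacement x m) + G.mul _ 0 = _
    rw [G.mul_zero, add_zero]

/-- The crossings of the ray from a face to the right with a copy whose base stroke starts on a line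
far away from the face. -/
theorem copyCrossing_of_far (hx : ∀ j, 0 < j → j < m → G.IsTurn (x j)) (hm : 0 < m)
    (hr : lastHeading x m = 0) {b : Stroke G} (hb : b.Positive) {f : ℤ × ℤ} {α κ M : ℤ}
    (h : α * (G.mul b.source (displacement x m)).1 = κ * (G.mul b.source (displacement x m)).2 + M)
    (hM : (|α| + |κ|) * (|f.1| + |f.2| + extent x m + 2) < M) :
    copyCrossing x m b f = if 0 < α then above f (G.mul b.target (displacement x m)) -
      above f (G.mul b.source (displacement x m)) else 0 := by
  have hd := positive_displacement hx hm hr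
  have hw := isWalk_tileWalk hx hm G.isTurn_turn
  have hpos : ∀ j < m, (Stroke.place (displacement x m) b (walk (Stroke.origin G) x j)).Positive := by
    intro j hj
    rw [← tileWalk_eq_walk (l := G.turn) hj]
    exact Stroke.Positive.place hd hb (hw.positive j)
  -- When the copy comes near the row of `f`, its base point has bounded height, so `M` dominates
  -- the equation of the line and `α` times the abscissa is large. The sign of `α` thus decides
  -- whether the copy is far to the right or far to the left.
  have key : ∀ j < m,
      (Stroke.place (displacement x m) b (walk (Stroke.origin G) x j)).source.2 = f.2 ∨
      (Stroke.place (displacement x m) b (walk (Stroke.origin G) x j)).source.2 = f.2 + 1 →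
      |α| * (|f.1| + extent x m + 1) < α * (G.mul b.source (displacement x m)).1 := by
    intro j hj hy
    have h2 := (abs_place_sub_le (x := x) b hj).2
    have hK := extent_nonneg x m
    generalize (Stroke.place (displacement x m) b (walk (Stroke.origin G) x j)).source.2 = y at *
    generalize (G.mul b.source (displacement x m)).2 = Y at *
    generalize (G.mul b.source (displacement x m)).1 = X at *
    generalize extent x m = K at *
    have hY : |Y| ≤ |f.2| + K + 1 := by
      rw [abs_le] at h2 ⊢
      have := neg_abs_le f.2
      have := le_abs_self f.2
      constructor <;> omega
    have h3 : -(|κ| * (|f.2| + K + 1)) ≤ κ * Y := by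
      have := neg_abs_le (κ * Y)
      rw [abs_mul] at this
      have := mul_le_mul_of_nonneg_left hY (abs_nonneg κ)
      linarith
    have h4 : 0 ≤ |α| * (|f.2| + 1) := by positivity
    have h5 : 0 ≤ |κ| * (|f.1| + 1) := by positivity
    rw [h]
    nlinarith
  rw [copyCrossing]
  split_ifs with hα
  · rw [← sum_above_place hm]
    refine Finset.sum_congr rfl fun j hj => crossing_right (hpos j (Finset.mem_range.1 hj)) ?_
    intro hy
    have h1 := key j (Finset.mem_range.1 hj) hy
    have h2 := (abs_place_sub_le (x := x) b (Finset.mem_range.1 hj)).1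
    rw [abs_of_pos hα] at h1
    have := lt_of_mul_lt_mul_left h1 hα.le
    rw [abs_le] at h2
    omega
  · refine Finset.sum_eq_zero fun j hj => crossing_left (hpos j (Finset.mem_range.1 hj)) ?_
    intro hy
    have h1 := key j (Finset.mem_range.1 hj) hy
    have h2 := (abs_place_sub_le (x := x) b (Finset.mem_range.1 hj)).1
    rw [abs_of_nonpos (not_lt.1 hα)] at h1
    have h3 : α ≠ 0 := by
      rintro rfl
      simp at h1
    have h4 : 0 < -α := by have := not_lt.1 hα; omega
    have := lt_of_mul_lt_mul_left (b := |f.1| + extent x m + 1)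
      (c := -(G.mul b.source (displacement x m)).1) (a := -α) (by linarith) h4.le
    rw [abs_le] at h2
    omega

end


/-! ### The displacement of the curve -/

section

variable {G : Grid} {x : ℕ → G.Heading} {m : ℕ}

/-- On the square grid the displacement is odd. On the triangular grid, a curve with displacement 0
would itself be a simple closed curve with turn 0 at the joint, hence of total turn 3 or -3, whereas
the two tiles force total turn 0. -/
theorem displacement_ne_zero (hx : ∀ j, 0 < j → j < m → G.IsTurn (x j)) (hm : 0 < m)
    (h : ∀ l, l = G.turn ∨ l = -G.turn → SimpleOn (tileWalk x m l) (G.sides * m)) :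
    displacement x m ≠ 0 := by
  intro hd0
  have hr := lastHeading_eq_zero hx hm h
  have hd := positive_displacement hx hm hr
  have t1 := G.turnInt_turn
  have t2 := G.turnInt_neg_turn
  have t3 := turnInt_zero G
  cases G
  · have h0 : ¬ ((1 : Grid.square.Heading) = 0 ∨ (1 : Grid.square.Heading) = 2) := by decide
    rw [hd0] at hd
    rcases hd with ⟨-, h1⟩ | ⟨h1, -⟩
    · exact h0 h1
    · revert h1; decide
  have hper : ∀ i, tileWalk x m 0 (m + i) = tileWalk x m 0 i := fun i => by
    rw [tileWalk_add hm, hr, hd0, add_zero, Stroke.move_zero]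
  have hmod : ∀ i, tileWalk x m 0 (i % m) = tileWalk x m 0 i := fun i => by
    conv_rhs => rw [← Nat.mod_add_div i m]
    generalize i % m = a
    induction i / m with
    | zero => rfl
    | succ k ih => rw [Nat.mul_succ, ← add_assoc, add_comm, hper, ih]
  have hS : SimpleOn (walk (Stroke.origin .triangular) x) m := by
    have := (h _ (Or.inl rfl)).mono (M := m) (Nat.le_mul_of_pos_left _ (Grid.sides_pos _))
    refine ⟨fun i j hi hj hij => this.inj i j hi hj ?_, fun i j hi hj => ?_⟩
    · rwa [tileWalk_eq_walk hi, tileWalk_eq_walk hj]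
    · have := this.noCross i j hi hj
      rwa [tileWalk_eq_walk hi, tileWalk_eq_walk hj, tileWalk_eq_walk (by omega),
        tileWalk_eq_walk (by omega)] at this
  have hpos := (isWalk_tileWalk hx hm (Grid.isTurn_turn _)).positive
  -- With displacement 0 all sides of the tile start at the origin and use all three positive
  -- strokes from there; a further visit would repeat one of them.
  have hO : ∀ j, 0 < j → j < m → (walk (Stroke.origin .triangular) x j).source ≠ 0 := by
    intro j hj hjm h0
    have h1 := hpos j
    rw [tileWalk_eq_walk hjm] at h1
    have key : ∀ k : ℕ, k < 3 →
        (walk (Stroke.origin .triangular) x j).heading = k * Grid.turn .triangular → False := by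
      intro k hk hh
      have e : tileWalk x m (Grid.turn .triangular) (k * m + 0) =
          ⟨0, k * Grid.turn .triangular⟩ := by
        clear hh
        induction k with
        | zero => simp; rfl
        | succ k ih =>
          rw [show (k + 1) * m + 0 = m + (k * m + 0) by ring, tileWalk_add hm, ih (by omega), hr,
            hd0]
          refine Stroke.ext ?_ ?_
          · change 0 + Grid.mul _ _ 0 = 0
            rw [Grid.mul_zero, add_zero]
          · simp only [Stroke.move]
            push_cast
            ring
      have e2 : tileWalk x m (Grid.turn .triangular) (k * m + 0) =
          tileWalk x m (Grid.turn .triangular) j := by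
        rw [e, tileWalk_eq_walk hjm]
        exact Stroke.ext h0.symm hh.symm
      have hk3 : k * m + 0 < Grid.sides .triangular * m :=
        Nat.mul_lt_mul_of_pos_right hk hm
      have := (h _ (Or.inl rfl)).inj _ _ hk3 (hjm.trans_le
        (Nat.le_mul_of_pos_left _ (Grid.sides_pos _))) e2
      rcases Nat.eq_zero_or_pos k with rfl | hk0
      · omega
      · have := Nat.le_mul_of_pos_left m hk0
        omega
    have k0 := key 0 (by omega)
    have k1 := key 1 (by omega)
    have k2 := key 2 (by omega)
    rcases h1 with h1 | h1 | h1
    · exact k0 (h1.trans (by decide))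
    · exact k1 (h1.trans (by decide))
    · exact k2 (h1.trans (by decide))
  have hc : IsSimpleClosed (tileWalk x m 0) m := by
    have hlt := fun i => Nat.mod_lt i hm
    have hsucc : ∀ i, i % m + 1 < m →
        tileWalk x m 0 (i + 1) = walk (Stroke.origin .triangular) x (i % m + 1) := by
      intro i hi
      rw [← hmod (i + 1), ← Nat.mod_add_mod, Nat.mod_eq_of_lt hi, tileWalk_eq_walk hi]
    have hlast : ∀ i, ¬ i % m + 1 < m → (tileWalk x m 0 (i + 1)).source = 0 := by
      intro i hi
      have := hlt i
      rw [← hmod (i + 1), ← Nat.mod_add_mod, show i % m + 1 = m by omega, Nat.mod_self]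
      rfl
    refine ⟨isWalk_tileWalk hx hm (Or.inr (Or.inr ⟨rfl, rfl⟩)), hm,
      fun i => by rw [add_comm, hper], fun i j hij => ?_, fun i j hi hj hij => ?_⟩
    · rw [← hmod i, ← hmod j, tileWalk_eq_walk (hlt i), tileWalk_eq_walk (hlt j)] at hij
      exact hS.inj _ _ (hlt i) (hlt j) hij
    · rw [← hmod i, tileWalk_eq_walk (hlt i)] at hi ⊢
      rw [← hmod j, tileWalk_eq_walk (hlt j)] at hj ⊢
      by_cases hi' : i % m + 1 < m <;> by_cases hj' : j % m + 1 < m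
      · rw [hsucc i hi'] at hi hij
        rw [hsucc j hj'] at hj hij
        exact hS.noCross _ _ hi' hj' hi hj hij
      · rw [hsucc i hi', hlast j hj'] at hij
        exact absurd hij (hO _ (by omega) hi')
      · rw [hsucc j hj', hlast i hi'] at hij
        exact absurd hij.symm (hO _ (by omega) hj')
      · have hi2 := hlt i
        have hj2 := hlt j
        rw [show i % m = j % m by omega]
  obtain ⟨c, hc', -, -, -, e⟩ := hc.exists_sum_turnInt
  rw [sum_turnInt_tileWalk hm] at e
  obtain ⟨c1, hc1, -, -, -, e1⟩ := exists_totalTurn hm (isSimpleClosed_tiles hx hm h (Or.inl rfl))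
  obtain ⟨c2, hc2, -, -, -, e2⟩ := exists_totalTurn hm (isSimpleClosed_tiles hx hm h (Or.inr rfl))
  simp only [Grid.sides] at e
  push_cast at e
  omega

end


/-! ### Copies of tiles around the faces of the base grid -/

section

theorem Stroke.next_square_zero (a b : ℤ) :
    Stroke.next (Grid.turn .square) ⟨(a, b), 0⟩ = ⟨(a + 1, b), 1⟩ :=
  Stroke.ext (congrArg₂ Prod.mk rfl (add_zero b)) rfl

theorem Stroke.next_square_one (a b : ℤ) :
    Stroke.next (Grid.turn .square) ⟨(a, b), 1⟩ = ⟨(a, b + 1), 2⟩ :=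
  Stroke.ext (congrArg₂ Prod.mk (add_zero a) rfl) rfl

theorem Stroke.next_square_two (a b : ℤ) :
    Stroke.next (Grid.turn .square) ⟨(a, b), 2⟩ = ⟨(a - 1, b), 3⟩ :=
  Stroke.ext (congrArg₂ Prod.mk rfl (add_zero b)) rfl

theorem Stroke.next_square_three (a b : ℤ) :
    Stroke.next (Grid.turn .square) ⟨(a, b), 3⟩ = ⟨(a, b - 1), 0⟩ :=
  Stroke.ext (congrArg₂ Prod.mk (add_zero a) rfl) rfl

theorem Stroke.next_neg_square_zero (a b : ℤ) :
    Stroke.next (-Grid.turn .square) ⟨(a, b), 0⟩ = ⟨(a + 1, b), 3⟩ :=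
  Stroke.ext (congrArg₂ Prod.mk rfl (add_zero b)) rfl

theorem Stroke.next_neg_square_one (a b : ℤ) :
    Stroke.next (-Grid.turn .square) ⟨(a, b), 1⟩ = ⟨(a, b + 1), 0⟩ :=
  Stroke.ext (congrArg₂ Prod.mk (add_zero a) rfl) rfl

theorem Stroke.next_neg_square_two (a b : ℤ) :
    Stroke.next (-Grid.turn .square) ⟨(a, b), 2⟩ = ⟨(a - 1, b), 1⟩ :=
  Stroke.ext (congrArg₂ Prod.mk rfl (add_zero b)) rfl

theorem Stroke.next_neg_square_three (a b : ℤ) :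
    Stroke.next (-Grid.turn .square) ⟨(a, b), 3⟩ = ⟨(a, b - 1), 2⟩ :=
  Stroke.ext (congrArg₂ Prod.mk (add_zero a) rfl) rfl

theorem Stroke.next_triangular_zero (a b : ℤ) :
    Stroke.next (Grid.turn .triangular) ⟨(a, b), 0⟩ = ⟨(a + 1, b), 2⟩ :=
  Stroke.ext (congrArg₂ Prod.mk rfl (add_zero b)) rfl

theorem Stroke.next_triangular_two (a b : ℤ) :
    Stroke.next (Grid.turn .triangular) ⟨(a, b), 2⟩ = ⟨(a - 1, b + 1), 4⟩ :=
  Stroke.ext rfl rfl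

theorem Stroke.next_triangular_four (a b : ℤ) :
    Stroke.next (Grid.turn .triangular) ⟨(a, b), 4⟩ = ⟨(a, b - 1), 0⟩ :=
  Stroke.ext (congrArg₂ Prod.mk (add_zero a) rfl) rfl

theorem Stroke.next_neg_triangular_zero (a b : ℤ) :
    Stroke.next (-Grid.turn .triangular) ⟨(a, b), 0⟩ = ⟨(a + 1, b), 4⟩ :=
  Stroke.ext (congrArg₂ Prod.mk rfl (add_zero b)) rfl

theorem Stroke.next_neg_triangular_two (a b : ℤ) :
    Stroke.next (-Grid.turn .triangular) ⟨(a, b), 2⟩ = ⟨(a - 1, b + 1), 0⟩ :=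
  Stroke.ext rfl rfl

theorem Stroke.next_neg_triangular_four (a b : ℤ) :
    Stroke.next (-Grid.turn .triangular) ⟨(a, b), 4⟩ = ⟨(a, b - 1), 2⟩ :=
  Stroke.ext (congrArg₂ Prod.mk (add_zero a) rfl) rfl

variable {G : Grid} {m : ℕ}

/-- The signed number of crossings with the copy along the base edge from `(u, v)` to
`(u + 1, v)`. -/
def rowCrossing : {G : Grid} → (ℕ → G.Heading) → ℕ → ℤ × ℤ → ℤ → ℤ → ℤ
  | .square, x, m, f, u, v =>
    if (u + v) % 2 = 0 then copyCrossing x m ⟨(u, v), 0⟩ f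
    else -copyCrossing x m ⟨(u + 1, v), 2⟩ f
  | .triangular, x, m, f, u, v => copyCrossing x m ⟨(u, v), 0⟩ f

/-- The signed number of crossings with the copy along the base edge from `(u, v)` to
`(u, v + 1)`. -/
def colCrossing : {G : Grid} → (ℕ → G.Heading) → ℕ → ℤ × ℤ → ℤ → ℤ → ℤ
  | .square, x, m, f, u, v =>
    if (u + v) % 2 = 1 then copyCrossing x m ⟨(u, v), 1⟩ f
    else -copyCrossing x m ⟨(u, v + 1), 3⟩ f
  | .triangular, x, m, f, u, v => -copyCrossing x m ⟨(u, v + 1), 4⟩ f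

/-- The winding number around the face `f` of the curve that results from the boundary of the
parallelogram with lower left corner `(u, v)`. -/
def cellWinding (x : ℕ → G.Heading) (m : ℕ) (f : ℤ × ℤ) (u v : ℤ) : ℤ :=
  rowCrossing x m f u v + colCrossing x m f (u + 1) v - rowCrossing x m f u (v + 1) -
    colCrossing x m f u v

/-- The winding number around the face `f` of the curve that results from the boundary of the
base face `φ`. -/
def faceWinding : {G : Grid} → (ℕ → G.Heading) → ℕ → ℤ × ℤ → ℤ × ℤ → ℤ
  | .square, x, m, f, φ => cellWinding x m f φ.1 φ.2
  | .triangular, x, m, f, φ =>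
    if φ.1 % 2 = 0 then rowCrossing x m f (φ.1 / 2) φ.2 +
      copyCrossing x m ⟨(φ.1 / 2 + 1, φ.2), 2⟩ f - colCrossing x m f (φ.1 / 2) φ.2
    else colCrossing x m f (φ.1 / 2 + 1) φ.2 - rowCrossing x m f (φ.1 / 2) (φ.2 + 1) -
      copyCrossing x m ⟨(φ.1 / 2 + 1, φ.2), 2⟩ f

theorem faceWinding_leftFace (x : ℕ → G.Heading) {b : Stroke G} (hb : b.Positive) (f : ℤ × ℤ) :
    faceWinding x m f b.leftFace =
      ∑ k ∈ Finset.range G.sides, copyCrossing x m ((Stroke.next G.turn)^[k] b) f := by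
  cases G
  · obtain ⟨p, q, hb⟩ := hb.square_cases
    have a1 : ∀ z : ℤ, z - 1 + 1 = z := fun z => by ring
    have a2 : ∀ z : ℤ, z + 1 - 1 = z := fun z => by ring
    rcases hb with ⟨h, rfl⟩ | ⟨h, rfl⟩ | ⟨h, rfl⟩ | ⟨h, rfl⟩ <;>
    simp (decide := true) only [Grid.sides, Finset.sum_range_succ, Finset.sum_range_zero,
      Function.iterate_succ_apply, Function.iterate_zero, id_eq, Stroke.next_square_zero,
      Stroke.next_square_one, Stroke.next_square_two, Stroke.next_square_three, Stroke.leftFace,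
      if_true, if_false, faceWinding, cellWinding, rowCrossing, colCrossing, a1, a2] <;>
    rw [if_pos (by omega), if_pos (by omega), if_neg (by omega), if_neg (by omega)] <;>
    ring
  · obtain ⟨p, q, hb⟩ := hb.triangular_cases
    have a1 : ∀ z : ℤ, z - 1 + 1 = z := fun z => by ring
    have a2 : ∀ z : ℤ, z + 1 - 1 = z := fun z => by ring
    have a3 : ∀ z : ℤ, 2 * z % 2 = 0 := fun z => by omega
    have a4 : ∀ z : ℤ, 2 * z / 2 = z := fun z => by omega
    have a5 : ∀ z : ℤ, (2 * z - 2) % 2 = 0 := fun z => by omega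
    have a6 : ∀ z : ℤ, (2 * z - 2) / 2 = z - 1 := fun z => by omega
    rcases hb with rfl | rfl | rfl <;>
    simp (decide := true) only [Grid.sides, Finset.sum_range_succ, Finset.sum_range_zero,
      Function.iterate_succ_apply, Function.iterate_zero, id_eq, Stroke.next_triangular_zero,
      Stroke.next_triangular_two, Stroke.next_triangular_four, Stroke.leftFace,
      if_true, if_false, faceWinding, rowCrossing, colCrossing, a1, a2, a3, a4, a5, a6] <;>
    ring

/-- Positive strokes run clockwise around their right faces, whence the sign. -/
theorem faceWinding_rightFace (x : ℕ → G.Heading) {b : Stroke G} (hb : b.Positive) (f : ℤ × ℤ) :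
    faceWinding x m f b.rightFace =
      -∑ k ∈ Finset.range G.sides, copyCrossing x m ((Stroke.next (-G.turn))^[k] b) f := by
  cases G
  · obtain ⟨p, q, hb⟩ := hb.square_cases
    have a1 : ∀ z : ℤ, z - 1 + 1 = z := fun z => by ring
    have a2 : ∀ z : ℤ, z + 1 - 1 = z := fun z => by ring
    rcases hb with ⟨h, rfl⟩ | ⟨h, rfl⟩ | ⟨h, rfl⟩ | ⟨h, rfl⟩ <;>
    simp (decide := true) only [Grid.sides, Finset.sum_range_succ, Finset.sum_range_zero,
      Function.iterate_succ_apply, Function.iterate_zero, id_eq, Stroke.next_neg_square_zero,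
      Stroke.next_neg_square_one, Stroke.next_neg_square_two, Stroke.next_neg_square_three,
      Stroke.rightFace, if_true, if_false, faceWinding, cellWinding, rowCrossing, colCrossing,
      a1, a2] <;>
    rw [if_neg (by omega), if_neg (by omega), if_pos (by omega), if_pos (by omega)] <;>
    ring
  · obtain ⟨p, q, hb⟩ := hb.triangular_cases
    have a1 : ∀ z : ℤ, z - 1 + 1 = z := fun z => by ring
    have a3 : ∀ z : ℤ, ¬ (2 * z + 1) % 2 = 0 := fun z => by omega
    have a4 : ∀ z : ℤ, (2 * z + 1) / 2 = z := fun z => by omega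
    have a5 : ∀ z : ℤ, ¬ (2 * z - 1) % 2 = 0 := fun z => by omega
    have a6 : ∀ z : ℤ, (2 * z - 1) / 2 = z - 1 := fun z => by omega
    rcases hb with rfl | rfl | rfl <;>
    simp (decide := true) only [Grid.sides, Finset.sum_range_succ, Finset.sum_range_zero,
      Function.iterate_succ_apply, Function.iterate_zero, id_eq, Stroke.next_neg_triangular_zero,
      Stroke.next_neg_triangular_two, Stroke.next_neg_triangular_four, Stroke.rightFace,
      if_true, if_false, faceWinding, rowCrossing, colCrossing, a1, a3, a4, a5, a6] <;>
    ring

/-- Discrete Green's theorem: every inner edge belongs to two cells with opposite signs. -/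
theorem sum_cells (η ν : ℤ → ℤ → ℤ) (a b : ℤ) (N : ℕ) :
    ∑ i ∈ Finset.range N, ∑ j ∈ Finset.range N, (η (a + i) (b + j) + ν (a + i + 1) (b + j) -
      η (a + i) (b + j + 1) - ν (a + i) (b + j)) =
    ∑ i ∈ Finset.range N, (η (a + i) b - η (a + i) (b + N)) +
      ∑ j ∈ Finset.range N, (ν (a + N) (b + j) - ν a (b + j)) := by
  have e1 : ∀ i : ℕ, ∑ j ∈ Finset.range N, (η (a + i) (b + j) - η (a + i) (b + j + 1)) =
      η (a + i) b - η (a + i) (b + N) := fun i => by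
    have := Finset.sum_range_sub' (fun j : ℕ => η (a + i) (b + j)) N
    simpa [add_assoc] using this
  have e2 : ∀ j : ℕ, ∑ i ∈ Finset.range N, (ν (a + i + 1) (b + j) - ν (a + i) (b + j)) =
      ν (a + N) (b + j) - ν a (b + j) := fun j => by
    have := Finset.sum_range_sub (fun i : ℕ => ν (a + i) (b + j)) N
    simpa [add_assoc] using this
  simp only [← e1, ← e2]
  rw [Finset.sum_comm (f := fun j i => ν (a + (i : ℕ) + 1) (b + (j : ℕ)) - ν (a + (i : ℕ)) (b + (j : ℕ))),
    ← Finset.sum_add_distrib]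
  refine Finset.sum_congr rfl fun i _ => ?_
  rw [← Finset.sum_add_distrib]
  refine Finset.sum_congr rfl fun j _ => ?_
  ring

end


/-! ### The winding number of the boundary of a large parallelogram -/

section

variable {G : Grid} {x : ℕ → G.Heading} {m : ℕ}

theorem Grid.mul_eq (G : Grid) (u v : ℤ) (d : G.Point) :
    G.mul (u, v) d = (u * d.1 + v * (G.mul (0, 1) d).1, u * d.2 + v * (G.mul (0, 1) d).2) := by
  cases G <;> simp only [Grid.mul] <;> ext <;> simp only <;> ring

/-- The determinant is the norm of `d = (a, b)`: $a^2+b^2$ or $a^2+ab+b^2$. -/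
theorem Grid.det_pos {d : G.Point} (hd : d ≠ 0) :
    0 < d.1 * (G.mul (0, 1) d).2 - d.2 * (G.mul (0, 1) d).1 := by
  obtain ⟨a, b⟩ := d
  have h : a ≠ 0 ∨ b ≠ 0 := by
    by_contra! hc
    exact hd (by rw [hc.1, hc.2]; rfl)
  cases G <;> simp only [Grid.mul]
  · rcases h with h | h
    · have := sq_nonneg b
      have : 0 < a ^ 2 := by positivity
      nlinarith
    · have := sq_nonneg a
      have : 0 < b ^ 2 := by positivity
      nlinarith
  · rcases h with h | h
    · have := sq_nonneg (a + 2 * b)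
      have : 0 < a ^ 2 := by positivity
      nlinarith
    · have := sq_nonneg (2 * a + b)
      have : 0 < b ^ 2 := by positivity
      nlinarith

theorem rowCrossing_of_far (hx : ∀ j, 0 < j → j < m → G.IsTurn (x j)) (hm : 0 < m)
    (hr : lastHeading x m = 0) {f : ℤ × ℤ} {α κ M v : ℤ}
    (h : ∀ u : ℤ, α * (G.mul (u, v) (displacement x m)).1 =
      κ * (G.mul (u, v) (displacement x m)).2 + M)
    (hM : (|α| + |κ|) * (|f.1| + |f.2| + extent x m + 2) < M) (u : ℤ) :
    rowCrossing x m f u v = if 0 < α then above f (G.mul (u + 1, v) (displacement x m)) -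
      above f (G.mul (u, v) (displacement x m)) else 0 := by
  cases G
  · rw [rowCrossing]
    split_ifs with h1 h2 h2
    · rw [copyCrossing_of_far hx hm hr (Or.inl ⟨h1, Or.inl rfl⟩) (h u) hM, if_pos h2]
      simp [Stroke.target]
    · rw [copyCrossing_of_far hx hm hr (Or.inl ⟨h1, Or.inl rfl⟩) (h u) hM, if_neg h2]
    · rw [copyCrossing_of_far hx hm hr (Or.inl ⟨by simp only; omega, Or.inr rfl⟩) (h (u + 1)) hM,
        if_pos h2]
      simp [Stroke.target]
    · rw [copyCrossing_of_far hx hm hr (Or.inl ⟨by simp only; omega, Or.inr rfl⟩) (h (u + 1)) hM,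
        if_neg h2, neg_zero]
  · rw [rowCrossing, copyCrossing_of_far hx hm hr (Or.inl rfl) (h u) hM]
    simp [Stroke.target]

theorem colCrossing_of_far (hx : ∀ j, 0 < j → j < m → G.IsTurn (x j)) (hm : 0 < m)
    (hr : lastHeading x m = 0) {f : ℤ × ℤ} {α κ M u : ℤ}
    (h : ∀ v : ℤ, α * (G.mul (u, v) (displacement x m)).1 =
      κ * (G.mul (u, v) (displacement x m)).2 + M)
    (hM : (|α| + |κ|) * (|f.1| + |f.2| + extent x m + 2) < M) (v : ℤ) :
    colCrossing x m f u v = if 0 < α then above f (G.mul (u, v + 1) (displacement x m)) -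
      above f (G.mul (u, v) (displacement x m)) else 0 := by
  cases G
  · rw [colCrossing]
    split_ifs with h1 h2 h2
    · rw [copyCrossing_of_far hx hm hr (Or.inr ⟨h1, Or.inl rfl⟩) (h v) hM, if_pos h2]
      simp [Stroke.target]
    · rw [copyCrossing_of_far hx hm hr (Or.inr ⟨h1, Or.inl rfl⟩) (h v) hM, if_neg h2]
    · rw [copyCrossing_of_far hx hm hr (Or.inr ⟨by simp only; omega, Or.inr rfl⟩) (h (v + 1)) hM,
        if_pos h2]
      simp [Stroke.target]
    · rw [copyCrossing_of_far hx hm hr (Or.inr ⟨by simp only; omega, Or.inr rfl⟩) (h (v + 1)) hM,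
        if_neg h2, neg_zero]
  · rw [colCrossing, copyCrossing_of_far hx hm hr (Or.inr (Or.inr rfl)) (h (v + 1)) hM]
    split_ifs <;> simp [Stroke.target]

/-- Together, the copies of the tiles inside a large parallelogram wind around a face once. -/
theorem exists_sum_cellWinding (hx : ∀ j, 0 < j → j < m → G.IsTurn (x j)) (hm : 0 < m)
    (hr : lastHeading x m = 0) (hd : displacement x m ≠ 0) (f : ℤ × ℤ) :
    ∃ N : ℕ, ∀ n : ℕ, N ≤ n → ∑ i ∈ Finset.range (2 * n), ∑ j ∈ Finset.range (2 * n),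
      cellWinding x m f (-n + i) (-n + j) = 1 := by
  obtain ⟨e, he⟩ : ∃ e, e = G.mul (0, 1) (displacement x m) := ⟨_, rfl⟩
  have hD := fun u v => G.mul_eq u v (displacement x m)
  have hdet := Grid.det_pos hd
  rw [← he] at hdet
  simp only [← he] at hD
  obtain ⟨L, hL⟩ : ∃ L, L = |f.1| + |f.2| + extent x m + 2 := ⟨_, rfl⟩
  have hL2 : |f.2| + 2 ≤ L := by
    have := extent_nonneg x m
    have := abs_nonneg f.1
    omega
  -- `B` exceeds the bound required by `copyCrossing_of_far` for each of the four sides, whose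
  -- slopes are given by `displacement x m` and `e`.
  obtain ⟨B, hB⟩ : ∃ B, B = (|(displacement x m).1| + |(displacement x m).2| + |e.1| + |e.2| + 1) * L :=
    ⟨_, rfl⟩
  have hf := abs_nonneg f.2
  have hL0 : 0 < L := by omega
  refine ⟨B.toNat + 1, fun n hn => ?_⟩
  have hnB : B < n := by have := Int.self_le_toNat B; omega
  obtain ⟨Δ, hΔ⟩ : ∃ Δ, Δ = (displacement x m).1 * e.2 - (displacement x m).2 * e.1 := ⟨_, rfl⟩
  rw [← hΔ] at hdet
  have hnΔ : B < n * Δ := by nlinarith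
  have hrow := fun α κ v => rowCrossing_of_far (f := f) (M := n * Δ) (α := α) (κ := κ) (v := v) hx hm hr
  have hcol := fun α κ u => colCrossing_of_far (f := f) (M := n * Δ) (α := α) (κ := κ) (u := u) hx hm hr
  generalize displacement x m = d at *
  have hLn : |f.2| < n := by
    have h1 : 0 ≤ (|d.1| + |d.2| + |e.1| + |e.2|) * L := by positivity
    nlinarith
  have bd : ∀ α κ : ℤ, |α| ≤ |d.2| → |κ| ≤ |d.1| → (|α| + |κ|) * L < n * Δ := by
    intro α κ h1 h2
    refine lt_of_le_of_lt ?_ hnΔ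
    rw [hB]
    refine mul_le_mul_of_nonneg_right ?_ hL0.le
    linarith [abs_nonneg e.1, abs_nonneg e.2]
  have be : ∀ α κ : ℤ, |α| ≤ |e.2| → |κ| ≤ |e.1| → (|α| + |κ|) * L < n * Δ := by
    intro α κ h1 h2
    refine lt_of_le_of_lt ?_ hnΔ
    rw [hB]
    refine mul_le_mul_of_nonneg_right ?_ hL0.le
    linarith [abs_nonneg d.1, abs_nonneg d.2]
  simp only [hD, ← hL] at hrow hcol
  -- The equation of each side is obtained by eliminating the free parameter of the side; the signs
  -- are chosen so that the constant is `n * Δ > 0`.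
  have b1 := hrow d.2 d.1 (-n) (fun u => by rw [hΔ]; ring) (bd _ _ le_rfl le_rfl)
  have b2 := hrow (-d.2) (-d.1) n (fun u => by rw [hΔ]; ring)
    (bd _ _ (abs_neg _).le (abs_neg _).le)
  have b3 := hcol e.2 e.1 n (fun u => by rw [hΔ]; ring) (be _ _ le_rfl le_rfl)
  have b4 := hcol (-e.2) (-e.1) (-n) (fun u => by rw [hΔ]; ring)
    (be _ _ (abs_neg _).le (abs_neg _).le)
  have hsum := sum_cells (rowCrossing x m f) (colCrossing x m f) (-n) (-n) (2 * n)
  have h2n : -(n : ℤ) + ((2 * n : ℕ) : ℤ) = n := by push_cast; ring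
  simp only [h2n, b1, b2, b3, b4] at hsum
  refine hsum.trans ?_
  have tel : ∀ g : ℤ → ℤ, ∑ i ∈ Finset.range (2 * n), (g (-n + i + 1) - g (-n + i)) =
      g n - g (-n) := fun g => by
    have := Finset.sum_range_sub (fun i : ℕ => g (-n + i)) (2 * n)
    simp only [h2n] at this
    simpa [add_assoc] using this
  have tr := fun v : ℤ => tel fun u => above f (u * d.1 + v * e.1, u * d.2 + v * e.2)
  have tc := fun u : ℤ => tel fun v => above f (u * d.1 + v * e.1, u * d.2 + v * e.2)
  -- The corners have heights `n * (± d.2 ± e.2)`, and `P` tells which of them lie above the row of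
  -- `f`. The corner values that are not known cancel in the end.
  obtain ⟨P, hP⟩ : ∃ P : ℤ → ℤ, P = fun z => if f.2 < n * z then 1 else 0 := ⟨_, rfl⟩
  have hP1 : ∀ z : ℤ, 1 ≤ z → P z = 1 := fun z hz => by
    rw [hP]
    refine if_pos ?_
    have := le_abs_self f.2
    nlinarith
  have hP0 : ∀ z : ℤ, z ≤ -1 → P z = 0 := fun z hz => by
    rw [hP]
    refine if_neg ?_
    have := neg_abs_le f.2
    nlinarith
  have hA : ∀ u v z w : ℤ, w = n * z → above f (u, w) = P z := fun u v z w h => by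
    rw [hP, above, h]
  have c1 : ∀ u, above f (u, (n : ℤ) * d.2 + n * e.2) = P (d.2 + e.2) := fun u =>
    hA _ 0 _ _ (by ring)
  have c2 : ∀ u, above f (u, (n : ℤ) * d.2 + -n * e.2) = P (d.2 - e.2) := fun u =>
    hA _ 0 _ _ (by ring)
  have c3 : ∀ u, above f (u, -(n : ℤ) * d.2 + n * e.2) = P (-d.2 + e.2) := fun u =>
    hA _ 0 _ _ (by ring)
  have c4 : ∀ u, above f (u, -(n : ℤ) * d.2 + -n * e.2) = P (-d.2 - e.2) := fun u =>
    hA _ 0 _ _ (by ring)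
  have tA : ∑ i ∈ Finset.range (2 * n),
      ((if 0 < d.2 then above f ((-n + i + 1) * d.1 + -n * e.1, (-n + i + 1) * d.2 + -n * e.2) -
        above f ((-n + i) * d.1 + -n * e.1, (-n + i) * d.2 + -n * e.2) else 0) -
      (if 0 < -d.2 then above f ((-n + i + 1) * d.1 + n * e.1, (-n + i + 1) * d.2 + n * e.2) -
        above f ((-n + i) * d.1 + n * e.1, (-n + i) * d.2 + n * e.2) else 0)) =
      (if 0 < d.2 then P (d.2 - e.2) - P (-d.2 - e.2) else 0) -
        if 0 < -d.2 then P (d.2 + e.2) - P (-d.2 + e.2) else 0 := by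
    rw [Finset.sum_sub_distrib]
    congr 1
    · split_ifs
      · rw [tr (-n), c2, c4]
      · simp
    · split_ifs
      · rw [tr n, c1, c3]
      · simp
  have tB : ∑ i ∈ Finset.range (2 * n),
      ((if 0 < e.2 then above f (n * d.1 + (-n + i + 1) * e.1, n * d.2 + (-n + i + 1) * e.2) -
        above f (n * d.1 + (-n + i) * e.1, n * d.2 + (-n + i) * e.2) else 0) -
      (if 0 < -e.2 then above f (-n * d.1 + (-n + i + 1) * e.1, -n * d.2 + (-n + i + 1) * e.2) -
        above f (-n * d.1 + (-n + i) * e.1, -n * d.2 + (-n + i) * e.2) else 0)) =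
      (if 0 < e.2 then P (d.2 + e.2) - P (d.2 - e.2) else 0) -
        if 0 < -e.2 then P (-d.2 + e.2) - P (-d.2 - e.2) else 0 := by
    rw [Finset.sum_sub_distrib]
    congr 1
    · split_ifs
      · rw [tc n, c1, c2]
      · simp
    · split_ifs
      · rw [tc (-n), c3, c4]
      · simp
  refine (congrArg₂ (· + ·) tA tB).trans ?_
  have hne : d.2 ≠ 0 ∨ e.2 ≠ 0 := by
    by_contra! hc
    rw [hΔ, hc.1, hc.2] at hdet
    simp at hdet
  rcases lt_trichotomy 0 d.2 with h1 | h1 | h1 <;> rcases lt_trichotomy 0 e.2 with h2 | h2 | h2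
  · rw [if_pos h1, if_neg (by omega), if_pos h2, if_neg (by omega)]
    linarith [hP1 (d.2 + e.2) (by omega), hP0 (-d.2 - e.2) (by omega)]
  · rw [if_pos h1, if_neg (by omega), if_neg (by omega), if_neg (by omega)]
    linarith [hP1 (d.2 - e.2) (by omega), hP0 (-d.2 - e.2) (by omega)]
  · rw [if_pos h1, if_neg (by omega), if_neg (by omega), if_pos (by omega)]
    linarith [hP1 (d.2 - e.2) (by omega), hP0 (-d.2 + e.2) (by omega)]
  · rw [if_neg (by omega), if_neg (by omega), if_pos h2, if_neg (by omega)]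
    linarith [hP1 (d.2 + e.2) (by omega), hP0 (d.2 - e.2) (by omega)]
  · omega
  · rw [if_neg (by omega), if_neg (by omega), if_neg (by omega), if_pos (by omega)]
    linarith [hP1 (-d.2 - e.2) (by omega), hP0 (-d.2 + e.2) (by omega)]
  · rw [if_neg (by omega), if_pos (by omega), if_pos h2, if_neg (by omega)]
    linarith [hP1 (-d.2 + e.2) (by omega), hP0 (d.2 - e.2) (by omega)]
  · rw [if_neg (by omega), if_pos (by omega), if_neg (by omega), if_neg (by omega)]
    linarith [hP1 (-d.2 + e.2) (by omega), hP0 (d.2 + e.2) (by omega)]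
  · rw [if_neg (by omega), if_pos (by omega), if_neg (by omega), if_pos (by omega)]
    linarith [hP1 (-d.2 - e.2) (by omega), hP0 (d.2 + e.2) (by omega)]

end


/-! ### Recovering base faces from the faces beside a copy -/

section

variable {G : Grid} {x : ℕ → G.Heading} {m : ℕ}

theorem exists_stroke_face (φ : ℤ × ℤ) :
    ∃ b : Stroke G, b.Positive ∧ (b.leftFace = φ ∨ b.rightFace = φ) := by
  obtain ⟨u, v⟩ := φ
  cases G
  · rcases Int.emod_two_eq_zero_or_one (u + v) with h | h
    · exact ⟨⟨(u, v), 0⟩, Or.inl ⟨h, Or.inl rfl⟩, Or.inl rfl⟩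
    · exact ⟨⟨(u, v), 1⟩, Or.inr ⟨h, Or.inl rfl⟩, Or.inr rfl⟩
  · rcases Int.emod_two_eq_zero_or_one u with h | h
    · refine ⟨⟨(u / 2, v), 0⟩, Or.inl rfl, Or.inl (Prod.ext ?_ rfl)⟩
      change 2 * (u / 2) = u
      omega
    · refine ⟨⟨(u / 2, v + 1), 0⟩, Or.inl rfl, Or.inr (Prod.ext ?_ ?_)⟩
      · change 2 * (u / 2) + 1 = u
        omega
      · exact add_sub_cancel_right v 1

theorem faceWinding_nonneg (hx : ∀ j, 0 < j → j < m → G.IsTurn (x j)) (hm : 0 < m)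
    (h : ∀ l, l = G.turn ∨ l = -G.turn → SimpleOn (tileWalk x m l) (G.sides * m)) (f φ : ℤ × ℤ) :
    0 ≤ faceWinding x m f φ := by
  obtain ⟨b, hb, rfl | rfl⟩ := exists_stroke_face (G := G) φ
  · rw [faceWinding_leftFace x hb]
    exact (winding_place hx hm h hb).2.1 f
  · rw [faceWinding_rightFace x hb]
    exact neg_nonneg.2 ((winding_place hx hm h hb).2.2.2 f)

theorem cellWinding_triangular (x : ℕ → Grid.triangular.Heading) (f : ℤ × ℤ) (u v : ℤ) :
    cellWinding x m f u v = faceWinding x m f (2 * u, v) + faceWinding x m f (2 * u + 1, v) := by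
  have h1 : 2 * u % 2 = 0 := by omega
  have h2 : ¬ (2 * u + 1) % 2 = 0 := by omega
  have h3 : 2 * u / 2 = u := by omega
  have h4 : (2 * u + 1) / 2 = u := by omega
  simp only [faceWinding, if_pos h1, if_neg h2, h3, h4, cellWinding]
  ring

/-- Nonnegative integers with sum 1: one of them is 1, the others are 0. -/
theorem cellWinding_unique (hx : ∀ j, 0 < j → j < m → G.IsTurn (x j)) (hm : 0 < m)
    (h : ∀ l, l = G.turn ∨ l = -G.turn → SimpleOn (tileWalk x m l) (G.sides * m)) (f : ℤ × ℤ) :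
    (∀ u v, cellWinding x m f u v ≤ 1) ∧ ∀ u v u' v', 0 < cellWinding x m f u v →
      0 < cellWinding x m f u' v' → u = u' ∧ v = v' := by
  have hpos : ∀ u v, 0 ≤ cellWinding x m f u v := by
    intro u v
    have := faceWinding_nonneg hx hm h f
    cases G
    · exact this (u, v)
    · rw [cellWinding_triangular]
      exact add_nonneg (this _) (this _)
  obtain ⟨N, hN⟩ := exists_sum_cellWinding hx hm (lastHeading_eq_zero hx hm h)
    (displacement_ne_zero hx hm h) f
  simp only [← Finset.sum_product'] at hN
  have key : ∀ u v u' v', ∃ (s : Finset (ℕ × ℕ)) (c c' : ℕ × ℕ) (n : ℕ), c ∈ s ∧ c' ∈ s ∧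
      ((-n + c.1 : ℤ) = u ∧ (-n + c.2 : ℤ) = v) ∧ ((-n + c'.1 : ℤ) = u' ∧ (-n + c'.2 : ℤ) = v') ∧
      ∑ c ∈ s, cellWinding x m f (-n + c.1) (-n + c.2) = 1 := by
    intro u v u' v'
    have b1 := neg_abs_le u
    have b2 := le_abs_self u
    have b3 := neg_abs_le v
    have b4 := le_abs_self v
    have b5 := neg_abs_le u'
    have b6 := le_abs_self u'
    have b7 := neg_abs_le v'
    have b8 := le_abs_self v'
    obtain ⟨n, hn⟩ : ∃ n : ℕ, n = N + (|u| + |v| + |u'| + |v'|).toNat + 1 := ⟨_, rfl⟩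
    have hn' := Int.self_le_toNat (|u| + |v| + |u'| + |v'|)
    refine ⟨_, ((u + n).toNat, (v + n).toNat), ((u' + n).toNat, (v' + n).toNat), n, ?_, ?_, ?_, ?_,
      hN n (by omega)⟩ <;>
    simp only [Finset.mem_product, Finset.mem_range] <;> constructor <;> omega
  constructor
  · intro u v
    obtain ⟨s, c, c', n, h1, -, ⟨rfl, rfl⟩, -, h2⟩ := key u v u v
    rw [← h2]
    exact Finset.single_le_sum
      (f := fun c : ℕ × ℕ => cellWinding x m f (-n + c.1) (-n + c.2)) (fun c _ => hpos _ _) h1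
  · intro u v u' v' hc hc'
    obtain ⟨s, c, c', n, h1, h1', ⟨rfl, rfl⟩, ⟨rfl, rfl⟩, h2⟩ := key u v u' v'
    obtain rfl | hne := eq_or_ne c c'
    · exact ⟨rfl, rfl⟩
    · have := Finset.sum_le_sum_of_subset_of_nonneg
        (f := fun c : ℕ × ℕ => cellWinding x m f (-n + c.1) (-n + c.2))
        (show {c, c'} ⊆ s from Finset.insert_subset h1 (Finset.singleton_subset_iff.2 h1'))
        (fun c _ _ => hpos _ _)
      rw [Finset.sum_pair hne, h2] at this
      omega

/-- A face is enclosed by the copy of at most one tile. -/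
theorem faceWinding_unique (hx : ∀ j, 0 < j → j < m → G.IsTurn (x j)) (hm : 0 < m)
    (h : ∀ l, l = G.turn ∨ l = -G.turn → SimpleOn (tileWalk x m l) (G.sides * m)) {f φ φ' : ℤ × ℤ}
    (h1 : faceWinding x m f φ = 1) (h2 : faceWinding x m f φ' = 1) : φ = φ' := by
  obtain ⟨hle, huniq⟩ := cellWinding_unique hx hm h f
  have hn := faceWinding_nonneg hx hm h f
  obtain ⟨u, v⟩ := φ
  obtain ⟨u', v'⟩ := φ'
  cases G
  · have hc : ∀ u v, faceWinding x m f (u, v) = 1 → 0 < cellWinding x m f u v := by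
      intro u v h
      change cellWinding x m f u v = 1 at h
      omega
    have := huniq u v u' v' (hc _ _ h1) (hc _ _ h2)
    rw [this.1, this.2]
  · have hc : ∀ u v, faceWinding x m f (u, v) = 1 → 0 < cellWinding x m f (u / 2) v := by
      intro u v h
      rw [cellWinding_triangular]
      have a1 := hn (2 * (u / 2), v)
      have a2 := hn (2 * (u / 2) + 1, v)
      rcases Int.emod_two_eq_zero_or_one u with hu | hu
      · rw [show 2 * (u / 2) = u by omega] at a2 ⊢
        omega
      · rw [show 2 * (u / 2) + 1 = u by omega] at a2 ⊢
        omega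
    obtain ⟨e1, rfl⟩ := huniq _ _ _ _ (hc _ _ h1) (hc _ _ h2)
    have e2 := hle (u / 2) v
    rw [cellWinding_triangular] at e2
    by_contra hne
    have hne' : u ≠ u' := fun h => hne (by rw [h])
    rcases lt_or_gt_of_ne hne' with hlt | hlt
    · rw [show 2 * (u / 2) = u by omega, show u + 1 = u' by omega] at e2
      omega
    · rw [show 2 * (u / 2) = u' by omega, show u' + 1 = u by omega] at e2
      omega

/-- A face to the left of the copy along `b` is enclosed by the tile around the left face of `b`,
and by no other tile. -/
theorem leftFace_eq_of_place (hx : ∀ j, 0 < j → j < m → G.IsTurn (x j)) (hm : 0 < m)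
    (h : ∀ l, l = G.turn ∨ l = -G.turn → SimpleOn (tileWalk x m l) (G.sides * m)) {b b' : Stroke G}
    (hb : b.Positive) (hb' : b'.Positive) {j j' : ℕ} (hj : j < m) (hj' : j' < m)
    (he : (Stroke.place (displacement x m) b (walk (Stroke.origin G) x j)).leftFace =
      (Stroke.place (displacement x m) b' (walk (Stroke.origin G) x j')).leftFace) :
    b.leftFace = b'.leftFace := by
  refine faceWinding_unique hx hm h (f := _) ((faceWinding_leftFace x hb _).trans
    ((winding_place hx hm h hb).1 j hj)) ?_
  rw [he]
  exact (faceWinding_leftFace x hb' _).trans ((winding_place hx hm h hb').1 j' hj')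

theorem rightFace_eq_of_place (hx : ∀ j, 0 < j → j < m → G.IsTurn (x j)) (hm : 0 < m)
    (h : ∀ l, l = G.turn ∨ l = -G.turn → SimpleOn (tileWalk x m l) (G.sides * m)) {b b' : Stroke G}
    (hb : b.Positive) (hb' : b'.Positive) {j j' : ℕ} (hj : j < m) (hj' : j' < m)
    (he : (Stroke.place (displacement x m) b (walk (Stroke.origin G) x j)).rightFace =
      (Stroke.place (displacement x m) b' (walk (Stroke.origin G) x j')).rightFace) :
    b.rightFace = b'.rightFace := by
  refine faceWinding_unique hx hm h (f := _) ((faceWinding_rightFace x hb _).trans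
    (neg_eq_iff_eq_neg.2 ((winding_place hx hm h hb).2.2.1 j hj))) ?_
  rw [he]
  exact (faceWinding_rightFace x hb' _).trans
    (neg_eq_iff_eq_neg.2 ((winding_place hx hm h hb').2.2.1 j' hj'))

/-- Excludes a crossing between a passage inside a copy and a passage at a joint of two copies. -/
theorem straight_separated {s t b : Stroke .triangular} (hs : s.Positive) (hb : b.Positive)
    (h : t.source = s.target) (hh : t.heading = s.heading) :
    ¬ (b.leftFace = t.leftFace ∧ b.rightFace = s.rightFace) ∧
      ¬ (b.leftFace = s.leftFace ∧ b.rightFace = t.rightFace) := by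
  obtain ⟨t1, t2⟩ := t
  dsimp only at h hh
  subst h hh
  obtain ⟨p, q, hs⟩ := hs.triangular_cases
  obtain ⟨u, v, hb⟩ := hb.triangular_cases
  rcases hs with rfl | rfl | rfl <;> rcases hb with rfl | rfl | rfl <;>
  simp (decide := true) only [Stroke.leftFace, Stroke.rightFace, Stroke.target, if_true, if_false,
    Prod.mk.injEq, Prod.fst_add, Prod.snd_add, Grid.step_triangular_zero,
    Grid.step_triangular_two, Grid.step_triangular_four] <;>
  omega

end


/-! ### Substitution preserves self-avoidance -/

section

variable {G : Grid} {x A : ℕ → G.Heading} {m N : ℕ}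

theorem Grid.mul_right_cancel {d p q : G.Point} (hd : d ≠ 0) (h : G.mul p d = G.mul q d) :
    p = q := by
  have hdet := Grid.det_pos hd
  obtain ⟨a, b⟩ := p
  obtain ⟨u, v⟩ := q
  rw [G.mul_eq a b, G.mul_eq u v] at h
  obtain ⟨h1, h2⟩ := Prod.mk.inj h
  generalize G.mul (0, 1) d = e at *
  have e1 : (d.1 * e.2 - d.2 * e.1) * (a - u) = 0 := by linear_combination e.2 * h1 - e.1 * h2
  have e2 : (d.1 * e.2 - d.2 * e.1) * (b - v) = 0 := by linear_combination d.1 * h2 - d.2 * h1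
  have e1' := (mul_eq_zero.1 e1).resolve_left hdet.ne'
  have e2' := (mul_eq_zero.1 e2).resolve_left hdet.ne'
  exact Prod.ext (by simp only; omega) (by simp only; omega)

theorem Grid.IsTurn.square_ne_zero {δ : Grid.square.Heading} (h : Grid.square.IsTurn δ) : δ ≠ 0 := by
  rcases h with h | h | ⟨h, -⟩
  · exact Grid.ne_zero_of_or (Or.inl h)
  · exact Grid.ne_zero_of_or (Or.inr h)
  · cases h

theorem simpleOn_walk
    (h : ∀ l, l = G.turn ∨ l = -G.turn → SimpleOn (tileWalk x m l) (G.sides * m)) :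
    SimpleOn (walk (Stroke.origin G) x) m := by
  have := (h _ (Or.inl rfl)).mono (M := m) (Nat.le_mul_of_pos_left _ G.sides_pos)
  refine ⟨fun i j hi hj hij => this.inj i j hi hj ?_, fun i j hi hj => ?_⟩
  · rwa [tileWalk_eq_walk hi, tileWalk_eq_walk hj]
  · have := this.noCross i j hi hj
    rwa [tileWalk_eq_walk hi, tileWalk_eq_walk hj, tileWalk_eq_walk (by omega),
      tileWalk_eq_walk (by omega)] at this

theorem walk_substTurns_of_lastHeading (hm : 0 < m) (hr : lastHeading x m = 0) (k : ℕ) {j : ℕ}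
    (hj : j < m) : walk (Stroke.origin G) (substTurns x m A) (m * k + j) =
      Stroke.place (displacement x m) (walk (Stroke.origin G) A k) (walk (Stroke.origin G) x j) := by
  rw [walk_substTurns x A hm k j hj]
  have : (fun i => A i + (walk (Stroke.origin G) x (m - 1)).heading) = A := by
    funext i
    rw [← lastHeading, hr, add_zero]
  rw [this]
  rfl

/-- A crossing produces two faces, each of which borders both passages, and faces determine base
faces. Two passages inside copies then lie in the same copy and cross in the curve of the
production; two passages at joints give a crossing of the base curve; the mixed cases fail by
`straight_separated`. -/
theorem noCross_substTurns {x A : ℕ → Grid.triangular.Heading}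
    (hx : ∀ j, 0 < j → j < m → Grid.triangular.IsTurn (x j)) (hm : 0 < m)
    (h : ∀ l, l = Grid.triangular.turn ∨ l = -Grid.triangular.turn →
      SimpleOn (tileWalk x m l) (Grid.triangular.sides * m))
    (hA : ∀ k, 0 < k → Grid.triangular.IsTurn (A k))
    (hB : SimpleOn (walk (Stroke.origin .triangular) A) N) {s : ℕ → Stroke .triangular}
    (hs : s = walk (Stroke.origin .triangular) (substTurns x m A)) (hw : IsWalk s) (i j : ℕ)
    (hi : i + 1 < m * N) (hj : j + 1 < m * N)
    (hi' : (s (i + 1)).heading = (s i).heading) (hj' : (s (j + 1)).heading = (s j).heading)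
    (hij : (s (i + 1)).source = (s (j + 1)).source) : (s j).heading ≠ (s i).heading + 2 := by
  intro h2
  have hr := lastHeading_eq_zero hx hm h
  have hd := displacement_ne_zero hx hm h
  have hbw := isWalk_walk (Stroke.positive_origin .triangular) hA
  have hX := simpleOn_walk h
  obtain ⟨B, hBdef⟩ : ∃ B, B = walk (Stroke.origin .triangular) A := ⟨_, rfl⟩
  rw [← hBdef] at hB hbw
  obtain ⟨c, hc⟩ : ∃ c, c = walk (Stroke.origin .triangular) x := ⟨_, rfl⟩
  rw [← hc] at hX
  have hclast : (c (m - 1)).heading = 0 := by rw [hc]; exact hr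
  have hc0 : c 0 = Stroke.origin .triangular := by rw [hc]; rfl
  -- A straight passage lies inside a copy or joins two copies; in the second case the base curve is
  -- straight there, as copies end with the heading with which they start.
  have dec : ∀ i, i + 1 < m * N → (s (i + 1)).heading = (s i).heading →
      (∃ k a, k < N ∧ a + 1 < m ∧ s i = Stroke.place (displacement x m) (B k) (c a) ∧
        s (i + 1) = Stroke.place (displacement x m) (B k) (c (a + 1))) ∨
      ∃ k, k + 1 < N ∧ s i = Stroke.place (displacement x m) (B k) (c (m - 1)) ∧
        s (i + 1) = Stroke.place (displacement x m) (B (k + 1)) (c 0) ∧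
        (B (k + 1)).heading = (B k).heading := by
    intro i hi hst
    have hj := Nat.mod_lt i hm
    have hij := Nat.div_add_mod i m
    have e1 := walk_substTurns_of_lastHeading (A := A) hm hr (i / m) hj
    rw [hij, ← hs, ← hBdef, ← hc] at e1
    by_cases hlt : i % m + 1 < m
    · have e2 := walk_substTurns_of_lastHeading (A := A) hm hr (i / m) hlt
      rw [← add_assoc, hij, ← hs, ← hBdef, ← hc] at e2
      exact Or.inl ⟨i / m, i % m, Nat.div_lt_of_lt_mul (by omega), hlt, e1, e2⟩
    · have e2 := walk_substTurns_of_lastHeading (A := A) hm hr (i / m + 1) hm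
      have e0 : i % m = m - 1 := by omega
      have e3 : m * (i / m + 1) + 0 = i + 1 := by rw [Nat.mul_succ]; omega
      rw [e3, ← hs, ← hBdef, ← hc] at e2
      rw [e0] at e1
      refine Or.inr ⟨i / m, ?_, e1, e2, ?_⟩
      · rw [add_zero] at e3
        exact Nat.lt_of_mul_lt_mul_left (a := m) (by rwa [e3])
      · rw [e1, e2] at hst
        simp only [Stroke.place, Stroke.move, hclast, hc0, Stroke.origin, add_zero] at hst
        exact hst
  -- At the crossing, `s (j + 1)` is `sideOut` of `s (i + 1)`.
  have hl : (s i).leftFace = (s (j + 1)).leftFace := by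
    rw [← (hw.positive i).sideOut_leftFace (hw.source_succ i) hi']
    congr 1
    refine Stroke.ext hij ?_
    rw [hj', h2, ← hi']
    rfl
  have hrt : (s (i + 1)).rightFace = (s j).rightFace :=
    (hw.positive i).sideIn_rightFace (hw.source_succ i) hi' ((hw.source_succ j).symm.trans hij.symm) h2
  have hL := fun {b b' : Stroke .triangular} => @leftFace_eq_of_place _ x m hx hm h b b'
  have hR := fun {b b' : Stroke .triangular} => @rightFace_eq_of_place _ x m hx hm h b b'
  simp only [← hc] at hL hR
  have hne : (s i).heading ≠ (s j).heading := by
    rw [h2]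
    have : ∀ t : ZMod 6, t ≠ t + 2 := by decide
    exact this _
  rcases dec i hi hi' with ⟨k, a, hk, ha, e1, e2⟩ | ⟨k, hk, e1, e2, e3⟩ <;>
  rcases dec j hj hj' with ⟨k', a', hk', ha', f1, f2⟩ | ⟨k', hk', f1, f2, f3⟩ <;>
  rw [e1, f2] at hl <;> rw [e2, f1] at hrt
  · have hl' := hL (hbw.positive k) (hbw.positive k') (by omega) ha' hl
    have hr' := hR (hbw.positive k) (hbw.positive k') ha (by omega) hrt
    have hbb := (hbw.positive k).eq_of_faces (hbw.positive k') hl' hr'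
    rw [e1, e2] at hi'
    rw [f1, f2] at hj'
    rw [e1, f1] at hne
    rw [e2, f2] at hij
    rw [← hbb] at hj' hij hne
    simp only [Stroke.place, Stroke.move, add_right_inj, ne_eq] at hi' hj' hij hne
    refine hne (hX.noCross a a' ha ha' hi' hj' ?_)
    have := @Stroke.move_injective .triangular 0 (B k).heading ⟨(c (a + 1)).source, 0⟩
      ⟨(c (a' + 1)).source, 0⟩ (Stroke.ext (by simpa [Stroke.move] using hij) rfl)
    exact (Stroke.mk.inj this).1
  · have hl' := hL (hbw.positive k) (hbw.positive (k' + 1)) (by omega) hm hl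
    have hr' := hR (hbw.positive k) (hbw.positive k') ha (by omega) hrt
    exact (straight_separated (hbw.positive k') (hbw.positive k) (hbw.source_succ k') f3).1
      ⟨hl', hr'⟩
  · have hl' := hL (hbw.positive k) (hbw.positive k') (by omega) ha' hl
    have hr' := hR (hbw.positive (k + 1)) (hbw.positive k') hm (by omega) hrt
    exact (straight_separated (hbw.positive k) (hbw.positive k') (hbw.source_succ k) e3).2
      ⟨hl'.symm, hr'.symm⟩
  · rw [e2, f2, hc0] at hij
    simp only [Stroke.place, Stroke.move, Stroke.origin, Grid.mul_zero, add_zero] at hij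
    have := hB.noCross k k' hk hk' e3 f3 (Grid.mul_right_cancel hd hij)
    rw [e1, f1] at hne
    simp only [Stroke.place, Stroke.move, hclast, add_zero] at hne
    exact hne this

/-- If both tiles are simple, then the replacement of strokes preserves self-avoidance. -/
theorem SimpleOn.substTurns (hx : ∀ j, 0 < j → j < m → G.IsTurn (x j)) (hm : 0 < m)
    (h : ∀ l, l = G.turn ∨ l = -G.turn → SimpleOn (tileWalk x m l) (G.sides * m))
    (hA : ∀ k, 0 < k → G.IsTurn (A k)) (hB : SimpleOn (walk (Stroke.origin G) A) N) :
    SimpleOn (walk (Stroke.origin G) (substTurns x m A)) (m * N) := by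
  have hr := lastHeading_eq_zero hx hm h
  have hbw := isWalk_walk (Stroke.positive_origin G) hA
  have hw := isWalk_walk (Stroke.positive_origin G) (isTurn_substTurns hx hm hA)
  refine ⟨fun i j hi hj hij => ?_, fun i j hi hj hi' hj' hij => ?_⟩
  · have hi' := Nat.mod_lt i hm
    have hj' := Nat.mod_lt j hm
    rw [← Nat.div_add_mod i m, ← Nat.div_add_mod j m] at hij ⊢
    rw [walk_substTurns_of_lastHeading hm hr _ hi', walk_substTurns_of_lastHeading hm hr _ hj'] at hij
    have hb := (hbw.positive (i / m)).eq_of_faces (hbw.positive (j / m))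
      (leftFace_eq_of_place hx hm h (hbw.positive _) (hbw.positive _) hi' hj' (by rw [hij]))
      (rightFace_eq_of_place hx hm h (hbw.positive _) (hbw.positive _) hi' hj' (by rw [hij]))
    have hk := hB.inj _ _ (Nat.div_lt_of_lt_mul hi) (Nat.div_lt_of_lt_mul hj) hb
    rw [hb] at hij
    rw [hk, (simpleOn_walk h).inj _ _ hi' hj' (Stroke.place_injective _ _ hij)]
  · cases G
    · have := (isTurn_substTurns hx hm hA (i + 1) (Nat.succ_pos i)).square_ne_zero
      simp only [walk, add_eq_left] at hi'
      exact absurd hi' this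
    · have key := noCross_substTurns hx hm h hA hB rfl hw
      have h1 := key i j hi hj hi' hj' hij
      have h2 := key j i hj hi hj' hi' hij.symm
      have h3 : ∀ a b : ZMod 6, a = 0 ∨ a = 2 ∨ a = 4 → b = 0 ∨ b = 2 ∨ b = 4 → b ≠ a + 2 →
        a ≠ b + 2 → a = b := by decide
      exact h3 _ _ (hw.positive i) (hw.positive j) h1 h2

theorem isTurn_iterTurns (hx : ∀ j, 0 < j → j < m → G.IsTurn (x j)) (hm : 0 < m) (n : ℕ) :
    ∀ i, 0 < i → G.IsTurn (iterTurns G x m n i) := by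
  induction n with
  | zero => exact fun i _ => G.isTurn_turn
  | succ n ih => exact isTurn_substTurns hx hm ih

/-- If both tiles are simple, then all iterates are. -/
theorem simpleOn_iterTurns (hx : ∀ j, 0 < j → j < m → G.IsTurn (x j)) (hm : 0 < m)
    (h : ∀ l, l = G.turn ∨ l = -G.turn → SimpleOn (tileWalk x m l) (G.sides * m)) (n : ℕ) :
    SimpleOn (walk (Stroke.origin G) (iterTurns G x m n)) (m ^ n) := by
  induction n with
  | zero =>
    refine ⟨fun i j hi hj _ => ?_, fun i j hi => ?_⟩
    · rw [pow_zero] at hi hj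
      omega
    · rw [pow_zero] at hi
      omega
  | succ n ih =>
    rw [pow_succ']
    exact ih.substTurns hx hm h (isTurn_iterTurns hx hm n)

end


/-! # Tiles of self-avoiding curves -/

section

variable {G : Grid} {x : ℕ → G.Heading} {m : ℕ} {l : G.Heading}

theorem SimpleOn.of_walk_shift {T T' : ℕ → G.Heading} {N M a : ℕ}
    (h : SimpleOn (walk (Stroke.origin G) T) N) (ha : a + M ≤ N)
    (hT : ∀ i, 0 < i → i < M → T (a + i) = T' i) : SimpleOn (walk (Stroke.origin G) T') M := by
  have key : ∀ i < M, walk (Stroke.origin G) T (a + i) =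
      (walk (Stroke.origin G) T' i).move (walk (Stroke.origin G) T a).source
        (walk (Stroke.origin G) T a).heading := by
    intro i hi
    rw [walk_add, ← walk_move, Stroke.move_origin]
    exact walk_congr _ hT i hi
  refine ⟨fun i j hi hj hij => ?_, fun i j hi hj hi' hj' hij => ?_⟩
  · have := h.inj (a + i) (a + j) (by omega) (by omega) (by rw [key i hi, key j hj, hij])
    omega
  · have := h.noCross (a + i) (a + j) (by omega) (by omega)
    rw [add_assoc, add_assoc, key _ hi, key _ hj, key i (by omega), key j (by omega)] at this
    simp only [Stroke.move, hi', hj', hij] at this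
    exact add_left_cancel (this trivial trivial trivial)

/-- The copies with numbers `j - 1` and `j` in the second iterate are joined by the turn `x j`. -/
theorem simpleOn_tileWalk_two (hC : SimpleOn (walk (Stroke.origin G) (iterTurns G x m 2)) (m ^ 2))
    {j : ℕ} (hj : 0 < j) (hjm : j < m) (hjl : x j = l) : SimpleOn (tileWalk x m l) (2 * m) := by
  have hm : 0 < m := by omega
  refine hC.of_walk_shift (a := m * (j - 1)) ?_ fun i hi him => ?_
  · have : m * (j + 1) ≤ m * m := Nat.mul_le_mul_left m hjm
    rw [pow_two]
    refine le_trans (le_of_eq ?_) this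
    obtain ⟨k, rfl⟩ : ∃ k, j = k + 1 := ⟨j - 1, by omega⟩
    rw [Nat.add_sub_cancel]
    ring
  · simp only [iterTurns, substTurns, Nat.mul_add_mod]
    split_ifs with h0 h1
    · exfalso
      obtain ⟨c, hc⟩ := Nat.dvd_of_mod_eq_zero h0
      have hc1 : c = 1 := by
        have h2 : c < 2 := Nat.lt_of_mul_lt_mul_left (a := m) (by omega)
        have h3 : c ≠ 0 := by rintro rfl; omega
        omega
      rw [hc, hc1, ← Nat.mul_add, Nat.mul_div_cancel_left _ hm, Nat.sub_add_cancel hj,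
        Nat.mod_eq_of_lt hjm] at h1
      omega
    · obtain ⟨c, hc⟩ := Nat.dvd_of_mod_eq_zero h0
      have hc1 : c = 1 := by
        have h2 : c < 2 := Nat.lt_of_mul_lt_mul_left (a := m) (by omega)
        have h3 : c ≠ 0 := by rintro rfl; omega
        omega
      rw [hc, hc1, ← Nat.mul_add, Nat.mul_div_cancel_left _ hm, Nat.sub_add_cancel hj,
        Nat.mod_eq_of_lt hjm, hjl]
    · rfl

theorem tileWalk_window_inj (hm : 0 < m) (h : SimpleOn (tileWalk x m l) (2 * m)) (k : ℕ) {i j : ℕ}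
    (hi : i < 2 * m) (hj : j < 2 * m)
    (hij : tileWalk x m l (k * m + i) = tileWalk x m l (k * m + j)) : i = j := by
  rw [tileWalk_mul_add hm, tileWalk_mul_add hm] at hij
  exact h.inj i j hi hj ((Function.Injective.iterate (Stroke.move_injective _ _) k) hij)

theorem tileWalk_window_noCross (hm : 0 < m) (h : SimpleOn (tileWalk x m l) (2 * m)) (k : ℕ)
    {i j : ℕ} (hi : i + 1 < 2 * m) (hj : j + 1 < 2 * m)
    (hi' : (tileWalk x m l (k * m + i + 1)).heading = (tileWalk x m l (k * m + i)).heading)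
    (hj' : (tileWalk x m l (k * m + j + 1)).heading = (tileWalk x m l (k * m + j)).heading)
    (hij : (tileWalk x m l (k * m + i + 1)).source = (tileWalk x m l (k * m + j + 1)).source) :
    (tileWalk x m l (k * m + i)).heading = (tileWalk x m l (k * m + j)).heading := by
  induction k with
  | zero =>
    simp only [Nat.zero_mul, zero_add] at *
    exact h.noCross i j hi hj hi' hj' hij
  | succ k ih =>
    have e : ∀ i, tileWalk x m l ((k + 1) * m + i) =
        (tileWalk x m l (k * m + i)).move (displacement x m) (lastHeading x m + l) := by
      intro i
      rw [← tileWalk_add hm]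
      congr 1
      ring
    rw [add_assoc] at hi' hj'
    rw [add_assoc, add_assoc _ j] at hij
    rw [e, e] at hi' hj' hij ⊢
    simp only [Stroke.move, add_right_inj] at hi' hj' hij ⊢
    refine ih hi' hj' ?_
    have := @Stroke.move_injective G 0 (lastHeading x m + l)
      ⟨(tileWalk x m l (k * m + (i + 1))).source, 0⟩ ⟨(tileWalk x m l (k * m + (j + 1))).source, 0⟩
      (Stroke.ext (by simpa [Stroke.move] using hij) rfl)
    exact (Stroke.mk.inj this).1

/-- Any two of three sides are consecutive in cyclic order, and the rotation of the tile carries the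
hypothesis to each such pair. -/
theorem isSimpleClosed_of_two_triangular {x : ℕ → Grid.triangular.Heading}
    {l : Grid.triangular.Heading} (hx : ∀ j, 0 < j → j < m → Grid.triangular.IsTurn (x j))
    (hm : 0 < m) (h : SimpleOn (tileWalk x m l) (2 * m))
    (hβ : lastHeading x m + l = Grid.turn .triangular ∨ lastHeading x m + l = -Grid.turn .triangular)
    (hl : l = Grid.turn .triangular ∨ l = -Grid.turn .triangular) :
    IsSimpleClosed (tileWalk x m l) (Grid.sides .triangular * m) := by
  have hper : ∀ i, tileWalk x m l (i + 3 * m) = tileWalk x m l i := tileWalk_periodic hm hβ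
  refine isSimpleClosed_tileWalk hx hm hβ hl ⟨?_, ?_⟩
  · have key : ∀ i j, i ≤ j → i < 3 * m → j < 3 * m → tileWalk x m l i = tileWalk x m l j →
        i = j := by
      intro i j hle hi hj hij
      by_cases h1 : j < 2 * m
      · exact h.inj i j (by omega) h1 hij
      by_cases h2 : m ≤ i
      · have := tileWalk_window_inj hm h 1 (i := i - m) (j := j - m) (by omega) (by omega)
          (by rwa [one_mul, Nat.add_sub_cancel' h2, Nat.add_sub_cancel' (by omega)])
        omega
      · have := tileWalk_window_inj hm h 2 (i := i + m) (j := j - 2 * m) (by omega) (by omega)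
          (by
            rw [Nat.add_sub_cancel' (by omega), ← hij, show 2 * m + (i + m) = i + 3 * m by ring,
              hper])
        omega
    intro i j hi hj hij
    rcases le_total i j with hle | hle
    · exact key i j hle hi hj hij
    · exact (key j i hle hj hi hij.symm).symm
  · have block : ∀ i, i + 1 < 3 * m →
        (tileWalk x m l (i + 1)).heading = (tileWalk x m l i).heading →
        i + 1 < m ∨ m ≤ i ∧ i + 1 < 2 * m ∨ 2 * m ≤ i := by
      intro i hi hst
      have := tileWalk_heading_ne (Grid.ne_zero_of_or hl) hst
      have h1 : i + 1 ≠ m := fun e => this (by rw [e, Nat.mod_self])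
      have h2 : i + 1 ≠ 2 * m := fun e => this (by rw [e, Nat.mul_mod_left])
      omega
    have key : ∀ i j, i ≤ j → i + 1 < 3 * m → j + 1 < 3 * m →
        (tileWalk x m l (i + 1)).heading = (tileWalk x m l i).heading →
        (tileWalk x m l (j + 1)).heading = (tileWalk x m l j).heading →
        (tileWalk x m l (i + 1)).source = (tileWalk x m l (j + 1)).source →
        (tileWalk x m l i).heading = (tileWalk x m l j).heading := by
      intro i j hle hi hj hi' hj' hij
      have bi := block i hi hi'
      have bj := block j hj hj'
      by_cases h1 : j + 1 < 2 * m
      · exact h.noCross i j (by omega) h1 hi' hj' hij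
      by_cases h2 : m ≤ i
      · have := tileWalk_window_noCross hm h 1 (i := i - m) (j := j - m) (by omega) (by omega)
        rw [one_mul, Nat.add_sub_cancel' h2, Nat.add_sub_cancel' (by omega)] at this
        exact this hi' hj' hij
      · have := tileWalk_window_noCross hm h 2 (i := i + m) (j := j - 2 * m) (by omega) (by omega)
        rw [Nat.add_sub_cancel' (by omega), show 2 * m + (i + m) + 1 = i + 1 + 3 * m by ring,
          show 2 * m + (i + m) = i + 3 * m by ring, hper, hper] at this
        exact this hi' hj' hij
    intro i j hi hj hi' hj' hij
    rcases le_total i j with hle | hle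
    · exact key i j hle hi hj hi' hj' hij
    · exact (key j i hle hj hi hj' hi' hij.symm).symm

end


/-! # Disjoint closed walks on the square grid -/

section

variable {a b : ℕ → Stroke .square} {n : ℕ}

theorem winding_left_sub_right_of_disjoint (hb : IsWalk b) (pb : ∀ i, b (i + n) = b i)
    {e : Stroke .square} (he : e.Positive) (h : ∀ j, e ≠ b j) :
    winding b 0 n e.leftFace = winding b 0 n e.rightFace := by
  have h1 := winding_left_sub_right hb (Nat.zero_le n) he
  have h2 := pb 0
  rw [zero_add] at h2
  rw [h2, traversals_eq_zero fun k _ _ hk => h k hk.symm] at h1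
  omega

/-- Consecutive strokes of `a` share a face, and the two faces beside a stroke of `a` are not
separated by `b`. -/
theorem winding_const_of_disjoint (ha : IsWalk a) (hb : IsWalk b) (pb : ∀ i, b (i + n) = b i)
    (h : ∀ i j, a i ≠ b j) (i : ℕ) :
    winding b 0 n (a i).leftFace = winding b 0 n (a 0).leftFace := by
  induction i with
  | zero => rfl
  | succ i ih =>
    have h1 := winding_left_sub_right_of_disjoint hb pb (ha.positive i) (h i)
    have h2 := winding_left_sub_right_of_disjoint hb pb (ha.positive (i + 1)) (h (i + 1))
    rcases (ha.positive i).turn_cases (ha.positive (i + 1)) (ha.source_succ i) with h' | h' | ⟨h', -⟩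
    · rw [(ha.positive i).leftFace_eq (ha.positive (i + 1)) (ha.source_succ i) h', ih]
    · rw [h2, (ha.positive i).rightFace_eq (ha.positive (i + 1)) (ha.source_succ i) h', ← h1, ih]
    · cases h'

theorem crossing_eq_zero_of_height {s : Stroke .square} (hs : s.Positive) {f : ℤ × ℤ}
    (h1 : s.source.2 ≤ f.2) (h2 : s.target.2 ≤ f.2) : s.crossing f = 0 := by
  obtain ⟨p, q, hs⟩ := hs.square_cases
  rcases hs with ⟨-, rfl⟩ | ⟨-, rfl⟩ | ⟨-, rfl⟩ | ⟨-, rfl⟩ <;>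
  simp (decide := true) only [Stroke.crossing, Stroke.target, if_true, if_false, Prod.snd_add,
    Grid.step_square_zero, Grid.step_square_one, Grid.step_square_two,
    Grid.step_square_three] at h1 h2 ⊢ <;>
  (split_ifs <;> omega)

theorem crossing_eq_zero_of_le {s : Stroke .square} (hs : s.Positive) {f : ℤ × ℤ}
    (h1 : s.source.1 ≤ f.1) : s.crossing f = 0 := by
  obtain ⟨p, q, hs⟩ := hs.square_cases
  rcases hs with ⟨-, rfl⟩ | ⟨-, rfl⟩ | ⟨-, rfl⟩ | ⟨-, rfl⟩ <;>
  simp (decide := true) only [Stroke.crossing, if_true, if_false] at h1 ⊢ <;>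
  (split_ifs <;> omega)

/-- The walk turns at its highest point, so one of the two strokes there is horizontal, and one of
its faces lies above it. -/
theorem exists_horizontal_top (ha : IsWalk a) (pa : ∀ i, a (i + n) = a i) (hn : 0 < n) {k : ℕ}
    (hk : ∀ i, (a i).source.2 ≤ (a k).source.2) :
    ∃ i, (a k).source.2 = (a i).leftFace.2 ∨ (a k).source.2 = (a i).rightFace.2 := by
  obtain ⟨k', hk', hs⟩ : ∃ k', a (k' + 1) = a k ∧ (a (k' + 1 + 1)).source = (a (k + 1)).source := by
    refine ⟨k + (n - 1), ?_, ?_⟩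
    · rw [add_assoc, Nat.sub_add_cancel hn, pa]
    · rw [show k + (n - 1) + 1 + 1 = k + 1 + n by omega, pa]
  have ht := hk (k' + 1 + 1)
  have hp := hk k'
  rw [ha.source_succ (k' + 1), hk'] at ht
  have hsrc := ha.source_succ k'
  have htc := (ha.positive k').turn_cases (ha.positive (k' + 1)) hsrc
  rw [hk'] at hsrc htc
  obtain ⟨p, q, hc⟩ := (ha.positive k).square_cases
  obtain ⟨u, v, hc'⟩ := (ha.positive k').square_cases
  rcases hc with ⟨-, hc⟩ | ⟨-, hc⟩ | ⟨-, hc⟩ | ⟨-, hc⟩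
  · refine ⟨k, Or.inl ?_⟩
    rw [hc]
    rfl
  · rw [hc] at ht
    simp [Stroke.target] at ht
  · refine ⟨k, Or.inr ?_⟩
    rw [hc]
    rfl
  · rcases hc' with ⟨-, hc'⟩ | ⟨-, hc'⟩ | ⟨-, hc'⟩ | ⟨-, hc'⟩ <;> rw [hc, hc'] at hsrc htc
    · refine ⟨k', Or.inl ?_⟩
      rw [hc, hc', hsrc]
      simp [Stroke.target, Stroke.leftFace]
    · exfalso
      dsimp only at htc
      revert htc
      have : ¬ ((3 : Grid.square.Heading) = 1 + Grid.square.turn ∨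
        (3 : Grid.square.Heading) = 1 - Grid.square.turn) := by decide
      rintro (h | h | ⟨h, -⟩)
      · exact this (Or.inl h)
      · exact this (Or.inr h)
      · cases h
    · refine ⟨k', Or.inr ?_⟩
      rw [hc, hc', hsrc]
      simp [Stroke.target, Stroke.rightFace, show ¬ ((2 : Grid.square.Heading) = 0) by decide,
        show ¬ ((2 : Grid.square.Heading) = 1) by decide]
    · exfalso
      dsimp only at htc
      have : ¬ ((3 : Grid.square.Heading) = 3 + Grid.square.turn ∨
        (3 : Grid.square.Heading) = 3 - Grid.square.turn) := by decide
      rcases htc with h | h | ⟨h, -⟩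
      · exact this (Or.inl h)
      · exact this (Or.inr h)
      · cases h

theorem exists_vertical_right (ha : IsWalk a) (pa : ∀ i, a (i + n) = a i) (hn : 0 < n) {k : ℕ}
    (hk : ∀ i, (a i).source.1 ≤ (a k).source.1) :
    ∃ i, (a k).source.1 = (a i).leftFace.1 ∨ (a k).source.1 = (a i).rightFace.1 := by
  obtain ⟨k', hk', hs⟩ : ∃ k', a (k' + 1) = a k ∧ (a (k' + 1 + 1)).source = (a (k + 1)).source := by
    refine ⟨k + (n - 1), ?_, ?_⟩
    · rw [add_assoc, Nat.sub_add_cancel hn, pa]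
    · rw [show k + (n - 1) + 1 + 1 = k + 1 + n by omega, pa]
  have ht := hk (k' + 1 + 1)
  rw [ha.source_succ (k' + 1), hk'] at ht
  have hsrc := ha.source_succ k'
  have htc := (ha.positive k').turn_cases (ha.positive (k' + 1)) hsrc
  rw [hk'] at hsrc htc
  obtain ⟨p, q, hc⟩ := (ha.positive k).square_cases
  obtain ⟨u, v, hc'⟩ := (ha.positive k').square_cases
  rcases hc with ⟨-, hc⟩ | ⟨-, hc⟩ | ⟨-, hc⟩ | ⟨-, hc⟩
  · rw [hc] at ht
    simp [Stroke.target] at ht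
  · refine ⟨k, Or.inr ?_⟩
    rw [hc]
    rfl
  · rcases hc' with ⟨-, hc'⟩ | ⟨-, hc'⟩ | ⟨-, hc'⟩ | ⟨-, hc'⟩ <;> rw [hc, hc'] at hsrc htc
    · exfalso
      dsimp only at htc
      have : ¬ ((2 : Grid.square.Heading) = 0 + Grid.square.turn ∨
        (2 : Grid.square.Heading) = 0 - Grid.square.turn) := by decide
      rcases htc with h | h | ⟨h, -⟩
      · exact this (Or.inl h)
      · exact this (Or.inr h)
      · cases h
    · refine ⟨k', Or.inr ?_⟩
      rw [hc, hc', hsrc]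
      simp [Stroke.target, Stroke.rightFace, show ¬ ((1 : Grid.square.Heading) = 0) by decide]
    · exfalso
      dsimp only at htc
      have : ¬ ((2 : Grid.square.Heading) = 2 + Grid.square.turn ∨
        (2 : Grid.square.Heading) = 2 - Grid.square.turn) := by decide
      rcases htc with h | h | ⟨h, -⟩
      · exact this (Or.inl h)
      · exact this (Or.inr h)
      · cases h
    · refine ⟨k', Or.inl ?_⟩
      rw [hc, hc', hsrc]
      simp [Stroke.target, Stroke.leftFace, show ¬ ((3 : Grid.square.Heading) = 0) by decide,
        show ¬ ((3 : Grid.square.Heading) = 1) by decide,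
        show ¬ ((3 : Grid.square.Heading) = 2) by decide]
  · refine ⟨k, Or.inl ?_⟩
    rw [hc]
    rfl

/-- Two closed walks without common strokes cannot both wind around a face, if one of them contains
a highest and the other one a rightmost point. -/
theorem false_of_disjoint (ha : IsWalk a) (hb : IsWalk b) (pa : ∀ i, a (i + n) = a i)
    (pb : ∀ i, b (i + n) = b i) (hn : 0 < n) (h : ∀ i j, a i ≠ b j) {o : ℤ × ℤ}
    (hao : winding a 0 n o ≠ 0) (hbo : winding b 0 n o ≠ 0) {k k' : ℕ}
    (hka : ∀ i, (a i).source.2 ≤ (a k).source.2) (hkb : ∀ i, (b i).source.2 ≤ (a k).source.2)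
    (hka' : ∀ i, (a i).source.1 ≤ (b k').source.1) (hkb' : ∀ i, (b i).source.1 ≤ (b k').source.1) :
    False := by
  have hb0 : ∀ i, winding b 0 n (a i).leftFace = 0 ∧ winding b 0 n (a i).rightFace = 0 := by
    -- The row above the highest point of `a` is not reached by `b`; so `b` does not wind around any
    -- face along `a`.
    have top : ∀ f : ℤ × ℤ, (a k).source.2 = f.2 → winding b 0 n f = 0 := fun f hf =>
      Finset.sum_eq_zero fun i _ => crossing_eq_zero_of_height (hb.positive i) (hf ▸ hkb i)
        (by rw [← hb.source_succ, ← hf]; exact hkb (i + 1))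
    have eq := fun i => winding_left_sub_right_of_disjoint hb pb (ha.positive i) (h i)
    obtain ⟨i, hi⟩ := exists_horizontal_top ha pa hn hka
    have h0 : winding b 0 n (a i).leftFace = 0 := by
      rcases hi with hi | hi
      · exact top _ hi
      · rw [eq, top _ hi]
    intro i'
    have h1 := (winding_const_of_disjoint ha hb pb h i').trans
      ((winding_const_of_disjoint ha hb pb h i).symm.trans h0)
    exact ⟨h1, (eq i').symm.trans h1⟩
  have ha0 : ∀ i, winding a 0 n (b i).leftFace = 0 ∧ winding a 0 n (b i).rightFace = 0 := by
    have right : ∀ f : ℤ × ℤ, (b k').source.1 = f.1 → winding a 0 n f = 0 := fun f hf =>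
      Finset.sum_eq_zero fun i _ => crossing_eq_zero_of_le (ha.positive i) (hf ▸ hka' i)
    have h' : ∀ i j, b i ≠ a j := fun i j e => h j i e.symm
    have eq := fun i => winding_left_sub_right_of_disjoint ha pa (hb.positive i) (h' i)
    obtain ⟨i, hi⟩ := exists_vertical_right hb pb hn hkb'
    have h0 : winding a 0 n (b i).leftFace = 0 := by
      rcases hi with hi | hi
      · exact right _ hi
      · rw [eq, right _ hi]
    intro i'
    have h1 := (winding_const_of_disjoint hb ha pa h' i').trans
      ((winding_const_of_disjoint hb ha pa h' i).symm.trans h0)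
    exact ⟨h1, (eq i').symm.trans h1⟩
  -- Go from `o` to the right. One of the winding numbers can change only at a stroke of that walk,
  -- but there the other one is 0; so both remain nonzero forever, which is absurd.
  have key : ∀ t : ℕ, winding a 0 n (o.1 + t, o.2) ≠ 0 ∧ winding b 0 n (o.1 + t, o.2) ≠ 0 := by
    intro t
    induction t with
    | zero => simpa using ⟨hao, hbo⟩
    | succ t ih =>
      have e : (o.1 + ((t + 1 : ℕ) : ℤ), o.2) = (o.1 + t + 1, o.2) := by push_cast; ring_nf
      rw [e]
      have e1 : winding a 0 n (o.1 + t, o.2) = winding a 0 n (o.1 + t + 1, o.2) := by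
        by_contra hne
        obtain ⟨i, -, -, hi | hi⟩ := exists_crossing_ne ha.positive hne
        · exact ih.2 (hi.1 ▸ (hb0 i).1)
        · exact ih.2 (hi.2 ▸ (hb0 i).2)
      have e2 : winding b 0 n (o.1 + t, o.2) = winding b 0 n (o.1 + t + 1, o.2) := by
        by_contra hne
        obtain ⟨i, -, -, hi | hi⟩ := exists_crossing_ne hb.positive hne
        · exact ih.1 (hi.1 ▸ (ha0 i).1)
        · exact ih.1 (hi.2 ▸ (ha0 i).2)
      rw [← e1, ← e2]
      exact ih
  obtain ⟨J, hJ⟩ := exists_winding_eq_zero a 0 n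
  exact (key (J - o.1).toNat).1 (hJ _ _ (by have := Int.self_le_toNat (J - o.1); omega))

end


/-! ### Closed walks with a half-turn symmetry -/

section

variable {v v' : ℕ → Stroke .square} {p : ℕ}

/-- The half-turn about the center of the face `o` takes the ray to the right into the ray to the
left; together they form a line, whose crossings are differences of `above`. -/
theorem crossing_opposite {s : Stroke .square} (hs : s.Positive) (o : ℤ × ℤ) :
    s.crossing o - (s.move (2 * o.1 + 1, 2 * o.2 + 1) 2).crossing o =
      above o s.target - above o s.source := by
  obtain ⟨a, b, hs⟩ := hs.square_cases
  have e1 : (2 : Grid.square.Heading) + 1 = 3 := by decide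
  have e2 : (2 : Grid.square.Heading) + 2 = 0 := by decide
  have e3 : (2 : Grid.square.Heading) + 3 = 1 := by decide
  rcases hs with ⟨-, rfl⟩ | ⟨-, rfl⟩ | ⟨-, rfl⟩ | ⟨-, rfl⟩ <;>
  simp (decide := true) only [Stroke.crossing, Stroke.move, above, Stroke.target, Grid.mul,
    if_true, if_false, Prod.fst_add, Prod.snd_add, add_zero, e1, e2, e3, Grid.step_square_zero,
    Grid.step_square_one, Grid.step_square_two, Grid.step_square_three] <;>
  (split_ifs <;> omega)

/-- The winding number is odd: half of the walk leads from one side of the horizontal line through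
the center to the other side. -/
theorem winding_ne_zero_of_opposite (hv : IsWalk v) {o : ℤ × ℤ}
    (h : ∀ k, v (p + k) = (v k).move (2 * o.1 + 1, 2 * o.2 + 1) 2) : winding v 0 (2 * p) o ≠ 0 := by
  have h1 : winding v 0 (2 * p) o =
      ∑ k ∈ Finset.range p, ((v k).crossing o - ((v k).move (2 * o.1 + 1, 2 * o.2 + 1) 2).crossing o) +
        2 * ∑ k ∈ Finset.range p, (v (p + k)).crossing o := by
    rw [winding, Nat.Ico_zero_eq_range, two_mul, Finset.sum_range_add, Finset.sum_sub_distrib]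
    simp only [h]
    ring
  have h2 : ∑ k ∈ Finset.range p,
      ((v k).crossing o - ((v k).move (2 * o.1 + 1, 2 * o.2 + 1) 2).crossing o) =
      above o (v p).source - above o (v 0).source := by
    rw [← Finset.sum_range_sub fun k => above o (v k).source]
    refine Finset.sum_congr rfl fun k _ => ?_
    rw [crossing_opposite (hv.positive k), hv.source_succ]
  have h3 : above o (v p).source = 1 - above o (v 0).source := by
    rw [show v p = v (p + 0) from rfl, h]
    simp only [above, Stroke.move, Grid.mul, Grid.step_square_two, Prod.snd_add]
    split_ifs <;> omega
  rw [h1, h2, h3]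
  omega

theorem exists_forall_le_of_periodic {f : ℕ → ℤ} {n : ℕ} (hn : 0 < n) (hf : ∀ i, f (i + n) = f i) :
    ∃ k, ∀ i, f i ≤ f k := by
  obtain ⟨k, -, hk⟩ := (Finset.range n).exists_max_image f ⟨0, Finset.mem_range.2 hn⟩
  refine ⟨k, fun i => ?_⟩
  rw [← Function.Periodic.map_mod_nat (f := f) hf]
  exact hk _ (Finset.mem_range.2 (Nat.mod_lt i hn))

/-- A closed walk that is invariant under a half-turn meets its image under the quarter-turn with
the same center. -/
theorem false_of_quarter_turn (hv : IsWalk v) (hv' : IsWalk v') (hp : 0 < p) {d : Grid.square.Point}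
    {β : Grid.square.Heading} (hβ : β = 1 ∨ β = 3) (hd : (d.1 + d.2) % 2 = 1)
    (h : ∀ k, v (p + k) = (v k).move (d + Grid.mul .square (Grid.step .square β) d) 2)
    (hg : ∀ k, v' k = (v k).move d β) (hdis : ∀ i j, v i ≠ v' j) : False := by
  obtain ⟨c, hc⟩ : ∃ c, c = d + Grid.mul .square (Grid.step .square β) d := ⟨_, rfl⟩
  -- As `d.1 + d.2` is odd, both coordinates of `c` are odd, so the center `c / 2` of the half-turn
  -- is the center of a face.
  obtain ⟨o, ho⟩ : ∃ o : ℤ × ℤ, c = (2 * o.1 + 1, 2 * o.2 + 1) := by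
    refine ⟨((c.1 - 1) / 2, (c.2 - 1) / 2), ?_⟩
    rw [hc]
    rcases hβ with rfl | rfl <;>
    refine Prod.ext ?_ ?_ <;>
    simp only [Grid.mul, Grid.step_square_one, Grid.step_square_three, Prod.fst_add, Prod.snd_add] <;>
    omega
  rw [← hc] at h
  have hper : ∀ i, v (i + 2 * p) = v i := fun i => by
    rw [show i + 2 * p = p + (p + i) by ring, h, h, Stroke.move_move_opposite]
  have hper' : ∀ i, v' (i + 2 * p) = v' i := fun i => by rw [hg, hg, hper]
  have h' : ∀ k, v' (p + k) = (v' k).move c 2 := fun k => by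
    rw [hg, hg, h, Stroke.move_move, Stroke.move_move, add_comm β 2, hc]
    congr 1
    rcases hβ with rfl | rfl <;> ext <;>
    simp [Grid.mul]
  have w1 : winding v 0 (2 * p) o ≠ 0 := winding_ne_zero_of_opposite hv fun k => by rw [h, ho]
  have w2 : winding v' 0 (2 * p) o ≠ 0 := winding_ne_zero_of_opposite hv' fun k => by rw [h', ho]
  have hn : 0 < 2 * p := by omega
  have hdis' : ∀ i j, v' i ≠ v j := fun i j e => hdis j i e.symm
  obtain ⟨k, hk⟩ := exists_forall_le_of_periodic (f := fun i => (v i).source.2) hn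
    fun i => by rw [hper]
  obtain ⟨k', hk'⟩ := exists_forall_le_of_periodic (f := fun i => (v i).source.1) hn
    fun i => by rw [hper]
  have ρ1 : ∀ i, (v (p + i)).source.1 = c.1 - (v i).source.1 := fun i => by
    rw [h]
    simp only [Stroke.move, Grid.mul, Grid.step_square_two, Prod.fst_add]
    ring
  have ρ2 : ∀ i, (v (p + i)).source.2 = c.2 - (v i).source.2 := fun i => by
    rw [h]
    simp only [Stroke.move, Grid.mul, Grid.step_square_two, Prod.snd_add]
    ring
  -- The quarter-turn interchanges the extents in height and width, so if one of the walks reaches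
  -- at least as high as the other, then the other reaches at least as far to the right.
  have fin : ∀ k1 k1', (∀ i, (v' i).source.2 ≤ (v' k1).source.2) →
      (∀ i, (v' i).source.1 ≤ (v' k1').source.1) →
      ((v' k1).source.2 ≤ (v k).source.2 ∧ (v k').source.1 ≤ (v' k1').source.1 ∨
        (v k).source.2 ≤ (v' k1).source.2 ∧ (v' k1').source.1 ≤ (v k').source.1) → False := by
    intro k1 k1' h1 h2 hor
    rcases hor with ⟨h3, h4⟩ | ⟨h3, h4⟩
    · exact false_of_disjoint hv hv' hper hper' hn hdis w1 w2 hk (fun i => (h1 i).trans h3)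
        (fun i => (hk' i).trans h4) h2
    · exact false_of_disjoint hv' hv hper' hper hn hdis' w2 w1 h1 (fun i => (hk i).trans h3)
        (fun i => (h2 i).trans h4) hk'
  rcases hβ with rfl | rfl
  · have g1 : ∀ i, (v' i).source.1 = d.1 - (v i).source.2 := fun i => by
      rw [hg]
      simp only [Stroke.move, Grid.mul, Grid.step_square_one, Prod.fst_add]
      ring
    have g2 : ∀ i, (v' i).source.2 = d.2 + (v i).source.1 := fun i => by
      rw [hg]
      simp only [Stroke.move, Grid.mul, Grid.step_square_one, Prod.snd_add]
      ring
    have c2 : c.2 = d.1 + d.2 := by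
      rw [hc]
      simp only [Grid.mul, Grid.step_square_one, Prod.snd_add]
      ring
    refine fin k' (p + k) (fun i => ?_) (fun i => ?_) ?_
    · rw [g2, g2]
      have := hk' i
      omega
    · rw [g1, g1, ρ2]
      have := hk (p + i)
      rw [ρ2] at this
      omega
    · rw [g1, g2, ρ2]
      omega
  · have g1 : ∀ i, (v' i).source.1 = d.1 + (v i).source.2 := fun i => by
      rw [hg]
      simp only [Stroke.move, Grid.mul, Grid.step_square_three, Prod.fst_add]
      ring
    have g2 : ∀ i, (v' i).source.2 = d.2 - (v i).source.1 := fun i => by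
      rw [hg]
      simp only [Stroke.move, Grid.mul, Grid.step_square_three, Prod.snd_add]
      ring
    have c1 : c.1 = d.1 + d.2 := by
      rw [hc]
      simp only [Grid.mul, Grid.step_square_three, Prod.fst_add]
      ring
    refine fin (p + k') k (fun i => ?_) (fun i => ?_) ?_
    · rw [g2, g2, ρ1]
      have := hk' (p + i)
      rw [ρ1] at this
      omega
    · rw [g1, g1]
      have := hk i
      omega
    · rw [g1, g2, ρ1]
      omega

end

/-! ### Opposite sides of a square tile -/

section

variable {x : ℕ → Grid.square.Heading} {m : ℕ} {l : Grid.square.Heading}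

theorem tileWalk_half (hm : 0 < m)
    (hβ : lastHeading x m + l = 1 ∨ lastHeading x m + l = 3) (i : ℕ) :
    tileWalk x m l (2 * m + i) = (tileWalk x m l i).move (displacement x m +
      Grid.mul .square (Grid.step .square (lastHeading x m + l)) (displacement x m)) 2 := by
  rw [two_mul, add_assoc, tileWalk_add hm, tileWalk_add hm, Stroke.move_move]
  congr 1
  rcases hβ with h | h <;> rw [h] <;> decide

/-- The walk around a tile does not meet its opposite side. -/
theorem tileWalk_ne_opposite (hx : ∀ j, 0 < j → j < m → Grid.square.IsTurn (x j)) (hm : 0 < m)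
    (h : SimpleOn (tileWalk x m l) (2 * m))
    (hβ : lastHeading x m + l = 1 ∨ lastHeading x m + l = 3) (hl : l = 1 ∨ l = 3) {q p : ℕ}
    (hp : 0 < p) (hqp : q + p < m) : tileWalk x m l (q + p) ≠ tileWalk x m l (2 * m + q) := by
  intro heq
  have hu : IsWalk (tileWalk x m l) := isWalk_tileWalk hx hm (Grid.isTurn_of_or hl)
  have hper : ∀ i, tileWalk x m l (i + 4 * m) = tileWalk x m l i := tileWalk_periodic hm hβ
  have hd : ((displacement x m).1 + (displacement x m).2) % 2 = 1 := by
    have h1 := hu.positive (m + 0)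
    have h2 : tileWalk x m l 0 = Stroke.origin .square := rfl
    rw [tileWalk_add hm, h2, Stroke.move_origin] at h1
    rcases h1 with ⟨-, h1⟩ | ⟨h1, -⟩
    · exfalso
      have : ∀ b : ZMod 4, b = 1 ∨ b = 3 → ¬ (b = 0 ∨ b = 2) := by decide
      exact this _ hβ h1
    · exact h1
  -- `v q` runs through the strokes `q, ..., q + p - 1` of side 0, jumps by `heq` to the same piece
  -- of side 2, and so on: a closed walk on two opposite sides. `v (q + m)` does the same on the
  -- other two sides.
  obtain ⟨v, hv⟩ : ∃ v : ℕ → ℕ → Stroke .square,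
      ∀ a i, v a i = tileWalk x m l (2 * m * (i / p) + (a + i % p)) := ⟨_, fun _ _ => rfl⟩
  have hvs : ∀ a k s, s < p → v a (p * k + s) = tileWalk x m l (2 * m * k + (a + s)) := by
    intro a k s hs
    rw [hv, Nat.mul_add_mod, Nat.mod_eq_of_lt hs, Nat.mul_add_div hp, Nat.div_eq_of_lt hs, add_zero]
  have shift : ∀ k i j, tileWalk x m l i = tileWalk x m l j →
      tileWalk x m l (k * m + i) = tileWalk x m l (k * m + j) := by
    intro k i j hij
    rw [tileWalk_mul_add hm, tileWalk_mul_add hm, hij]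
  have hwalk : ∀ a, tileWalk x m l (a + p) = tileWalk x m l (2 * m + a) → IsWalk (v a) := by
    intro a ha
    refine ⟨fun i => ?_, fun i => ?_⟩
    · have hs := Nat.mod_lt i hp
      rw [← Nat.div_add_mod i p]
      generalize i / p = k
      generalize i % p = s at *
      by_cases h1 : s + 1 < p
      · rw [add_assoc, hvs a k _ h1, hvs a k s hs, ← hu.source_succ]
        rfl
      · have e : p * k + s + 1 = p * (k + 1) + 0 := by rw [Nat.mul_succ]; omega
        have e2 := shift (2 * k) _ _ ha
        rw [e, hvs a _ 0 hp, hvs a k s hs, ← hu.source_succ,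
          show 2 * m * (k + 1) + (a + 0) = 2 * k * m + (2 * m + a) by ring, ← e2,
          show 2 * m * k + (a + s) + 1 = 2 * k * m + (a + (s + 1)) by ring,
          show s + 1 = p by omega]
    · rw [hv]
      exact hu.positive _
  have hq' : tileWalk x m l (q + m + p) = tileWalk x m l (2 * m + (q + m)) := by
    have := shift 1 _ _ heq
    rw [show q + m + p = 1 * m + (q + p) by ring, this]
    congr 1
    ring
  refine false_of_quarter_turn (hwalk q heq) (hwalk (q + m) hq') hp hβ hd (fun k => ?_)
    (fun k => ?_) fun i j => ?_
  · rw [hv, hv, Nat.add_mod_left, Nat.add_div_left _ hp, ← tileWalk_half hm hβ]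
    congr 1
    rw [Nat.mul_succ]
    ring
  · rw [hv, hv, ← tileWalk_add hm]
    congr 1
    ring
  · have hred : ∀ k s, ∃ e, (e = 0 ∨ e = 2) ∧
        tileWalk x m l (2 * m * k + s) = tileWalk x m l (e * m + s) := by
      intro k s
      induction k using Nat.twoStepInduction with
      | zero => exact ⟨0, Or.inl rfl, by simp⟩
      | one => exact ⟨2, Or.inr rfl, by simp⟩
      | more k ih _ =>
        obtain ⟨e, he, h⟩ := ih
        refine ⟨e, he, ?_⟩
        rw [← h, ← hper (2 * m * k + s)]
        congr 1
        ring
    -- A stroke of `v q` and a stroke of `v (q + m)` belong to consecutive sides, which have no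
    -- stroke in common.
    have adj : ∀ k s t, s < m → t < m →
        tileWalk x m l (k * m + s) ≠ tileWalk x m l (k * m + (m + t)) := by
      intro k s t hs ht hst
      have := tileWalk_window_inj hm h k (by omega) (by omega) hst
      omega
    intro hij
    rw [hv, hv] at hij
    have hs : q + i % p < m := by have := Nat.mod_lt i hp; omega
    have ht : q + j % p < m := by have := Nat.mod_lt j hp; omega
    rw [show q + m + j % p = m + (q + j % p) by ring] at hij
    obtain ⟨e, he, h1⟩ := hred (i / p) (q + i % p)
    obtain ⟨e', he', h2⟩ := hred (j / p) (m + (q + j % p))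
    rw [h1, h2] at hij
    rcases he with rfl | rfl <;> rcases he' with rfl | rfl
    · exact adj 0 _ _ hs ht hij
    · refine adj 3 _ _ ht hs ?_
      rw [show 3 * m + (m + (q + i % p)) = 0 * m + (q + i % p) + 4 * m by ring, hper, hij]
      congr 1
      ring
    · refine adj 1 _ _ ht hs ?_
      rw [show 1 * m + (m + (q + i % p)) = 2 * m + (q + i % p) by ring, hij]
      congr 1
      ring
    · exact adj 2 _ _ hs ht hij

theorem isSimpleClosed_of_two_square (hx : ∀ j, 0 < j → j < m → Grid.square.IsTurn (x j))
    (hm : 0 < m) (h : SimpleOn (tileWalk x m l) (2 * m))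
    (hβ : lastHeading x m + l = 1 ∨ lastHeading x m + l = 3) (hl : l = 1 ∨ l = 3) :
    IsSimpleClosed (tileWalk x m l) (Grid.sides .square * m) := by
  have hper : ∀ i, tileWalk x m l (i + 4 * m) = tileWalk x m l i := tileWalk_periodic hm hβ
  have hopp : ∀ s t, s < m → t < m → tileWalk x m l s ≠ tileWalk x m l (2 * m + t) := by
    intro s t hs ht hst
    rcases lt_trichotomy s t with hlt | rfl | hlt
    -- The half-turn of the tile exchanges the two sides and thus reduces this case to the case `t <
    -- s`.
    · refine tileWalk_ne_opposite hx hm h hβ hl (q := s) (p := t - s) (by omega) (by omega) ?_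
      rw [Nat.add_sub_cancel' hlt.le, tileWalk_half hm hβ, hst, tileWalk_half hm hβ,
        Stroke.move_move_opposite]
    · rw [tileWalk_half hm hβ] at hst
      have := congrArg Stroke.heading hst
      have h2 : ∀ b : ZMod 4, b ≠ 2 + b := by decide
      exact h2 _ this
    · refine tileWalk_ne_opposite hx hm h hβ hl (q := t) (p := s - t) (by omega) (by omega) ?_
      rw [Nat.add_sub_cancel' hlt.le, hst]
  have key : ∀ i j, i ≤ j → i < 4 * m → j < 4 * m → tileWalk x m l i = tileWalk x m l j →
      i = j := by
    intro i j hle hi hj hij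
    have win : ∀ k i j, i < 2 * m → j < 2 * m →
        tileWalk x m l (k * m + i) = tileWalk x m l (k * m + j) → i = j :=
      fun k i j hi hj => tileWalk_window_inj hm h k hi hj
    by_cases h1 : j < 2 * m
    · exact win 0 i j (by omega) h1 (by simpa using hij)
    by_cases h2 : 2 * m ≤ i
    · have := win 2 (i - 2 * m) (j - 2 * m) (by omega) (by omega)
        (by rwa [Nat.add_sub_cancel' h2, Nat.add_sub_cancel' (by omega)])
      omega
    by_cases h3 : i < m
    · by_cases h4 : j < 3 * m
      · exact absurd hij (by
          have := hopp i (j - 2 * m) h3 (by omega)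
          rwa [Nat.add_sub_cancel' (by omega)] at this)
      · have := win 3 (i + m) (j - 3 * m) (by omega) (by omega)
          (by
            rw [Nat.add_sub_cancel' (by omega), ← hij, show 3 * m + (i + m) = i + 4 * m by ring,
              hper])
        omega
    · by_cases h4 : j < 3 * m
      · have := win 1 (i - m) (j - m) (by omega) (by omega)
          (by rwa [one_mul, Nat.add_sub_cancel' (by omega), Nat.add_sub_cancel' (by omega)])
        omega
      · exfalso
        refine hopp (i - m) (j - 3 * m) (by omega) (by omega) ?_
        refine Stroke.move_injective (displacement x m) (lastHeading x m + l) ?_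
        rw [← tileWalk_add hm, ← tileWalk_add hm, Nat.add_sub_cancel' (by omega), hij]
        congr 1
        omega
  refine isSimpleClosed_tileWalk hx hm hβ hl ⟨fun i j hi hj hij => ?_, fun i j hi hj hi' => ?_⟩
  · rcases le_total i j with hle | hle
    · exact key i j hle hi hj hij
    · exact (key j i hle hj hi hij.symm).symm
  · have := (isTurn_substTurns hx hm (fun _ _ => Grid.isTurn_of_or hl) (i + 1)
      (Nat.succ_pos i)).square_ne_zero
    rw [← tileWalk_heading_sub, hi', sub_self] at this
    exact absurd rfl this

end


/-! ### Walks on a line and straight curves -/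

section

theorem exists_last_before {P : ℕ → Prop} {a c : ℕ} (ha : P a) (hac : a < c) :
    ∃ j, a ≤ j ∧ j < c ∧ P j ∧ ∀ t, j < t → t < c → ¬ P t := by
  classical
  have h1 := Nat.findGreatest_spec (P := P) (n := c - 1) (by omega : a ≤ c - 1) ha
  have h2 := Nat.le_findGreatest (P := P) (n := c - 1) (by omega : a ≤ c - 1) ha
  have h3 := Nat.findGreatest_le (P := P) (c - 1)
  exact ⟨_, h2, by omega, h1, fun t ht htc => Nat.findGreatest_is_greatest ht (by omega)⟩

theorem walk_straight_source {t : ℕ → Grid.square.Heading} {a n : ℕ} {e : Stroke .square}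
    (h : ∀ i, a < i → i < a + n → t i = 0) : ∀ i < n,
      (walk e t (a + i)).heading = (walk e t a).heading ∧
      (walk e t (a + i)).source = (walk e t a).source + i • Grid.step .square (walk e t a).heading := by
  intro i
  induction i with
  | zero => intro _; simp
  | succ i ih =>
    intro hi
    obtain ⟨h1, h2⟩ := ih (by omega)
    have h3 := h (a + (i + 1)) (by omega) (by omega)
    constructor
    · rw [← add_assoc, walk, ← h1]
      simp only
      rw [add_assoc, h3, add_zero]
    · rw [← add_assoc, walk]
      simp only
      rw [Stroke.target, h1, h2, succ_nsmul, add_assoc]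

/-- A walk on a line that reverses its direction three times repeats a stroke. -/
theorem exists_repeated_stroke {t : ℕ → Grid.square.Heading} {N : ℕ} {e : Stroke .square}
    (ht : ∀ k, 0 < k → k < N → t k = 0 ∨ t k = 2) {a b c : ℕ} (ha0 : 0 < a) (hab : a < b)
    (hbc : b < c) (hc : c < N) (ha : t a = 2) (hb : t b = 2) (hc2 : t c = 2) :
    ∃ i j, i < j ∧ j < N ∧ walk e t i = walk e t j := by
  -- Replace `a` and `b` by reversals `i` and `j` such that `i`, `j`, `c` are consecutive reversals.
  obtain ⟨j, hbj, hjc, hj, hjmax⟩ := exists_last_before (P := fun k => t k = 2) hb hbc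
  obtain ⟨i, hai, hij, hi, himax⟩ := exists_last_before (P := fun k => t k = 2) ha (c := j) (by omega)
  obtain ⟨i', rfl⟩ : ∃ i', i = i' + 1 := ⟨i - 1, by omega⟩
  have z1 := walk_straight_source (e := e) (t := t) (a := i' + 1) (n := j - (i' + 1))
    fun k h1 h2 => (ht k (by omega) (by omega)).resolve_right (himax k h1 (by omega))
  have z2 := walk_straight_source (e := e) (t := t) (a := j) (n := c - j)
    fun k h1 h2 => (ht k (by omega) (by omega)).resolve_right (hjmax k h1 (by omega))
  obtain ⟨j', rfl⟩ : ∃ j', j = j' + 1 := ⟨j - 1, by omega⟩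
  obtain ⟨c', rfl⟩ : ∃ c', c = c' + 1 := ⟨c - 1, by omega⟩
  obtain ⟨p, hp⟩ : ∃ p, p = j' - i' := ⟨_, rfl⟩
  obtain ⟨q, hq⟩ : ∃ q, q = c' - j' := ⟨_, rfl⟩
  obtain rfl : j' = i' + p := by omega
  obtain rfl : c' = i' + p + q := by omega
  obtain ⟨s, hs⟩ : ∃ s, s = walk e t i' := ⟨_, rfl⟩
  have opp : ∀ h : Grid.square.Heading, Grid.step .square (h + 2) = -Grid.step .square h := by
    intro h
    rcases Grid.square_heading h with rfl | rfl | rfl | rfl <;> decide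
  have two : ∀ h : Grid.square.Heading, h + 2 + 2 = h := by
    intro h
    rcases Grid.square_heading h with rfl | rfl | rfl | rfl <;> decide
  have w1 : walk e t (i' + 1) = ⟨s.target, s.heading + 2⟩ := by rw [walk, hi, hs]
  have w2 : walk e t (i' + p + 1) =
      ⟨s.target + p • Grid.step .square (s.heading + 2), s.heading⟩ := by
    have := z1 (p - 1) (by omega)
    rw [w1, show i' + 1 + (p - 1) = i' + p by omega] at this
    rw [walk, hj, this.1, Stroke.target, this.1, this.2, add_assoc, ← succ_nsmul]
    refine Stroke.ext ?_ ?_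
    · simp only
      rw [show p - 1 + 1 = p by omega]
    · simp only
      rw [two]
  -- After the first reversal the walk goes `p` steps back, after the second one `q` steps forward.
  -- If `q < p`, the third reversal sends it again over the backward run; otherwise the forward run
  -- reaches the stroke before the first reversal.
  rcases Nat.lt_or_ge q p with hlt | hge
  · refine ⟨i' + 1 + (p - q), i' + p + q + 1, by omega, hc, ?_⟩
    have e1 := z1 (p - q) (by omega)
    have e2 := z2 (q - 1) (by omega)
    rw [w1] at e1
    rw [w2, show i' + p + 1 + (q - 1) = i' + p + q by omega] at e2
    refine Stroke.ext ?_ ?_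
    · rw [e1.2]
      change s.target + (p - q) • _ = (walk e t (i' + p + q)).source +
        Grid.step .square (walk e t (i' + p + q)).heading
      rw [e2.1, e2.2, add_assoc]
      simp only
      rw [← succ_nsmul, show q - 1 + 1 = q by omega, opp]
      obtain ⟨k, rfl⟩ : ∃ k, p = q + k := ⟨p - q, by omega⟩
      rw [Nat.add_sub_cancel_left]
      simp only [nsmul_eq_mul]
      push_cast
      ring
    · rw [e1.1, walk, hc2, e2.1]
  · refine ⟨i', i' + p + 1 + (p - 1), by omega, by omega, ?_⟩
    have e2 := z2 (p - 1) (by omega)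
    rw [w2] at e2
    refine Stroke.ext ?_ ?_
    · rw [e2.2, ← hs]
      simp only
      rw [opp, Stroke.target]
      obtain ⟨k, rfl⟩ : ∃ k, p = k + 1 := ⟨p - 1, by omega⟩
      rw [Nat.add_sub_cancel]
      simp only [nsmul_eq_mul]
      push_cast
      ring
    · rw [e2.1, ← hs]

variable {G : Grid} {x : ℕ → G.Heading} {m : ℕ} {l : G.Heading}

/-- Iterates of a straight curve contain no turns and say nothing about the tiles, so two sides have
to be checked directly. -/
theorem simpleOn_tileWalk_of_straight (hx : ∀ j, 0 < j → j < m → x j = 0) (hm : 0 < m)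
    (hl : l = G.turn ∨ l = -G.turn) : SimpleOn (tileWalk x m l) (2 * m) := by
  have hX : ∀ i < m, walk (Stroke.origin G) x i = ⟨((i : ℤ), (0 : ℤ)), 0⟩ := by
    intro i
    induction i with
    | zero => intro _; rfl
    | succ i ih =>
      intro hi
      rw [walk, ih (by omega), hx _ (by omega) hi]
      refine Stroke.ext ?_ (add_zero _)
      simp [Stroke.target, G.step_zero]
  have hr : lastHeading x m = 0 := by rw [lastHeading, hX _ (by omega)]
  have hd : displacement x m = ((m : ℤ), (0 : ℤ)) := by
    rw [displacement, hX _ (by omega), Stroke.target, G.step_zero]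
    refine Prod.ext ?_ rfl
    simp only [Prod.fst_add]
    omega
  have b0 : ∀ i < m, tileWalk x m l i = ⟨((i : ℤ), (0 : ℤ)), 0⟩ := fun i hi => by
    rw [tileWalk_eq_walk hi, hX i hi]
  have b1 : ∀ i, tileWalk x m l (m + i) = (tileWalk x m l i).move ((m : ℤ), (0 : ℤ)) l := fun i => by
    rw [tileWalk_add hm, hr, hd, zero_add]
  have hl0 := G.ne_zero_of_or hl
  have h0 : ∀ i < m, (tileWalk x m l i).heading = 0 := fun i hi => by rw [b0 i hi]
  have h1 : ∀ i, m ≤ i → i < 2 * m → (tileWalk x m l i).heading = l := by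
    intro i h1 h2
    obtain ⟨k, rfl⟩ := Nat.exists_eq_add_of_le h1
    rw [b1, Stroke.move]
    simp only
    rw [h0 k (by omega), add_zero]
  have hstep : (G.step l).2 ≠ 0 := by
    cases G
    · rcases hl with rfl | rfl <;> decide
    · rcases hl with rfl | rfl <;> decide
  have s1 : ∀ i, i < m → (tileWalk x m l (m + i)).source.2 = (G.step l).2 * i := by
    intro i hi
    rw [b1, b0 i hi, Stroke.move, Grid.mul_comm, G.mul_eq]
    simp [_root_.mul_comm]
  have cross : ∀ i j, i + 1 < m → m ≤ j → j + 1 < 2 * m →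
      (tileWalk x m l (i + 1)).source ≠ (tileWalk x m l (j + 1)).source := by
    intro i j hi hj hj' hij
    obtain ⟨k, rfl⟩ := Nat.exists_eq_add_of_le hj
    have := congrArg Prod.snd hij
    rw [add_assoc, s1 _ (by omega), b0 _ hi] at this
    simp only at this
    exact (mul_ne_zero hstep (by omega)) this.symm
  have hst : ∀ i, (tileWalk x m l (i + 1)).heading = (tileWalk x m l i).heading → i + 1 ≠ m := by
    intro i hi e
    exact tileWalk_heading_ne hl0 hi (by rw [e, Nat.mod_self])
  refine ⟨fun i j hi hj hij => ?_, fun i j hi hj hi' hj' hij => ?_⟩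
  · have hh := congrArg Stroke.heading hij
    rcases Nat.lt_or_ge i m with h2 | h2 <;> rcases Nat.lt_or_ge j m with h3 | h3
    · rw [b0 i h2, b0 j h3] at hij
      have := congrArg (fun p : ℤ × ℤ => p.1) (Stroke.mk.inj hij).1
      simpa using this
    · rw [h0 i h2, h1 j h3 hj] at hh
      exact absurd hh.symm hl0
    · rw [h1 i h2 hi, h0 j h3] at hh
      exact absurd hh hl0
    · obtain ⟨i, rfl⟩ := Nat.exists_eq_add_of_le h2
      obtain ⟨j, rfl⟩ := Nat.exists_eq_add_of_le h3
      rw [b1, b1] at hij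
      have := Stroke.move_injective _ _ hij
      rw [b0 i (by omega), b0 j (by omega)] at this
      have := congrArg (fun p : ℤ × ℤ => p.1) (Stroke.mk.inj this).1
      simpa using this
  · have si := hst i hi'
    have sj := hst j hj'
    rcases Nat.lt_or_ge i m with h2 | h2 <;> rcases Nat.lt_or_ge j m with h3 | h3
    · rw [h0 i h2, h0 j h3]
    · exact absurd hij (cross i j (by omega) h3 hj)
    · exact absurd hij.symm (cross j i (by omega) h2 hi)
    · rw [h1 i h2 (by omega), h1 j h3 (by omega)]

theorem isSimpleClosed_of_two (hx : ∀ j, 0 < j → j < m → G.IsTurn (x j)) (hm : 0 < m)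
    (h : SimpleOn (tileWalk x m l) (2 * m))
    (hβ : lastHeading x m + l = G.turn ∨ lastHeading x m + l = -G.turn)
    (hl : l = G.turn ∨ l = -G.turn) : IsSimpleClosed (tileWalk x m l) (G.sides * m) := by
  cases G
  · exact isSimpleClosed_of_two_square hx hm h hβ hl
  · exact isSimpleClosed_of_two_triangular hx hm h hβ hl

end


/-! ### From self-avoiding iterates to tiles -/

section

variable {m : ℕ}

theorem iterTurns_eq_const {G : Grid} {x : ℕ → G.Heading} {l : G.Heading} (hm : 0 < m)
    (h : ∀ j, 0 < j → j < m → x j = l) (n : ℕ) :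
    ∀ i, 0 < i → i < m ^ n → iterTurns G x m n i = l := by
  induction n with
  | zero =>
    intro i hi hin
    rw [pow_zero] at hin
    omega
  | succ n ih =>
    intro i hi hin
    rw [iterTurns, substTurns]
    split_ifs with h0
    · refine ih _ (Nat.div_pos (Nat.le_of_dvd hi (Nat.dvd_of_mod_eq_zero h0)) hm) ?_
      rw [pow_succ'] at hin
      exact Nat.div_lt_of_lt_mul hin
    · exact h _ (Nat.pos_of_ne_zero h0) (Nat.mod_lt _ hm)

/-- A self-avoiding iterate of at least five strokes does not make the same turn everywhere. -/
theorem exists_ne_of_simpleOn_square {x : ℕ → Grid.square.Heading} {l : Grid.square.Heading}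
    (hm : 2 ≤ m) (hl : l = 1 ∨ l = 3)
    (hC : SimpleOn (walk (Stroke.origin .square) (iterTurns .square x m 3)) (m ^ 3)) :
    ∃ j, 0 < j ∧ j < m ∧ x j ≠ l := by
  by_contra! hc
  have h1 := iterTurns_eq_const (by omega) hc 3
  have h8 : 2 ^ 3 ≤ m ^ 3 := Nat.pow_le_pow_left hm 3
  have h2 := walk_congr (Stroke.origin .square) h1 (N := m ^ 3) 4 (by omega)
  have h3 : walk (Stroke.origin .square) (fun _ => l) 4 = Stroke.origin .square := by
    rcases hl with rfl | rfl <;> rfl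
  have := hC.inj 4 0 (by omega) (by omega) (h2.trans h3)
  omega

/-- For an odd end heading, the third iterate consists of copies along a base curve that moves on a
line. The turn `2 - lastHeading x m` occurs in every copy of `x` and reverses this motion; three
reversals repeat a base stroke, hence a whole copy. -/
theorem lastHeading_even {x : ℕ → Grid.square.Heading}
    (hx : ∀ j, 0 < j → j < m → Grid.square.IsTurn (x j))
    (hC : SimpleOn (walk (Stroke.origin .square) (iterTurns .square x m 3)) (m ^ 3))
    (h : ∀ l : Grid.square.Heading, l = 1 ∨ l = 3 → ∃ j, 0 < j ∧ j < m ∧ x j = l) :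
    lastHeading x m = 0 ∨ lastHeading x m = 2 := by
  by_contra hr
  have dec : ∀ r : ZMod 4, ¬ (r = 0 ∨ r = 2) → (2 - r = 1 ∨ 2 - r = 3) ∧
      (1 + r = 0 ∨ 1 + r = 2) ∧ (-1 + r = 0 ∨ -1 + r = 2) ∧ 2 - r + r = 2 := by decide
  obtain ⟨d1, d2, d3, d4⟩ := dec _ hr
  obtain ⟨j, hj, hjm, hjl⟩ := h _ d1
  have hm3 : 3 ≤ m := by
    obtain ⟨j1, a1, a2, a3⟩ := h 1 (Or.inl rfl)
    obtain ⟨j2, b1, b2, b3⟩ := h 3 (Or.inr rfl)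
    have : j1 ≠ j2 := by
      rintro rfl
      rw [a3] at b3
      revert b3
      decide
    omega
  have hm : 0 < m := by omega
  have hT2 : ∀ a, iterTurns .square x m 2 (m * a + j) + lastHeading x m = 2 := by
    intro a
    rw [iterTurns, substTurns, Nat.mul_add_mod, Nat.mod_eq_of_lt hjm, if_neg (by omega)]
    exact (congrArg (· + lastHeading x m) hjl).trans d4
  -- Both turns occur in `x`, so `m` is at least 3, which leaves room for three reversals.
  have hmm : m * 2 + j < m ^ 2 := by
    have : m * 3 ≤ m * m := Nat.mul_le_mul_left m hm3
    rw [pow_two]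
    omega
  obtain ⟨a, b, hab, hb, heq⟩ := exists_repeated_stroke (e := Stroke.origin .square) (N := m ^ 2)
    (t := fun i => iterTurns .square x m 2 i + lastHeading x m)
    (fun k hk _ => by
      rcases isTurn_iterTurns hx hm 2 k hk with h | h | ⟨h, -⟩
      · rw [h]; exact d2
      · rw [h]; exact d3
      · cases h)
    (a := m * 0 + j) (b := m * 1 + j) (c := m * 2 + j) (by omega) (by omega) (by omega) hmm
    (hT2 0) (hT2 1) (hT2 2)
  have key : ∀ k, walk (Stroke.origin .square) (iterTurns .square x m 3) (m * k) =
      Stroke.place (displacement x m) (walk (Stroke.origin .square)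
        (fun i => iterTurns .square x m 2 i + lastHeading x m) k) (Stroke.origin .square) :=
    fun k => walk_substTurns x (iterTurns .square x m 2) hm k 0 hm
  have hlt : ∀ k, k < m ^ 2 → m * k < m ^ 3 := fun k hk => by
    rw [show m ^ 3 = m * m ^ 2 by ring]
    exact Nat.mul_lt_mul_of_pos_left hk hm
  have := hC.inj (m * a) (m * b) (hlt a (by omega)) (hlt b hb) (by rw [key, key, heq])
  have := Nat.eq_of_mul_eq_mul_left hm this
  omega

theorem totalTurn_pos {G : Grid} {x : ℕ → G.Heading} {s : ℤ}
    (h0 : ∀ j, 0 < j → j < m → 0 ≤ s * G.turnInt (x j))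
    (h1 : ∃ j, 0 < j ∧ j < m ∧ 0 < s * G.turnInt (x j)) : 0 < s * totalTurn x m := by
  rw [totalTurn, Finset.mul_sum]
  refine Finset.sum_pos' (fun j hj => ?_) ?_
  · rw [Finset.mem_Ico] at hj
    exact h0 j hj.1 hj.2
  · obtain ⟨j, a, b, c⟩ := h1
    exact ⟨j, Finset.mem_Ico.2 ⟨a, b⟩, c⟩

/-- On the triangular grid: if the second iterate is self-avoiding and not straight, then both turns
occur and the total turn is zero. -/
theorem totalTurn_eq_zero {x : ℕ → Grid.triangular.Heading}
    (hx : ∀ j, 0 < j → j < m → Grid.triangular.IsTurn (x j)) (hm : 0 < m)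
    (hC : SimpleOn (walk (Stroke.origin .triangular) (iterTurns .triangular x m 2)) (m ^ 2))
    (h : ∃ j, 0 < j ∧ j < m ∧ x j ≠ 0) :
    totalTurn x m = 0 ∧ ∀ l : Grid.triangular.Heading,
      l = Grid.turn .triangular ∨ l = -Grid.turn .triangular → ∃ j, 0 < j ∧ j < m ∧ x j = l := by
  have t1 := Grid.turnInt_turn .triangular
  have t2 := Grid.turnInt_neg_turn .triangular
  have t0 := turnInt_zero .triangular
  -- Two sides joined by `l` are self-avoiding. Either they are translates and the turn per side is
  -- 0, or the tile closes up and it is 1 or -1. If both turns occur, the two estimates leave only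
  -- total turn 0; a single kind of turn would violate its own estimate.
  have key : ∀ l : Grid.triangular.Heading,
      l = Grid.turn .triangular ∨ l = -Grid.turn .triangular →
      (∃ j, 0 < j ∧ j < m ∧ x j = l) → -1 ≤ totalTurn x m + Grid.turnInt .triangular l ∧
        totalTurn x m + Grid.turnInt .triangular l ≤ 1 := by
    rintro l hl ⟨j, hj, hjm, hjl⟩
    have h2 := simpleOn_tileWalk_two hC hj hjm hjl
    have hr := lastHeading_eq hx
    have dec : ∀ (k l : ZMod 6), l = 2 ∨ l = -2 → k * 2 + l = 0 ∨ k * 2 + l = 2 ∨ k * 2 + l = -2 := by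
      decide
    rcases dec ((totalTurn x m : ℤ) : ZMod 6) l hl with h0 | h0
    · have := totalTurn_of_translation hx hm (Grid.isTurn_of_or hl) (by rw [hr]; exact h0) h2
      omega
    · obtain ⟨c, hc, -, -, -, e⟩ := exists_totalTurn hm
        (isSimpleClosed_of_two hx hm h2 (by rw [hr]; exact h0) hl)
      omega
  have hval : ∀ j, 0 < j → j < m → x j = Grid.turn .triangular ∨ x j = -Grid.turn .triangular ∨
      x j = 0 := fun j hj hjm => by
    rcases hx j hj hjm with h | h | ⟨-, h⟩
    · exact Or.inl h
    · exact Or.inr (Or.inl h)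
    · exact Or.inr (Or.inr h)
  obtain ⟨j0, hj0, hj0m, hne⟩ := h
  by_cases hp : ∃ j, 0 < j ∧ j < m ∧ x j = Grid.turn .triangular <;>
  by_cases hn : ∃ j, 0 < j ∧ j < m ∧ x j = -Grid.turn .triangular
  · have k1 := key _ (Or.inl rfl) hp
    have k2 := key _ (Or.inr rfl) hn
    rw [t1] at k1
    rw [t2] at k2
    refine ⟨by omega, ?_⟩
    rintro l (rfl | rfl)
    · exact hp
    · exact hn
  · have k1 := key _ (Or.inl rfl) hp
    have := totalTurn_pos (G := .triangular) (x := x) (m := m) (s := 1) (fun j hj hjm => by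
      rcases hval j hj hjm with h | h | h
      · rw [h, t1]; decide
      · exact absurd ⟨j, hj, hjm, h⟩ hn
      · rw [h, t0]; decide) (by
      obtain ⟨j, hj, hjm, h⟩ := hp
      exact ⟨j, hj, hjm, by rw [h, t1]; decide⟩)
    omega
  · have k1 := key _ (Or.inr rfl) hn
    have := totalTurn_pos (G := .triangular) (x := x) (m := m) (s := -1) (fun j hj hjm => by
      rcases hval j hj hjm with h | h | h
      · exact absurd ⟨j, hj, hjm, h⟩ hp
      · rw [h, t2]; decide
      · rw [h, t0]; decide) (by
      obtain ⟨j, hj, hjm, h⟩ := hn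
      exact ⟨j, hj, hjm, by rw [h, t2]; decide⟩)
    omega
  · rcases hval j0 hj0 hj0m with h | h | h
    · exact absurd ⟨j0, hj0, hj0m, h⟩ hp
    · exact absurd ⟨j0, hj0, hj0m, h⟩ hn
    · exact absurd h hne

/-- If the iterates are self-avoiding, then the walks around both tiles are. -/
theorem isSimpleClosed_of_iterTurns {G : Grid} {x : ℕ → G.Heading} {l : G.Heading}
    (hx : ∀ j, 0 < j → j < m → G.IsTurn (x j)) (hm : 0 < m)
    (hC : ∀ n, SimpleOn (walk (Stroke.origin G) (iterTurns G x m n)) (m ^ n))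
    (hl : l = G.turn ∨ l = -G.turn) : IsSimpleClosed (tileWalk x m l) (G.sides * m) := by
  by_cases h0 : ∀ j, 0 < j → j < m → x j = 0
  · have hr : lastHeading x m = 0 := by
      rw [lastHeading_eq hx, totalTurn, Finset.sum_eq_zero, Int.cast_zero, MulZeroClass.zero_mul]
      intro j hj
      rw [Finset.mem_Ico] at hj
      rw [h0 j hj.1 hj.2, turnInt_zero]
    exact isSimpleClosed_of_two hx hm (simpleOn_tileWalk_of_straight h0 hm hl)
      (by rwa [hr, zero_add]) hl
  push Not at h0
  cases G
  · have hm2 : 2 ≤ m := by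
      obtain ⟨j, h1, h2, -⟩ := h0
      omega
    have hval : ∀ j, 0 < j → j < m → x j = 1 ∨ x j = 3 := fun j hj hjm => by
      rcases hx j hj hjm with h | h | ⟨h, -⟩
      · exact Or.inl h
      · exact Or.inr h
      · cases h
    have both : ∀ l : Grid.square.Heading, l = 1 ∨ l = 3 → ∃ j, 0 < j ∧ j < m ∧ x j = l := by
      rintro l (rfl | rfl)
      · obtain ⟨j, h1, h2, h3⟩ := exists_ne_of_simpleOn_square hm2 (Or.inr rfl) (hC 3)
        exact ⟨j, h1, h2, (hval j h1 h2).resolve_right h3⟩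
      · obtain ⟨j, h1, h2, h3⟩ := exists_ne_of_simpleOn_square hm2 (Or.inl rfl) (hC 3)
        exact ⟨j, h1, h2, (hval j h1 h2).resolve_left h3⟩
    obtain ⟨j, h1, h2, h3⟩ := both l hl
    have dec : ∀ r l : ZMod 4, r = 0 ∨ r = 2 → l = 1 ∨ l = 3 → r + l = 1 ∨ r + l = 3 := by decide
    exact isSimpleClosed_of_two hx hm (simpleOn_tileWalk_two (hC 2) h1 h2 h3)
      (dec _ _ (lastHeading_even hx (hC 3) both) hl) hl
  · obtain ⟨e, both⟩ := totalTurn_eq_zero hx hm (hC 2) h0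
    obtain ⟨j, h1, h2, h3⟩ := both l hl
    refine isSimpleClosed_of_two hx hm (simpleOn_tileWalk_two (hC 2) h1 h2 h3) ?_ hl
    rwa [lastHeading_eq hx, e, Int.cast_zero, MulZeroClass.zero_mul, zero_add]

end


/-! # The main theorem -/

section

theorem mem_turnList_triangular {w : List Letter} {a t : Grid.triangular.Heading}
    (ha : Grid.triangular.IsTurn a) (ht : t ∈ turnList .triangular a w) :
    Grid.triangular.IsTurn t := by
  have h0 : Grid.triangular.IsTurn 0 := Or.inr (Or.inr ⟨rfl, rfl⟩)
  have dec : ∀ a : ZMod 6, a = 2 ∨ a = -2 ∨ a = 0 →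
      (a + 2 = 2 ∨ a + 2 = -2 ∨ a + 2 = 0) ∧ (a - 2 = 2 ∨ a - 2 = -2 ∨ a - 2 = 0) := by decide
  have iff : ∀ a : Grid.triangular.Heading, Grid.triangular.IsTurn a ↔
      a = Grid.turn .triangular ∨ a = -Grid.turn .triangular ∨ a = 0 := fun a => by
    simp [Grid.IsTurn]
  induction w generalizing a with
  | nil => cases ht
  | cons l w ih =>
    cases l
    · rcases List.mem_cons.1 ht with rfl | ht
      · exact ha
      · exact ih h0 ht
    · exact ih ((iff _).2 (dec a ((iff a).1 ha)).1) ht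
    · exact ih ((iff _).2 (dec a ((iff a).1 ha)).2) ht
    · exact ih ha ht

theorem isTurn_wordTurns_triangular (X : List Letter) (j : ℕ) :
    Grid.triangular.IsTurn (wordTurns .triangular X j) := by
  have h0 : Grid.triangular.IsTurn 0 := Or.inr (Or.inr ⟨rfl, rfl⟩)
  rw [wordTurns, List.getD_eq_getElem?_getD]
  rcases h : (0 :: turnList Grid.triangular 0 X)[j]? with _ | t
  · exact h0
  · rcases List.mem_cons.1 (List.mem_of_getElem? h) with h' | h'
    · rw [Option.getD_some, h']
      exact h0
    · exact mem_turnList_triangular h0 h'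

variable {G : Grid} {X : List Letter}

theorem curve_eq_map : curve G (Letter.F :: X) =
    (List.range (wordLength G X)).map (walk (Stroke.origin G) (wordTurns G X)) := by
  have := turtle_eq_map G (Letter.F :: X) 0 0 0
  have e : (turnList G 0 (Letter.F :: X)).getD 0 0 = 0 := rfl
  rw [add_zero, e, add_zero] at this
  exact this

theorem wordTurns_square_ne_zero (h : IsAdmissible .square (Letter.F :: X)) {j : ℕ} (hj : 0 < j)
    (hjm : j < wordLength .square X) : wordTurns .square X j ≠ 0 := by
  obtain ⟨-, -, h⟩ := h
  simp only [curve_eq_map] at h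
  obtain ⟨k, rfl⟩ : ∃ k, j = k + 1 := ⟨j - 1, by omega⟩
  have := h _ (mem_passages.2 ⟨k, hjm, rfl⟩)
  simp only [walk] at this
  intro h0
  rw [h0, add_zero] at this
  exact this rfl

theorem not_nodup_of_reversal {t : ℕ → Grid.square.Heading} {e : Stroke .square} {N j : ℕ}
    (hj : j + 1 < N) (ht : t (j + 1) = 2) :
    ¬ (((List.range N).map (walk e t)).map Stroke.edge).Nodup := by
  rw [nodup_edges_iff]
  intro h
  have opp : ∀ h : Grid.square.Heading, Grid.step .square (h + 2) = -Grid.step .square h := by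
    intro h
    rcases Grid.square_heading h with rfl | rfl | rfl | rfl <;> decide
  have htgt : (walk e t (j + 1)).target = (walk e t j).source := by
    change (walk e t j).source + Grid.step .square _ +
      Grid.step .square ((walk e t j).heading + t (j + 1)) = _
    rw [ht, opp, add_neg_cancel_right]
  have := h j (j + 1) (by omega) hj (by
    rw [Stroke.edge, Stroke.edge, htgt, Sym2.eq_swap]
    rfl)
  omega

/-- On the square grid admissibility still permits a reversal. It retraces an edge at once, both in
$C_1$ and in a tile, so that both sides of the equivalence fail. -/
theorem isTurn_wordTurns_or (h : IsAdmissible G (Letter.F :: X)) :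
    (∀ j, 0 < j → j < wordLength G X → G.IsTurn (wordTurns G X j)) ∨
      ¬ (((List.range (wordLength G X ^ 1)).map
        (walk (Stroke.origin G) (iterTurns G (wordTurns G X) (wordLength G X) 1))).map
          Stroke.edge).Nodup ∧
      ¬ (((List.range (G.sides * wordLength G X)).map
        (tileWalk (wordTurns G X) (wordLength G X) G.turn)).map Stroke.edge).Nodup := by
  cases G
  · by_cases hc : ∃ j, 0 < j ∧ j < wordLength .square X ∧ wordTurns .square X j = 2
    · right
      obtain ⟨j, hj, hjm, h2⟩ := hc
      obtain ⟨k, rfl⟩ : ∃ k, j = k + 1 := ⟨j - 1, by omega⟩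
      have h3 : ∀ A : ℕ → Grid.square.Heading,
          substTurns (wordTurns .square X) (wordLength .square X) A (k + 1) = 2 := fun A => by
        rw [substTurns, Nat.mod_eq_of_lt hjm, if_neg (by omega), h2]
      refine ⟨not_nodup_of_reversal (j := k) (by rwa [pow_one]) (h3 _),
        not_nodup_of_reversal (j := k) ?_ (h3 _)⟩
      simp only [Grid.sides]
      omega
    · left
      intro j hj hjm
      have h0 := wordTurns_square_ne_zero h hj hjm
      have h2 : wordTurns .square X j ≠ 2 := fun h2 => hc ⟨j, hj, hjm, h2⟩
      have dec : ∀ t : ZMod 4, t ≠ 0 → t ≠ 2 → t = 1 ∨ t = -1 := by decide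
      exact Grid.isTurn_of_or (dec _ h0 h2)
  · exact Or.inl fun j _ _ => isTurn_wordTurns_triangular X j

end

theorem mainTheorem1 (G : Grid) (X : List Letter) (hX : IsAdmissible G X) :
    (∀ c ∈ iterates G X, SelfAvoiding c) ↔
      (ClosedSelfAvoiding (tile G X Letter.plus) ∧
        ClosedSelfAvoiding (tile G X Letter.minus)) := by
  obtain ⟨Y, rfl⟩ : ∃ Y, X = Letter.F :: Y := by
    obtain ⟨h, -⟩ := hX
    cases X with
    | nil => cases h
    | cons l Y =>
      rw [List.head?_cons, Option.some.injEq] at h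
      exact ⟨Y, by rw [h]⟩
  have hlast := hX.2.1
  have hplus : tile G (Letter.F :: Y) Letter.plus =
      (List.range (G.sides * wordLength G Y)).map
        (tileWalk (wordTurns G Y) (wordLength G Y) G.turn) :=
    tile_eq G hlast fun w => by rw [turnList, zero_add]
  have hminus : tile G (Letter.F :: Y) Letter.minus =
      (List.range (G.sides * wordLength G Y)).map
        (tileWalk (wordTurns G Y) (wordLength G Y) (-G.turn)) :=
    tile_eq G hlast fun w => by rw [turnList, zero_sub]
  have hm : 0 < wordLength G Y := Nat.succ_pos _
  simp only [iterates, Set.forall_mem_range, curve_iterate G hlast, hplus, hminus]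
  rcases isTurn_wordTurns_or hX with hx | ⟨h1, h2⟩
  · have hw := fun n => isWalk_walk (Stroke.positive_origin G) (isTurn_iterTurns hx hm n)
    simp only [(hw _).selfAvoiding_iff]
    constructor
    · intro hC
      exact ⟨(isSimpleClosed_of_iterTurns hx hm hC (Or.inl rfl)).closedSelfAvoiding,
        (isSimpleClosed_of_iterTurns hx hm hC (Or.inr rfl)).closedSelfAvoiding⟩
    · rintro ⟨h1, h2⟩
      refine simpleOn_iterTurns hx hm ?_
      rintro l (rfl | rfl)
      · exact (isWalk_tileWalk hx hm G.isTurn_turn).simpleOn_of_closedSelfAvoiding h1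
      · exact (isWalk_tileWalk hx hm G.isTurn_neg_turn).simpleOn_of_closedSelfAvoiding h2
  · exact ⟨fun h => absurd (h 1).1 h1, fun h => absurd h.1.1 h2⟩
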